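/- All graphs are finite and undirected; they may have parallel edges but no self-loops. A feedback vertex set of a graph $G$ is a set $S\subseteq V(G)$ such that $G-S$ is acyclic (two parallel edges form a cycle), and it is minimum if no feedback vertex set of $G$ has fewer vertices. For a graph $G$ and an integer $k\ge 0$ let $\#\mathrm{minFVS}(G,k)$ be the number of minimum feedback vertex sets of $G$ that have size at most $k$; so it is $0$ if every feedback vertex set of $G$ has more than $k$ vertices, and otherwise it is the number of all minimum feedback vertex sets of $G$. Lemma. There is an algorithm that, given a graph $G$ on $n$ vertices (as its adjacency matrix of edge multiplicities) and an integer $k\ge 0$, computes $\#\mathrm{minFVS}(G,k)$ (in binary) in time $26^k\cdot \mathrm{poly}(n)$, and hence in time $2^{\mathcal{O}(k)}\cdot\mathrm{poly}(n)$. Here an algorithm is a finite system of first-order recursive functions over binary trees (Lisp-style lists), numbers are lists of bits, and the running time is the number of evaluation steps, where reading a variable, forming a pair, a projection of a pair, a test for the empty tree and a function call each count as one step. -/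

import Mathlib

namespace CountFVS

/-! ### Multigraphs and minimum feedback vertex sets -/

/-- An undirected graph on the vertex set `V`, possibly with parallel edges, without self-loops.
The multiset of edges is given by the multiplicity of every unordered pair of vertices. -/
structure Multigraph (V : Type*) where
  mult : Sym2 V → ℕ
  loopless : ∀ v : V, mult s(v, v) = 0

namespace Multigraph

variable {V : Type*}

/-- The graph `G - S`, that is, the subgraph induced by the vertices outside `S`. -/
def deleteVerts (G : Multigraph V) (S : Finset V) : Multigraph {v : V // v ∉ S} where
  mult e := G.mult (e.map Subtype.val)
  loopless v := G.loopless v.val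

/-- The edges `v₀v₁, v₁v₂, …, vₗv₀` run through by the cyclic sequence `v₀, v₁, …, vₗ`. -/
def cyclicEdges (c : List V) : List (Sym2 V) :=
  List.zipWith (fun u v => s(u, v)) c (c.rotate 1)

/-- A cycle of `G`: at least two distinct vertices in cyclic order such that the edges
run through, counted with multiplicity, are available in `G`. In particular two vertices
form a cycle exactly if at least two parallel edges join them. -/
def IsCycle [DecidableEq V] (G : Multigraph V) (c : List V) : Prop :=
  c.Nodup ∧ 2 ≤ c.length ∧ ∀ e : Sym2 V, (cyclicEdges c).count e ≤ G.mult e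

/-- `G` is a forest. -/
def IsAcyclic [DecidableEq V] (G : Multigraph V) : Prop :=
  ∀ c : List V, ¬ G.IsCycle c

/-- `S` is a feedback vertex set of `G`. -/
def IsFVS [DecidableEq V] (G : Multigraph V) (S : Finset V) : Prop :=
  (G.deleteVerts S).IsAcyclic

/-- `S` is a feedback vertex set of `G` of minimum size. -/
def IsMinimumFVS [DecidableEq V] (G : Multigraph V) (S : Finset V) : Prop :=
  G.IsFVS S ∧ ∀ T : Finset V, G.IsFVS T → S.card ≤ T.card

/-- `#minFVS(G, k)`: the number of minimum feedback vertex sets of `G` that have size at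
most `k`. It is `0` if the feedback vertex number of `G` exceeds `k`. -/
noncomputable def numMinFVS [DecidableEq V] (G : Multigraph V) (k : ℕ) : ℕ :=
  Set.ncard {S : Finset V | G.IsMinimumFVS S ∧ S.card ≤ k}

end Multigraph

/-! ### The model of computation

Programs are finite systems of (mutually) recursive first-order functions over binary trees
(pure first-order Lisp whose only atom is `nil`). The primitive operations are reading a
variable, `nil`, pairing, the two projections and the test for `nil`; every one of them,
and every function call, is one step (constant time on a pointer machine). -/

/-- Values: binary trees. -/
inductive Data where
  | nil : Data
  | cons : Data → Data → Data

namespace Data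

/-- First component of a pair; `nil` for `nil`. -/
def head : Data → Data
  | nil => nil
  | cons a _ => a

/-- Second component of a pair; `nil` for `nil`. -/
def tail : Data → Data
  | nil => nil
  | cons _ b => b

/-- A list, as a chain of pairs that ends in `nil`. -/
def ofList : List Data → Data
  | [] => nil
  | x :: xs => cons x (ofList xs)

/-- A bit. -/
def ofBool : Bool → Data
  | false => nil
  | true => cons nil nil

/-- A natural number in binary: the list of its bits, least significant bit first, without
leading zeros. -/
def ofNat (m : ℕ) : Data :=
  ofList (m.bits.map ofBool)

end Data

/-- Program expressions. Variables are numbered by the innermost binding first. -/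
inductive Code where
  | var (i : ℕ) : Code
  | nil : Code
  | cons (a b : Code) : Code
  | head (a : Code) : Code
  | tail (a : Code) : Code
  /-- `ite c a b`: if the value of `c` is not `nil` then `a` else `b`. -/
  | ite (c a b : Code) : Code
  /-- `bind a b`: evaluate `b` with the value of `a` as the new variable `0`. -/
  | bind (a b : Code) : Code
  /-- `call f a`: apply the function number `f` to the value of `a`. -/
  | call (f : ℕ) (a : Code) : Code

/-- A program: the bodies of its functions. Each function has one argument, which is
variable `0` of its body; function number `0` is the main function. -/
abbrev Program := List Code

/-- `Eval P env e v t`: in the program `P`, with `env` as the list of the values of the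
variables, the expression `e` evaluates to `v` in exactly `t` steps. -/
inductive Eval (P : Program) : List Data → Code → Data → ℕ → Prop where
  | var (env : List Data) (i : ℕ) : Eval P env (Code.var i) (env.getD i Data.nil) 1
  | nil (env : List Data) : Eval P env Code.nil Data.nil 1
  | cons {env : List Data} {a b : Code} {v w : Data} {s t : ℕ} :
      Eval P env a v s → Eval P env b w t →
        Eval P env (Code.cons a b) (Data.cons v w) (s + t + 1)
  | head {env : List Data} {a : Code} {v : Data} {s : ℕ} :
      Eval P env a v s → Eval P env (Code.head a) v.head (s + 1)
  | tail {env : List Data} {a : Code} {v : Data} {s : ℕ} :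
      Eval P env a v s → Eval P env (Code.tail a) v.tail (s + 1)
  | ite_cons {env : List Data} {c a b : Code} {x y w : Data} {s t : ℕ} :
      Eval P env c (Data.cons x y) s → Eval P env a w t →
        Eval P env (Code.ite c a b) w (s + t + 1)
  | ite_nil {env : List Data} {c a b : Code} {w : Data} {s t : ℕ} :
      Eval P env c Data.nil s → Eval P env b w t →
        Eval P env (Code.ite c a b) w (s + t + 1)
  | bind {env : List Data} {a b : Code} {v w : Data} {s t : ℕ} :
      Eval P env a v s → Eval P (v :: env) b w t →
        Eval P env (Code.bind a b) w (s + t + 1)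
  | call {env : List Data} {f : ℕ} {a b : Code} {v w : Data} {s t : ℕ} :
      P[f]? = some b → Eval P env a v s → Eval P [v] b w t →
        Eval P env (Code.call f a) w (s + t + 1)

/-- Evaluation is deterministic: the value and the number of steps are determined. -/
theorem Eval.det {P : Program} {env : List Data} {e : Code} {v w : Data} {s t : ℕ}
    (h : Eval P env e v s) (h' : Eval P env e w t) : v = w ∧ s = t := by
  induction h generalizing w t with
  | var => cases h'; exact ⟨rfl, rfl⟩
  | nil => cases h'; exact ⟨rfl, rfl⟩
  | cons _ _ iha ihb =>
    cases h' with
    | cons ha hb =>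
      obtain ⟨rfl, rfl⟩ := iha ha
      obtain ⟨rfl, rfl⟩ := ihb hb
      exact ⟨rfl, rfl⟩
  | head _ iha =>
    cases h' with
    | head ha =>
      obtain ⟨rfl, rfl⟩ := iha ha
      exact ⟨rfl, rfl⟩
  | tail _ iha =>
    cases h' with
    | tail ha =>
      obtain ⟨rfl, rfl⟩ := iha ha
      exact ⟨rfl, rfl⟩
  | ite_cons _ _ iha ihb =>
    cases h' with
    | ite_cons ha hb =>
      obtain ⟨_, rfl⟩ := iha ha
      obtain ⟨rfl, rfl⟩ := ihb hb
      exact ⟨rfl, rfl⟩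
    | ite_nil ha hb => exact absurd (iha ha).1 (by simp)
  | ite_nil _ _ iha ihb =>
    cases h' with
    | ite_cons ha hb => exact absurd (iha ha).1 (by simp)
    | ite_nil ha hb =>
      obtain ⟨_, rfl⟩ := iha ha
      obtain ⟨rfl, rfl⟩ := ihb hb
      exact ⟨rfl, rfl⟩
  | bind _ _ iha ihb =>
    cases h' with
    | bind ha hb =>
      obtain ⟨rfl, rfl⟩ := iha ha
      obtain ⟨rfl, rfl⟩ := ihb hb
      exact ⟨rfl, rfl⟩
  | call hf _ _ iha ihb =>
    cases h' with
    | call hf' ha hb =>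
      obtain rfl := Option.some.inj (hf.symm.trans hf')
      obtain ⟨rfl, rfl⟩ := iha ha
      obtain ⟨rfl, rfl⟩ := ihb hb
      exact ⟨rfl, rfl⟩

/-- Started on the input `x`, the program `P` halts with output `y` after `t` steps. -/
def Program.Computes (P : Program) (x y : Data) (t : ℕ) : Prop :=
  Eval P [x] (Code.call 0 (Code.var 0)) y t

/-- The instance `(G, k)` as an input: the number `k` in binary, paired with the adjacency
matrix of `G`, whose entries are the multiplicities of the edges in binary. -/
def encodeInstance {n : ℕ} (G : Multigraph (Fin n)) (k : ℕ) : Data :=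
  Data.cons (Data.ofNat k)
    (Data.ofList (List.ofFn fun u : Fin n =>
      Data.ofList (List.ofFn fun v : Fin n => Data.ofNat (G.mult s(u, v)))))

end CountFVS

/-! The minimum feedback vertex sets are counted by iterative compression. Suppose that `w` is a
minimum feedback vertex set, of size at most `k`, of the graph induced by `vs`; if there is none,
then adding one more vertex `v` does not help. Then `v` and `w` are at most `k + 1` vertices, and
the other vertices induce a forest.

The graph induced by `v :: vs` is rebuilt vertex by vertex: first `v` and `w`, then the forest,
leaves first, so that each of its vertices has at most one edge to later vertices. The state of the
search remembers which of the kept vertices lie in which component. A new vertex of the forest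
without edges to the state lies on no cycle and is forgotten. One with a single such edge is hung
on the end of that edge; from now on, deleting it has the same effect as deleting any other
vertex of the chain that attaches it to its component, so that no branching is needed, and the
length of the chain is a factor of the count if the chain is cut. In all other cases one branches:
the new vertex is deleted, or it is kept and, for each of its edges, either the chain at the other
end is cut or the edge unites two components.

A deletion lowers the budget `k` and a union lowers the number `c` of components. This bounds the
number of leaves of the search tree by a constant times `7 ^ k * 2 ^ c * 3 ^ j`, where `j` counts
the vertices of `v :: w` that are still to be added. At the start `c = 0` and `j ≤ k + 1`, which
gives `21 ^ k`. -/

namespace CountFVS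

/-! ### Forests, one vertex at a time -/

/-- Partial equivalence relations: the components of a graph on a part of the vertex set. -/
structure IsPER {V : Type*} (r : V → V → Prop) : Prop where
  symm : ∀ {x y}, r x y → r y x
  trans : ∀ {x y z}, r x y → r y z → r x z

/-- The relation `r`, with the elements that satisfy `T` put into one class. -/
def glue {V : Type*} (r : V → V → Prop) (T : V → Prop) (x y : V) : Prop :=
  r x y ∨ T x ∧ T y

theorem IsPER.glue {V : Type*} {r : V → V → Prop} {T : V → Prop} (hr : IsPER r)
    (hT : ∀ {x y}, r x y → T y → T x) : IsPER (glue r T) where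
  symm := Or.imp hr.symm And.symm
  trans := by
    rintro x y z (hxy | ⟨hx, hy⟩) (hyz | ⟨hy', hz⟩)
    exacts [Or.inl (hr.trans hxy hyz), Or.inr ⟨hT hxy hy', hz⟩,
      Or.inr ⟨hx, hT (hr.symm hyz) hy⟩, Or.inr ⟨hx, hz⟩]

namespace Multigraph

variable {V : Type*} {G : Multigraph V} {A B : Finset V} {p x y z : V}

theorem ne_of_mult_pos (h : 0 < G.mult s(x, y)) : x ≠ y := by
  rintro rfl
  exact h.ne' (G.loopless x)

theorem mult_pos_comm : 0 < G.mult s(x, y) ↔ 0 < G.mult s(y, x) := by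
  rw [Sym2.eq_swap]

variable (G) in
/-- The simple graph underlying the subgraph of `G` induced by `A`. The vertices outside `A` stay
as isolated vertices, so that all these graphs live on the same type. -/
def simpleOn (A : Finset V) : SimpleGraph V where
  Adj u v := u ∈ A ∧ v ∈ A ∧ 0 < G.mult s(u, v)
  symm := ⟨fun _ _ h => ⟨h.2.1, h.1, mult_pos_comm.1 h.2.2⟩⟩
  loopless := ⟨fun _ h => ne_of_mult_pos h.2.2 rfl⟩

theorem simpleOn_mono (hAB : A ⊆ B) : G.simpleOn A ≤ G.simpleOn B :=
  fun _ _ h => ⟨hAB h.1, hAB h.2.1, h.2.2⟩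

theorem finite_edgeSet_simpleOn (A : Finset V) : (G.simpleOn A).edgeSet.Finite := by
  refine A.sym2.finite_toSet.subset fun e => ?_
  induction e with
  | h u v => exact fun h => Finset.mk_mem_sym2_iff.2 ⟨h.1, h.2.1⟩

theorem exists_isPath_avoiding (hx : x ∈ A) (h : (G.simpleOn A).Reachable x y) :
    ∃ w : (G.simpleOn A).Walk x y, w.IsPath ∧ ∀ v ∈ w.support, v ∈ A := by
  obtain ⟨w, hw⟩ := h.exists_isPath
  refine ⟨w, hw, fun v hv => ?_⟩
  clear hw h
  induction w with
  | nil => simpa using List.mem_singleton.1 hv ▸ hx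
  | cons hadj w ih =>
    rcases List.mem_cons.1 hv with rfl | hv
    exacts [hx, ih hadj.2.1 hv]

theorem zipWith_support {H : SimpleGraph V} (w : H.Walk x y) (z : V) :
    List.zipWith (fun u v => s(u, v)) w.support (w.support.tail ++ [z]) = w.edges ++ [s(y, z)] := by
  induction w with
  | nil => rfl
  | cons h w ih =>
    rw [SimpleGraph.Walk.support_cons, List.tail_cons, SimpleGraph.Walk.edges_cons,
      List.cons_append, ← ih]
    conv_lhs => rw [← w.cons_tail_support]
    conv_rhs => rw [← w.cons_tail_support]
    rfl

theorem cyclicEdges_support {H : SimpleGraph V} (w : H.Walk x y) :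
    cyclicEdges w.support = w.edges ++ [s(y, x)] := by
  rw [← zipWith_support, cyclicEdges]
  congr 1
  conv_lhs => rw [← w.cons_tail_support]
  rw [List.rotate_cons_succ, List.rotate_zero]

section Acyclic

variable [DecidableEq V]

variable (G) in
/-- The subgraph of `G` induced by `A` is a forest. -/
def AcyclicOn (A : Finset V) : Prop :=
  ∀ c : List V, G.IsCycle c → ¬ ∀ x ∈ c, x ∈ A

theorem IsCycle.mult_pos {l : List V} (h : G.IsCycle l) {i : ℕ} (hi : i < l.length) :
    0 < G.mult s(l[i], l[(i + 1) % l.length]'(Nat.mod_lt _ (by lia))) := by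
  refine lt_of_lt_of_le (List.count_pos_iff.2 (List.mem_iff_getElem.2 ⟨i, ?_, ?_⟩)) (h.2.2 _)
  · simpa [cyclicEdges] using hi
  · simp [cyclicEdges, List.getElem_rotate]

theorem isCycle_pair_iff : G.IsCycle [x, y] ↔ 2 ≤ G.mult s(x, y) := by
  have hswap : s(y, x) = s(x, y) := Sym2.eq_swap
  have hedges : cyclicEdges [x, y] = [s(x, y), s(x, y)] := by simp [cyclicEdges, hswap]
  refine ⟨fun h => by simpa [hedges] using h.2.2 s(x, y), fun h => ⟨?_, le_rfl, fun e => ?_⟩⟩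
  · simpa using ne_of_mult_pos (G := G) (by lia)
  · rw [hedges]
    by_cases he : s(x, y) = e
    · simpa [he] using he ▸ h
    · simp [he]

theorem isCycle_support {w : (G.simpleOn A).Walk x y} {h : (G.simpleOn A).Adj y x}
    (hc : (SimpleGraph.Walk.cons h w).IsCycle) : G.IsCycle w.support := by
  rw [SimpleGraph.Walk.cons_isCycle_iff] at hc
  have hedges : (cyclicEdges w.support).Nodup := by
    rw [cyclicEdges_support, ← List.concat_eq_append, List.nodup_concat]
    exact ⟨hc.2, hc.1.isTrail.edges_nodup⟩
  refine ⟨hc.1.support_nodup, ?_, fun e => ?_⟩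
  · have : w.length ≠ 0 := fun h0 => h.ne (w.eq_of_length_eq_zero h0).symm
    rw [w.length_support]
    lia
  · by_cases he : e ∈ cyclicEdges w.support
    · rw [List.count_eq_one_of_mem hedges he]
      rw [cyclicEdges_support, List.mem_append, List.mem_singleton] at he
      rcases he with he | rfl
      · induction e with
        | h u v => exact (w.adj_of_mem_edges he).2.2
      · exact h.2.2
    · rw [List.count_eq_zero_of_not_mem he]
      exact Nat.zero_le _

theorem IsCycle.not_isAcyclic {l : List V} (hc : G.IsCycle l) (hlen : 3 ≤ l.length)
    (hA : ∀ x ∈ l, x ∈ A) : ¬ (G.simpleOn A).IsAcyclic := by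
  intro hacyc
  have hne : l ≠ [] := List.ne_nil_of_length_pos (by lia)
  have hadj : ∀ i (hi : i < l.length),
      (G.simpleOn A).Adj l[i] (l[(i + 1) % l.length]'(Nat.mod_lt _ (by lia))) := fun i hi =>
    ⟨hA _ (List.getElem_mem _), hA _ (List.getElem_mem _), hc.mult_pos hi⟩
  have hchain : l.IsChain (G.simpleOn A).Adj := List.isChain_iff_getElem.2 fun i hi => by
    simpa only [Nat.mod_eq_of_lt hi] using hadj i (by lia)
  have hclose : (G.simpleOn A).Adj (l.getLast hne) (l.head hne) := by
    have := hadj (l.length - 1) (by lia)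
    simpa only [Nat.sub_add_cancel (show 1 ≤ l.length by lia), Nat.mod_self,
      ← List.getLast_eq_getElem hne, ← List.head_eq_getElem hne] using this
  set w := SimpleGraph.Walk.ofSupport l hne hchain with hw
  have hwp : w.IsPath := .mk' (by rw [hw, SimpleGraph.Walk.support_ofSupport]; exact hc.1)
  have hlength := congrArg (fun q => q.1.length)
    ((hacyc.subsingleton_path _ _).elim ⟨w, hwp⟩ (.singleton hclose.symm))
  simp only [hw, SimpleGraph.Walk.length_ofSupport, SimpleGraph.Path.singleton,
    SimpleGraph.Walk.length_cons, SimpleGraph.Walk.length_nil] at hlength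
  lia

theorem acyclicOn_iff : G.AcyclicOn A ↔
    (G.simpleOn A).IsAcyclic ∧ ∀ x ∈ A, ∀ y ∈ A, G.mult s(x, y) ≤ 1 := by
  constructor
  · refine fun hA => ⟨fun x c hc => ?_, fun x hx y hy => ?_⟩
    · cases c with
      | nil => exact hc.ne_nil rfl
      | cons h w =>
        refine hA _ (isCycle_support hc) fun v hv => ?_
        obtain ⟨e, he, hve⟩ := SimpleGraph.Walk.mem_support_iff_exists_mem_edges_of_not_nil
          (p := .cons h w) (by simp) |>.1 (List.mem_cons_of_mem _ hv)
        induction e with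
        | h a b =>
          have hab := SimpleGraph.Walk.adj_of_mem_edges _ he
          rcases Sym2.mem_iff.1 hve with rfl | rfl
          exacts [hab.1, hab.2.1]
    · by_contra! hxy
      exact hA [x, y] (isCycle_pair_iff.2 hxy) (by simp [hx, hy])
  · rintro ⟨hacyc, hmult⟩ c hc hA
    rcases Nat.lt_or_ge c.length 3 with hlen | hlen
    · obtain ⟨x, y, rfl⟩ := List.length_eq_two.1 (le_antisymm (Nat.le_of_lt_succ hlen) hc.2.1)
      have := hmult x (hA x (by simp)) y (hA y (by simp))
      have := isCycle_pair_iff.1 hc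
      lia
    · exact hc.not_isAcyclic hlen hA hacyc

theorem AcyclicOn.mono (h : G.AcyclicOn B) (hAB : A ⊆ B) : G.AcyclicOn A :=
  fun c hc hA => h c hc fun x hx => hAB (hA x hx)

theorem acyclicOn_empty : G.AcyclicOn ∅ := fun c hc h =>
  absurd (List.length_eq_zero_iff.2 (List.eq_nil_iff_forall_not_mem.2 fun x hx =>
    Finset.notMem_empty x (h x hx))) (by have := hc.2.1; lia)

theorem isCycle_deleteVerts_iff {S : Finset V} {c : List {v : V // v ∉ S}} :
    (G.deleteVerts S).IsCycle c ↔ G.IsCycle (c.map Subtype.val) := by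
  have hedges : cyclicEdges (c.map Subtype.val) = (cyclicEdges c).map (Sym2.map Subtype.val) := by
    simp only [cyclicEdges, ← List.map_rotate, List.zipWith_map, List.map_zipWith, Sym2.map_mk]
  have hcount (e : Sym2 {v : V // v ∉ S}) :
      (cyclicEdges (c.map Subtype.val)).count (e.map Subtype.val) = (cyclicEdges c).count e := by
    rw [hedges, List.count_map_of_injective _ _ (Sym2.map.injective Subtype.val_injective)]
  unfold IsCycle
  rw [List.nodup_map_iff Subtype.val_injective, List.length_map]
  refine and_congr_right fun _ => and_congr_right fun _ => ⟨fun h e => ?_, fun h e => ?_⟩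
  · by_cases he : e ∈ cyclicEdges (c.map Subtype.val)
    · obtain ⟨e', _, rfl⟩ := List.mem_map.1 (hedges ▸ he)
      exact (hcount e').trans_le (h e')
    · exact (List.count_eq_zero_of_not_mem he).trans_le (Nat.zero_le _)
  · exact (hcount e).symm.trans_le (h _)

theorem isFVS_iff [Fintype V] {S : Finset V} : G.IsFVS S ↔ G.AcyclicOn (Finset.univ \ S) := by
  constructor
  · intro h c hc hA
    have hS : ∀ x ∈ c, x ∉ S := fun x hx => (Finset.mem_sdiff.1 (hA x hx)).2
    apply h (c.attach.map fun x => ⟨x.1, hS x.1 x.2⟩)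
    simpa [isCycle_deleteVerts_iff] using hc
  · refine fun h c hc => h _ (isCycle_deleteVerts_iff.1 hc) fun x hx => ?_
    obtain ⟨v, _, rfl⟩ := List.mem_map.1 hx
    simpa using v.2

/-- The leaf is an end of a longest path. -/
theorem AcyclicOn.exists_leaf (h : G.AcyclicOn A) (hA : A.Nonempty) :
    ∃ x ∈ A, ∀ y ∈ A, ∀ z ∈ A, 0 < G.mult s(x, y) → 0 < G.mult s(x, z) →
      y = z ∧ G.mult s(x, y) = 1 := by
  obtain ⟨hacyc, hmult⟩ := acyclicOn_iff.1 h
  suffices ∃ x ∈ A, ∀ y z, (G.simpleOn A).Adj x y → (G.simpleOn A).Adj x z → y = z by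
    obtain ⟨x, hx, hleaf⟩ := this
    exact ⟨x, hx, fun y hy z hz hxy hxz =>
      ⟨hleaf y z ⟨hx, hy, hxy⟩ ⟨hx, hz, hxz⟩, le_antisymm (hmult x hx y hy) hxy⟩⟩
  have : Nonempty V := hA.to_type
  have : Finite (G.simpleOn A).edgeSet := (finite_edgeSet_simpleOn A).to_subtype
  obtain ⟨x, y, w, hw, hmax⟩ :=
    SimpleGraph.Walk.exists_isPath_forall_isPath_length_le_length (G.simpleOn A)
  have hsnd : ∀ z, (G.simpleOn A).Adj x z → z = w.snd := fun z hz => by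
    refine hacyc.eq_snd_of_adj_start hw hz (by_contra fun hzw => ?_)
    have := hmax z y (.cons hz.symm w) (hw.cons hzw)
    simp at this
  by_cases hx : x ∈ A
  · exact ⟨x, hx, fun y z hy hz => (hsnd y hy).trans (hsnd z hz).symm⟩
  · have hnil : w.length = 0 := by
      cases w with
      | nil => rfl
      | cons hadj _ => exact absurd hadj.1 hx
    obtain ⟨a, ha⟩ := hA
    refine ⟨a, ha, fun y z hy _ => ?_⟩
    have := hmax a y (.cons hy .nil) (by simpa using hy.ne)
    simp [hnil] at this

end Acyclic

/-! ### Adding a vertex -/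

variable (G) in
/-- `x` and `y` lie in the same component of the subgraph of `G` induced by `A`. -/
def Conn (A : Finset V) (x y : V) : Prop :=
  x ∈ A ∧ y ∈ A ∧ (G.simpleOn A).Reachable x y

variable (G) in
/-- The new vertex `p` sends at most one edge to every class of `r`. -/
def Linkable (p : V) (r : V → V → Prop) : Prop :=
  ∀ y z, r y z → 0 < G.mult s(p, y) → 0 < G.mult s(p, z) → y = z ∧ G.mult s(p, y) = 1

variable (G) in
/-- `x` is the new vertex `p` or lies in a class of `r` that `p` is adjacent to. -/
def Touch (p : V) (r : V → V → Prop) (x : V) : Prop :=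
  x = p ∨ ∃ z, r x z ∧ 0 < G.mult s(p, z)

variable (G) in
/-- The classes of the partial equivalence relation `r`, after adding `p` and all its edges. -/
def Extend (p : V) (r : V → V → Prop) : V → V → Prop :=
  glue r (G.Touch p r)

theorem isPER_conn (A : Finset V) : IsPER (G.Conn A) where
  symm h := ⟨h.2.1, h.1, h.2.2.symm⟩
  trans h h' := ⟨h.1, h'.2.1, h.2.2.trans h'.2.2⟩

theorem Conn.mono (hAB : A ⊆ B) (h : G.Conn A x y) : G.Conn B x y :=
  ⟨hAB h.1, hAB h.2.1, h.2.2.mono (simpleOn_mono hAB)⟩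

theorem conn_of_adj (h : (G.simpleOn A).Adj x y) : G.Conn A x y :=
  ⟨h.1, h.2.1, h.reachable⟩

theorem isPER_extend {r : V → V → Prop} (hr : IsPER r) (hp : ∀ x, ¬ r p x) :
    IsPER (G.Extend p r) := by
  refine hr.glue ?_
  rintro x y hxy (rfl | ⟨z, hyz, hz⟩)
  exacts [absurd (hr.symm hxy) (hp x), Or.inr ⟨z, hr.trans hxy hyz, hz⟩]

theorem extend_of_adj [DecidableEq V] (h : (G.simpleOn (insert p A)).Adj x y) :
    G.Extend p (G.Conn A) x y := by
  have touch_of_adj {v} (hv : v ∈ insert p A) (hpv : 0 < G.mult s(p, v)) :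
      G.Touch p (G.Conn A) v :=
    (Finset.mem_insert.1 hv).imp_right fun hv => ⟨v, ⟨hv, hv, .refl _⟩, hpv⟩
  obtain ⟨hx, hy, hxy⟩ := h
  rcases Finset.mem_insert.1 hx with rfl | hx'
  · exact Or.inr ⟨Or.inl rfl, touch_of_adj hy hxy⟩
  rcases Finset.mem_insert.1 hy with rfl | hy'
  · exact Or.inr ⟨touch_of_adj hx (mult_pos_comm.1 hxy), Or.inl rfl⟩
  · exact Or.inl (conn_of_adj ⟨hx', hy', hxy⟩)

theorem Touch.conn_insert [DecidableEq V] (h : G.Touch p (G.Conn A) x) :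
    G.Conn (insert p A) x p := by
  have hsub : A ⊆ insert p A := Finset.subset_insert p A
  rcases h with rfl | ⟨z, hxz, hpz⟩
  · exact ⟨by simp, by simp, .refl _⟩
  · exact (isPER_conn _).trans (hxz.mono hsub)
      (conn_of_adj ⟨hsub hxz.2.1, by simp, mult_pos_comm.1 hpz⟩)

theorem conn_insert [DecidableEq V] (hpA : p ∉ A) :
    G.Conn (insert p A) x y ↔ G.Extend p (G.Conn A) x y := by
  have hper : IsPER (G.Extend p (G.Conn A)) :=
    isPER_extend (isPER_conn A) fun _ h => hpA h.1
  constructor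
  · rintro ⟨hx, _, ⟨w⟩⟩
    induction w with
    | nil =>
      rcases Finset.mem_insert.1 hx with rfl | hx
      exacts [Or.inr ⟨Or.inl rfl, Or.inl rfl⟩, Or.inl ⟨hx, hx, .refl _⟩]
    | cons h _ ih => exact hper.trans (extend_of_adj h) (ih h.2.1 ‹_›)
  · rintro (h | ⟨hx, hy⟩)
    · exact h.mono (Finset.subset_insert p A)
    · exact (isPER_conn _).trans hx.conn_insert ((isPER_conn _).symm hy.conn_insert)

section AcyclicInsert

variable [DecidableEq V]

theorem AcyclicOn.linkable (h : G.AcyclicOn (insert p A)) (hpA : p ∉ A) :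
    G.Linkable p (G.Conn A) := by
  obtain ⟨hacyc, hmult⟩ := acyclicOn_iff.1 h
  have hsub : A ⊆ insert p A := Finset.subset_insert p A
  rintro y z ⟨hy, hz, hyz⟩ hpy hpz
  refine ⟨?_, le_antisymm (hmult p (by simp) y (hsub hy)) hpy⟩
  -- otherwise the path from `p` through `y` to `z` contradicts the uniqueness of paths
  obtain ⟨w, hw, hwA⟩ := exists_isPath_avoiding hy hyz
  let w' := w.mapLe (simpleOn_mono hsub)
  have hsupport : w'.support = w.support := by simp [w']
  have hadj {v} (hv : v ∈ A) (hpv : 0 < G.mult s(p, v)) : (G.simpleOn (insert p A)).Adj p v :=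
    ⟨by simp, hsub hv, hpv⟩
  have hpath : (SimpleGraph.Walk.cons (hadj hy hpy) w').IsPath :=
    (hw.mapLe (simpleOn_mono hsub)).cons (hsupport ▸ fun hp => hpA (hwA p hp))
  simpa using (hacyc.eq_snd_of_adj_start hpath (hadj hz hpz) (by simp)).symm

theorem mem_edgeSet_simpleOn_of_notMem_support (w : (G.simpleOn (insert p A)).Walk x y)
    (hp : p ∉ w.support) : ∀ e ∈ w.edges, e ∈ (G.simpleOn A).edgeSet := fun e he => by
  have mem_of_ne {v} (hv : v ∈ insert p A) (hvp : v ≠ p) : v ∈ A :=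
    (Finset.mem_insert.1 hv).resolve_left hvp
  induction e with
  | h u v =>
    obtain ⟨hu, hv, huv⟩ := w.adj_of_mem_edges he
    exact ⟨mem_of_ne hu fun h => hp (h ▸ w.fst_mem_support_of_mem_edges he),
      mem_of_ne hv fun h => hp (h ▸ w.snd_mem_support_of_mem_edges he), huv⟩

/-- The two neighbours of `p` on a cycle are joined by a path that avoids `p`. -/
theorem Linkable.not_isCycle_cons (hlink : G.Linkable p (G.Conn A))
    (hpy : (G.simpleOn (insert p A)).Adj p y) (w : (G.simpleOn (insert p A)).Walk y p) :
    ¬ (SimpleGraph.Walk.cons hpy w).IsCycle := by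
  rw [SimpleGraph.Walk.cons_isCycle_iff]
  rintro ⟨hw, hmem⟩
  have mem_of_adj {v} (hpv : (G.simpleOn (insert p A)).Adj p v) : v ∈ A :=
    (Finset.mem_insert.1 hpv.2.1).resolve_left hpv.ne'
  obtain ⟨z, w, hzp, rfl⟩ : ∃ z w', ∃ hzp : (G.simpleOn (insert p A)).Adj z p,
      w = SimpleGraph.Walk.concat w' hzp := by
    cases w with
    | nil => exact absurd rfl hpy.ne
    | cons h w => exact SimpleGraph.Walk.exists_cons_eq_concat h w
  rw [SimpleGraph.Walk.concat_isPath_iff] at hw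
  have hyz : G.Conn A y z := ⟨mem_of_adj hpy, mem_of_adj hzp.symm,
    ⟨w.transfer _ (mem_edgeSet_simpleOn_of_notMem_support w hw.2)⟩⟩
  obtain ⟨rfl, -⟩ := hlink y z hyz hpy.2.2 hzp.symm.2.2
  exact hmem (by simp [Sym2.eq_swap])

theorem AcyclicOn.insert_of_linkable (h : G.AcyclicOn A)
    (hlink : G.Linkable p (G.Conn A)) : G.AcyclicOn (insert p A) := by
  obtain ⟨hacyc, hmult⟩ := acyclicOn_iff.1 h
  have hmult_p {y} (hy : y ∈ insert p A) : G.mult s(p, y) ≤ 1 := by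
    rcases Finset.mem_insert.1 hy with rfl | hy
    · simp [G.loopless]
    · by_contra! hpy
      have := hlink y y ⟨hy, hy, .refl _⟩ (by lia) (by lia)
      lia
  refine acyclicOn_iff.2 ⟨fun x c hc => ?_, fun x hx y hy => ?_⟩
  · by_cases hpc : p ∈ c.support
    · replace hc := hc.rotate hpc
      cases hrot : c.rotate p hpc with
      | nil => exact hc.ne_nil hrot
      | cons hpy w => exact hlink.not_isCycle_cons hpy w (hrot ▸ hc)
    · exact hacyc _ (hc.transfer (mem_edgeSet_simpleOn_of_notMem_support c hpc))
  · rcases eq_or_ne x p with rfl | hxp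
    · exact hmult_p hy
    · rcases eq_or_ne y p with rfl | hyp
      · exact Sym2.eq_swap ▸ hmult_p hx
      · exact hmult x ((Finset.mem_insert.1 hx).resolve_left hxp) y
          ((Finset.mem_insert.1 hy).resolve_left hyp)

theorem acyclicOn_insert (hpA : p ∉ A) :
    G.AcyclicOn (insert p A) ↔ G.AcyclicOn A ∧ G.Linkable p (G.Conn A) :=
  ⟨fun h => ⟨h.mono (Finset.subset_insert p A), h.linkable hpA⟩,
    fun h => h.1.insert_of_linkable h.2⟩

end AcyclicInsert

end Multigraph

section Glue

variable {V : Type*} {r : V → V → Prop} {p a : V} {L : List V}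

/-- The relation `r`, with the classes of the members of `L` united. -/
def mergeClasses (r : V → V → Prop) (L : List V) : V → V → Prop :=
  glue r fun x => ∃ y ∈ L, r x y

theorem glue_right_comm (r : V → V → Prop) (T T' : V → Prop) :
    glue (glue r T) T' = glue (glue r T') T := by
  funext x y
  exact propext or_right_comm

theorem isPER_glue_eq (hr : IsPER r) (hp : ∀ x, ¬ r p x) : IsPER (glue r (· = p)) :=
  hr.glue fun hxy hy => absurd (hr.symm (hy ▸ hxy)) (hp _)

theorem isPER_mergeClasses (hr : IsPER r) (L : List V) : IsPER (mergeClasses r L) :=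
  hr.glue fun hxy ⟨z, hz, hyz⟩ => ⟨z, hz, hr.trans hxy hyz⟩

theorem mergeClasses_singleton (hr : IsPER r) (p : V) : mergeClasses r [p] = r := by
  funext x y
  simp only [mergeClasses, glue, List.mem_singleton, exists_eq_left, eq_iff_iff,
    or_iff_left_iff_imp]
  exact fun h => hr.trans h.1 (hr.symm h.2)

theorem mergeClasses_cons_of_forall_not (ha : ∀ x, ¬ r x a) :
    mergeClasses r (a :: L) = mergeClasses r L := by
  simp only [mergeClasses, List.mem_cons, exists_eq_or_imp, ha, false_or]

theorem mergeClasses_pair_right (hp : r p p) {x : V} :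
    mergeClasses r [a, p] x p ↔ r x a ∨ r x p := by
  simp only [mergeClasses, glue, List.mem_cons, List.not_mem_nil, or_false, exists_eq_or_imp,
    exists_eq_left]
  tauto

theorem mergeClasses_mergeClasses (hp : r p p) :
    mergeClasses (mergeClasses r [a, p]) (p :: L) = mergeClasses r (p :: a :: L) := by
  have hclass (x : V) : (∃ y ∈ p :: L, mergeClasses r [a, p] x y) ↔ ∃ y ∈ p :: a :: L, r x y := by
    simp only [List.mem_cons, exists_eq_or_imp, mergeClasses_pair_right hp]
    simp only [mergeClasses, glue, List.mem_cons, List.not_mem_nil, or_false, exists_eq_or_imp,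
      exists_eq_left]
    grind
  funext x y
  rw [mergeClasses, glue, hclass, hclass]
  simp only [mergeClasses, glue, List.mem_cons, List.not_mem_nil, or_false, exists_eq_or_imp,
    exists_eq_left]
  grind

theorem pairwise_not_mergeClasses (hr : IsPER r) (hp : r p p) :
    (p :: a :: L).Pairwise (fun y z => ¬ r y z) ↔
      ¬ r a p ∧ (p :: L).Pairwise fun y z => ¬ mergeClasses r [a, p] y z := by
  have hmem : (∀ y ∈ L, ¬ mergeClasses r [a, p] p y) ↔ ∀ y ∈ L, ¬ r a y ∧ ¬ r p y := by
    refine forall₂_congr fun y _ => ?_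
    rw [← not_or, not_iff_not]
    have hM := isPER_mergeClasses hr [a, p]
    exact ⟨fun h => ((mergeClasses_pair_right hp).1 (hM.symm h)).imp hr.symm hr.symm,
      fun h => hM.symm ((mergeClasses_pair_right hp).2 (h.imp hr.symm hr.symm))⟩
  simp only [List.pairwise_cons, List.mem_cons, forall_eq_or_imp, hmem]
  constructor
  · rintro ⟨⟨hpa, hpL⟩, haL, hL⟩
    refine ⟨fun h => hpa (hr.symm h), fun y hy => ⟨haL y hy, hpL y hy⟩, ?_⟩
    refine hL.imp_of_mem fun {y z} hy _ hyz => ?_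
    rintro (h | ⟨⟨b, hb, hyb⟩, -⟩)
    · exact hyz h
    · rcases List.mem_pair.1 hb with rfl | rfl
      exacts [haL y hy (hr.symm hyb), hpL y hy (hr.symm hyb)]
  · rintro ⟨hap, hL, hpair⟩
    exact ⟨⟨fun h => hap (hr.symm h), fun y hy => (hL y hy).2⟩, fun y hy => (hL y hy).1,
      hpair.imp fun h h' => h (Or.inl h')⟩

end Glue

/-- An entry of a state of the branching algorithm: `vertex` is attached to the component named
`label`, unless one of the vertices of `chain` is deleted. -/
structure Entry (V : Type*) where
  vertex : V
  chain : List V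
  label : V

namespace Multigraph

variable {V : Type*} {G : Multigraph V} {S S' : Finset V} {p x y : V} {l L : List V}
  {r r' : V → V → Prop}

/-! ### Adding the vertices of a list to a forest -/

variable (G) in
/-- The number of edges from `x` to the vertices of the list `l`. -/
def degTo (x : V) (l : List V) : ℕ :=
  (l.map fun y => G.mult s(x, y)).sum

variable (G) in
/-- `x` has a neighbour in the list `l`. -/
def AdjTo (l : List V) (x : V) : Prop :=
  ∃ q ∈ l, 0 < G.mult s(q, x)

variable (G) in
/-- The vertices of the list that are outside `S` can be added one by one to a forest whose
components are the classes of `r` without closing a cycle. -/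
def Feasible (S : Finset V) : List V → (V → V → Prop) → Prop
  | [], _ => True
  | p :: l, r => (p ∈ S → Feasible S l r) ∧
      (p ∉ S → G.Linkable p r ∧ Feasible S l (G.Extend p r))

theorem AdjTo.cons (h : G.AdjTo l x) : G.AdjTo (p :: l) x :=
  let ⟨q, hq, hqx⟩ := h
  ⟨q, List.mem_cons_of_mem _ hq, hqx⟩

theorem degTo_cons : G.degTo x (p :: l) = G.mult s(x, p) + G.degTo x l := by
  simp [degTo]

theorem AdjTo.degTo_pos (h : G.AdjTo l x) : 0 < G.degTo x l := by
  obtain ⟨q, hq, hqx⟩ := h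
  exact (mult_pos_comm.1 hqx).trans_le
    (List.single_le_sum (by simp) _ (List.mem_map.2 ⟨q, hq, rfl⟩))

theorem feasible_conn_iff [DecidableEq V] : ∀ {l : List V} {A : Finset V}, l.Nodup →
    (∀ x ∈ l, x ∉ A) → G.AcyclicOn A →
    (G.Feasible S l (G.Conn A) ↔ G.AcyclicOn (A ∪ (l.toFinset \ S)))
  | [], A, _, _, hA => by simp [Feasible, hA]
  | p :: l, A, hnodup, hdisj, hA => by
    rw [List.nodup_cons] at hnodup
    rw [List.forall_mem_cons] at hdisj
    by_cases hp : p ∈ S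
    · simp only [Feasible, hp, not_true_eq_false, false_imp_iff, and_true, forall_const,
        feasible_conn_iff hnodup.2 hdisj.2 hA]
      rw [List.toFinset_cons, Finset.insert_sdiff_of_mem _ hp]
    · have hext : G.Extend p (G.Conn A) = G.Conn (insert p A) := by
        funext x y
        exact propext (conn_insert hdisj.1).symm
      have hunion : A ∪ ((p :: l).toFinset \ S) = insert p A ∪ (l.toFinset \ S) := by
        rw [List.toFinset_cons, Finset.insert_sdiff_of_notMem _ hp, Finset.union_insert,
          Finset.insert_union]
      simp only [Feasible, hp, false_imp_iff, true_and, not_false_eq_true, forall_const, hext,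
        hunion]
      have hinsert := acyclicOn_insert (G := G) hdisj.1
      rw [and_iff_right hA] at hinsert
      rw [← hinsert]
      by_cases hacyc : G.AcyclicOn (insert p A)
      · rw [and_iff_right hacyc]
        refine feasible_conn_iff hnodup.2 (fun x hx hx' => ?_) hacyc
        rcases Finset.mem_insert.1 hx' with rfl | hx'
        exacts [hnodup.1 hx, hdisj.2 x hx hx']
      · exact iff_of_false (fun h => hacyc h.1) fun h => hacyc (h.mono Finset.subset_union_left)

theorem linkable_congr (h : ∀ y z, 0 < G.mult s(p, y) → 0 < G.mult s(p, z) → (r y z ↔ r' y z)) :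
    G.Linkable p r ↔ G.Linkable p r' := by
  refine forall₂_congr fun y z => ?_
  grind

theorem touch_congr (h : ∀ z, 0 < G.mult s(p, z) → (r x z ↔ r' x z)) :
    G.Touch p r x ↔ G.Touch p r' x :=
  or_congr_right (exists_congr fun z => and_congr_left fun hz => h z hz)

theorem feasible_congr : ∀ {l : List V} {r r' : V → V → Prop},
    (∀ q ∈ l, q ∈ S ↔ q ∈ S') → (∀ x y, G.AdjTo l x → G.AdjTo l y → (r x y ↔ r' x y)) →
      (G.Feasible S l r ↔ G.Feasible S' l r')
  | [], _, _, _, _ => by simp [Feasible]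
  | p :: l, r, r', hS, hr => by
    rw [List.forall_mem_cons] at hS
    have adj_p {z} (hz : 0 < G.mult s(p, z)) : G.AdjTo (p :: l) z := ⟨p, by simp, hz⟩
    have hlink : G.Linkable p r ↔ G.Linkable p r' :=
      linkable_congr fun y z hy hz => hr y z (adj_p hy) (adj_p hz)
    have htouch {x} (hx : G.AdjTo l x) : G.Touch p r x ↔ G.Touch p r' x :=
      touch_congr fun z hz => hr x z hx.cons (adj_p hz)
    have hskip : G.Feasible S l r ↔ G.Feasible S' l r' :=
      feasible_congr hS.2 fun x y hx hy => hr x y hx.cons hy.cons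
    have hkeep : G.Feasible S l (G.Extend p r) ↔ G.Feasible S' l (G.Extend p r') :=
      feasible_congr hS.2 fun x y hx hy =>
        or_congr (hr x y hx.cons hy.cons) (and_congr (htouch hx) (htouch hy))
    simp only [Feasible, hS.1, hlink, hskip, hkeep]

theorem linkable_glue_eq (hpx : G.mult s(p, x) ≤ 1) :
    G.Linkable p (glue r (· = x)) ↔ G.Linkable p r := by
  refine ⟨fun h y z hyz => h y z (Or.inl hyz), ?_⟩
  rintro h y z (hyz | ⟨rfl, rfl⟩) hy hz
  · exact h y z hyz hy hz
  · exact ⟨rfl, le_antisymm hpx hy⟩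

theorem touch_glue_eq (h : y ≠ x ∨ G.mult s(p, x) = 0) :
    G.Touch p (glue r (· = x)) y ↔ G.Touch p r y := by
  refine touch_congr fun z hz => or_iff_left ?_
  rintro ⟨rfl, rfl⟩
  exact h.elim (· rfl) hz.ne'

/-- The isolated vertex `x` plays no role: it sends at most one edge to the vertices that are added
later, and an edge to a vertex of degree one lies on no cycle. -/
theorem feasible_glue_eq : ∀ {l : List V} {r : V → V → Prop},
    x ∉ l → G.degTo x l ≤ 1 → (∀ v, ¬ r x v) → (∀ v, ¬ r v x) →
      (G.Feasible S l (glue r (· = x)) ↔ G.Feasible S l r)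
  | [], _, _, _, _, _ => by simp [Feasible]
  | p :: l, r, hxl, hdeg, hleft, hright => by
    rw [degTo_cons, Sym2.eq_swap] at hdeg
    rw [List.mem_cons, not_or] at hxl
    simp only [Feasible, linkable_glue_eq (r := r) (show G.mult s(p, x) ≤ 1 by lia),
      feasible_glue_eq hxl.2 (show G.degTo x l ≤ 1 by lia) hleft hright]
    refine and_congr_right fun _ => imp_congr_right fun _ => and_congr_right fun _ => ?_
    by_cases hpx : G.mult s(p, x) = 0
    · have hext : G.Extend p (glue r (· = x)) = glue (G.Extend p r) (· = x) := by
        have htouch : G.Touch p (glue r (· = x)) = G.Touch p r := by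
          funext y
          exact propext (touch_glue_eq (Or.inr hpx))
        rw [Extend, Extend, htouch, glue_right_comm]
      have hntouch : ¬ G.Touch p r x := by
        rintro (h | ⟨z, hxz, -⟩)
        exacts [hxl.1 h, hleft z hxz]
      rw [hext]
      exact feasible_glue_eq hxl.2 (by lia) (fun v h => h.elim (hleft v) fun h => hntouch h.1)
        fun v h => h.elim (hright v) fun h => hntouch h.2
    · have ne_of_adjTo {y} (hy : G.AdjTo l y) : y ≠ x := by
        rintro rfl
        have := hy.degTo_pos
        lia
      refine feasible_congr (fun _ _ => Iff.rfl) fun y z hy hz => ?_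
      exact or_congr (or_iff_left fun h => ne_of_adjTo hy h.1)
        (and_congr (touch_glue_eq (Or.inl (ne_of_adjTo hy)))
          (touch_glue_eq (Or.inl (ne_of_adjTo hz))))

/-! ### Adding the edges of a new vertex one by one -/

variable (G) in
/-- The edges from `p` to the vertices of the list can be added one by one without closing a
cycle, and then the vertices of `l` as in `Feasible`. -/
def LinkFeasible (S : Finset V) (p : V) (l : List V) : List V → (V → V → Prop) → Prop
  | [], r => G.Feasible S l r
  | y :: L, r => ¬ r y p ∧ LinkFeasible S p l L (mergeClasses r [y, p])

theorem linkFeasible_congr (hS : ∀ q ∈ l, q ∈ S ↔ q ∈ S') :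
    ∀ {L : List V} {r r' : V → V → Prop},
      (∀ x y, (x = p ∨ x ∈ L ∨ G.AdjTo l x) → (y = p ∨ y ∈ L ∨ G.AdjTo l y) →
        (r x y ↔ r' x y)) →
      (G.LinkFeasible S p l L r ↔ G.LinkFeasible S' p l L r')
  | [], r, r', hr => feasible_congr hS fun x y hx hy => hr x y (by simp [hx]) (by simp [hy])
  | a :: L, r, r', hr => by
    have weaken {x} (hx : x = p ∨ x ∈ L ∨ G.AdjTo l x) : x = p ∨ x ∈ a :: L ∨ G.AdjTo l x :=
      hx.imp_right (Or.imp_left (List.mem_cons_of_mem _))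
    have hclass {x} (hx : x = p ∨ x ∈ L ∨ G.AdjTo l x) :
        (∃ b ∈ [a, p], r x b) ↔ ∃ b ∈ [a, p], r' x b := by
      simp only [List.mem_cons, List.not_mem_nil, or_false, exists_eq_or_imp, exists_eq_left,
        hr x a (weaken hx) (by simp), hr x p (weaken hx) (by simp)]
    simp only [LinkFeasible, hr a p (by simp) (by simp)]
    exact and_congr_right fun _ => linkFeasible_congr hS fun x y hx hy =>
      or_congr (hr x y (weaken hx) (weaken hy)) (and_congr (hclass hx) (hclass hy))

theorem linkFeasible_iff : ∀ {L : List V} {r : V → V → Prop}, IsPER r → r p p →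
    (G.LinkFeasible S p l L r ↔
      (p :: L).Pairwise (fun y z => ¬ r y z) ∧ G.Feasible S l (mergeClasses r (p :: L)))
  | [], r, hr, _ => by simp [LinkFeasible, mergeClasses_singleton hr]
  | a :: L, r, hr, hp => by
    rw [LinkFeasible, linkFeasible_iff (isPER_mergeClasses hr _) (Or.inl hp),
      mergeClasses_mergeClasses hp, pairwise_not_mergeClasses hr hp, and_assoc]

section Nbrs

variable {st : List (Entry V)}

variable (G) in
/-- The members of `st` that are adjacent to `p`, twice if there are parallel edges. -/
def nbrs (p : V) (st : List (Entry V)) : List (Entry V) :=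
  st.flatMap fun e => List.replicate (min 2 (G.mult s(p, e.vertex))) e

theorem mem_nbrs {e : Entry V} : e ∈ G.nbrs p st ↔ e ∈ st ∧ 0 < G.mult s(p, e.vertex) := by
  simp only [nbrs, List.mem_flatMap, List.mem_replicate]
  constructor
  · rintro ⟨a, ha, hpa, rfl⟩
    exact ⟨ha, by lia⟩
  · rintro ⟨he, hpe⟩
    exact ⟨e, he, by lia, rfl⟩

theorem map_vertex_nbrs : (G.nbrs p st).map Entry.vertex =
    (st.map Entry.vertex).flatMap fun y => List.replicate (min 2 (G.mult s(p, y))) y := by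
  simp [nbrs, List.map_flatMap, List.flatMap_map]

theorem mem_map_vertex_nbrs :
    y ∈ (G.nbrs p st).map Entry.vertex ↔ y ∈ st.map Entry.vertex ∧ 0 < G.mult s(p, y) := by
  simp only [List.mem_map, mem_nbrs]
  constructor
  · rintro ⟨e, ⟨he, hpe⟩, rfl⟩
    exact ⟨⟨e, he, rfl⟩, hpe⟩
  · rintro ⟨⟨e, he, rfl⟩, hpe⟩
    exact ⟨e, ⟨he, hpe⟩, rfl⟩

theorem pairwise_nbrs_iff (hr : IsPER r) (hst : (st.map Entry.vertex).Nodup)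
    (hkey : ∀ x y, r x y → x ∈ st.map Entry.vertex) :
    ((G.nbrs p st).map Entry.vertex).Pairwise (fun y z => ¬ r y z) ↔ G.Linkable p r := by
  have hsymm : Std.Symm fun y z => 0 < G.mult s(p, y) → 0 < G.mult s(p, z) → ¬ r y z :=
    ⟨fun _ _ h hz hy hzy => h hy hz (hr.symm hzy)⟩
  have hblock {y z} : (∀ u ∈ List.replicate (min 2 (G.mult s(p, y))) y,
      ∀ v ∈ List.replicate (min 2 (G.mult s(p, z))) z, ¬ r u v) ↔
        (0 < G.mult s(p, y) → 0 < G.mult s(p, z) → ¬ r y z) := by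
    simp only [List.mem_replicate]
    grind
  simp only [map_vertex_nbrs, List.pairwise_flatMap, List.pairwise_replicate, hblock]
  rw [← hst.pairwise_coe]
  constructor
  · rintro ⟨hself, hne⟩ y z hyz hy hz
    obtain rfl : y = z := by_contra fun h => hne (hkey y z hyz) (hkey z y (hr.symm hyz)) h hy hz hyz
    have := (hself y (hkey y y hyz)).resolve_right (not_not.2 hyz)
    exact ⟨rfl, by lia⟩
  · refine fun h => ⟨fun y _ => ?_, fun y _ z _ hyz hy hz hr => hyz (h y z hr hy hz).1⟩
    by_cases hy : r y y
    · rcases Nat.eq_zero_or_pos (G.mult s(p, y)) with h0 | hpos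
      · exact Or.inl (by lia)
      · exact Or.inl (by have := (h y y hy hpos hpos).2; lia)
    · exact Or.inr hy

theorem linkFeasible_nbrs (hr : IsPER r) (hst : (st.map Entry.vertex).Nodup)
    (hkey : ∀ x y, r x y → x ∈ st.map Entry.vertex) (hp : p ∉ st.map Entry.vertex) :
    G.LinkFeasible S p l ((G.nbrs p st).map Entry.vertex) (glue r (· = p)) ↔
      G.Linkable p r ∧ G.Feasible S l (G.Extend p r) := by
  have hpr : ∀ v, ¬ r p v := fun v h => hp (hkey _ _ h)
  have hrp : ∀ v, ¬ r v p := fun v h => hpr v (hr.symm h)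
  have ne_p {y} (hy : y ∈ (G.nbrs p st).map Entry.vertex) : y ≠ p := by
    rintro rfl
    exact hp (mem_map_vertex_nbrs.1 hy).1
  have hlinks : (p :: (G.nbrs p st).map Entry.vertex).Pairwise (fun y z => ¬ glue r (· = p) y z) ↔
      G.Linkable p r := by
    rw [List.pairwise_cons, and_iff_right, ← pairwise_nbrs_iff hr hst hkey]
    · exact List.Pairwise.iff_of_mem fun hy _ => not_congr (or_iff_left fun h => ne_p hy h.1)
    · rintro y hy (h | ⟨-, h⟩)
      exacts [hpr y h, ne_p hy h]
  have hclass {x} : (∃ y ∈ p :: (G.nbrs p st).map Entry.vertex, glue r (· = p) x y) ↔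
      G.Touch p r x := by
    simp only [List.mem_cons, exists_eq_or_imp, mem_map_vertex_nbrs, glue, Touch]
    constructor
    · rintro ((h | ⟨h, -⟩) | ⟨y, ⟨-, hpy⟩, h | ⟨h, -⟩⟩)
      exacts [absurd h (hrp x), Or.inl h, Or.inr ⟨y, h, hpy⟩, Or.inl h]
    · rintro (h | ⟨y, hxy, hpy⟩)
      exacts [Or.inl (Or.inr ⟨h, trivial⟩), Or.inr ⟨y, ⟨hkey y x (hr.symm hxy), hpy⟩, Or.inl hxy⟩]
  rw [linkFeasible_iff (isPER_glue_eq hr hpr) (Or.inr ⟨rfl, rfl⟩), hlinks]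
  refine and_congr_right fun _ => feasible_congr (fun _ _ => Iff.rfl) fun x y _ _ => ?_
  simp only [mergeClasses, Extend, glue, ← hclass]
  grind

end Nbrs

end Multigraph

/-! ### Counting the smallest members of a family -/

section Tally

variable {V : Type*}

/-- What a search for the smallest members of a family of sets reports: one of them and their
number, or nothing if all members are too large. -/
abbrev Tally (V : Type*) := Option (List V × ℕ)

/-- The tally of the union of two disjoint families. -/
def Tally.union : Tally V → Tally V → Tally V
  | none, r => r
  | some a, none => some a
  | some (w, c), some (w', c') =>
    if w.length < w'.length then some (w, c)
    else if w'.length < w.length then some (w', c')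
    else some (w, c + c')

/-- The tally of the family of all sets that arise from a member of a family by adding one of the
vertices of `cl`. -/
def Tally.insertOneOf (cl : List V) : Tally V → Tally V
  | none => none
  | some (w, c) => match cl with
    | [] => none
    | v :: _ => some (v :: w, cl.length * c)

/-- The tally of the solutions within the budget `k` that contain one of the vertices of `cl`, when
`f` gives the tallies for what remains after the deletion of such a vertex. -/
def Tally.spend (cl : List V) (f : ℕ → Tally V) : ℕ → Tally V
  | 0 => none
  | k + 1 => (f k).insertOneOf cl

variable [DecidableEq V] {F F' A B : Finset V → Prop} {S : Finset V} {v : V} {w w' cl : List V}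
  {c c' k : ℕ} {r r' : Tally V}
  {f : ℕ → Tally V}

/-- `w` lists the elements of a smallest member of the family `F`, which has exactly `c` smallest
members. -/
structure IsMinCount (F : Finset V → Prop) (w : List V) (c : ℕ) : Prop where
  nodup : w.Nodup
  mem : F w.toFinset
  le_card : ∀ S, F S → w.length ≤ S.card
  count_eq : c = Set.ncard {S | F S ∧ S.card = w.length}

/-- `r` describes the smallest members of the family `F`, provided that their size is at most
`k`. -/
def IsTally (k : ℕ) (F : Finset V → Prop) : Tally V → Prop
  | none => ∀ S, F S → k < S.card
  | some (w, c) => w.length ≤ k ∧ IsMinCount F w c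

/-- Membership in the family `F` does not depend on the vertex `v`. -/
def Insensitive (F : Finset V → Prop) (v : V) : Prop :=
  ∀ S, F (insert v S) ↔ F S

theorem Insensitive.erase_iff (h : Insensitive F v) : F (S.erase v) ↔ F S := by
  by_cases hv : v ∈ S
  · rw [← h (S.erase v), Finset.insert_erase hv]
  · rw [Finset.erase_eq_of_notMem hv]

theorem IsMinCount.congr (h : IsMinCount F' w c)
    (hF : ∀ S, S.card ≤ w.length → (F S ↔ F' S)) : IsMinCount F w c where
  nodup := h.nodup
  mem := (hF _ (List.toFinset_card_le w)).2 h.mem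
  le_card S hS := by
    by_contra! hlt
    exact hlt.not_ge (h.le_card S ((hF S hlt.le).1 hS))
  count_eq := by
    rw [h.count_eq]
    congr 1
    ext S
    exact and_congr_left fun hc => (hF S hc.le).symm

theorem IsMinCount.union [Finite V] (hA : IsMinCount A w c) (hB : IsMinCount B w' c')
    (hlen : w'.length = w.length) (hdisj : ∀ S, A S → ¬ B S) :
    IsMinCount (fun S => A S ∨ B S) w (c + c') where
  nodup := hA.nodup
  mem := Or.inl hA.mem
  le_card S hS := hS.elim (hA.le_card S) fun h => hlen ▸ hB.le_card S h
  count_eq := by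
    rw [hA.count_eq, hB.count_eq, hlen, ← Set.ncard_union_eq _ (Set.toFinite _) (Set.toFinite _)]
    · congr 1
      ext S
      exact or_and_right.symm
    · exact Set.disjoint_left.2 fun S hS hS' => hdisj S hS.1 hS'.1

theorem IsMinCount.card_lt_of_mem (h : IsMinCount F w c) (hv : Insensitive F v) (hS : F S)
    (hvS : v ∈ S) : w.length < S.card := by
  rw [← Finset.card_erase_add_one hvS]
  exact Nat.lt_succ_of_le (h.le_card _ (hv.erase_iff.2 hS))

theorem IsTally.congr (h : IsTally k F' r) (hF : ∀ S, F S ↔ F' S) : IsTally k F r := by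
  rwa [show F = F' from funext fun S => propext (hF S)]

theorem IsTally.avoid (h : IsTally k F' r) (hcl : ∀ v ∈ cl, Insensitive F' v)
    (hF : ∀ S, F S ↔ F' S ∧ ∀ v ∈ cl, v ∉ S) : IsTally k F r := by
  match r, h with
  | none, h => exact fun S hS => h S ((hF S).1 hS).1
  | some (w, c), ⟨hk, h⟩ =>
    refine ⟨hk, h.congr fun S hc => (hF S).trans (and_iff_left_of_imp fun hS v hv hvS => ?_)⟩
    exact hc.not_gt (h.card_lt_of_mem (hcl v hv) hS hvS)

theorem IsTally.union [Finite V] (hA : IsTally k A r) (hB : IsTally k B r')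
    (hdisj : ∀ S, A S → ¬ B S) (hF : ∀ S, F S ↔ A S ∨ B S) : IsTally k F (r.union r') := by
  refine IsTally.congr ?_ hF
  have left_of_lt {w c} (hA : IsMinCount A w c) (hlt : ∀ S, B S → w.length < S.card) :
      IsMinCount (fun S => A S ∨ B S) w c :=
    hA.congr fun S hc => or_iff_left fun h => hc.not_gt (hlt S h)
  have right_of_lt {w c} (hB : IsMinCount B w c) (hlt : ∀ S, A S → w.length < S.card) :
      IsMinCount (fun S => A S ∨ B S) w c :=
    hB.congr fun S hc => or_iff_right fun h => hc.not_gt (hlt S h)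
  match r, r', hA, hB with
  | none, none, hA, hB => exact fun S hS => hS.elim (hA S) (hB S)
  | none, some (w, c), hA, ⟨hk, hB⟩ => exact ⟨hk, right_of_lt hB fun S h => hk.trans_lt (hA S h)⟩
  | some (w, c), none, ⟨hk, hA⟩, hB => exact ⟨hk, left_of_lt hA fun S h => hk.trans_lt (hB S h)⟩
  | some (w, c), some (w', c'), ⟨hk, hA⟩, ⟨hk', hB⟩ =>
    simp only [Tally.union]
    split_ifs with hlt hgt
    · exact ⟨hk, left_of_lt hA fun S h => hlt.trans_le (hB.le_card S h)⟩
    · exact ⟨hk', right_of_lt hB fun S h => hgt.trans_le (hA.le_card S h)⟩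
    · exact ⟨hk, hA.union hB (by lia) hdisj⟩

theorem IsMinCount.ncard_insert_image (h : IsMinCount F w c) (hcl : cl.Nodup)
    (hins : ∀ v ∈ cl, Insensitive F v) :
    Set.ncard {S | (F S ∧ ∃ v ∈ cl, v ∈ S) ∧ S.card = w.length + 1} = cl.length * c := by
  have notMem {u T} (hu : u ∈ cl) (hT : F T ∧ T.card = w.length) : u ∉ T := fun huT =>
    hT.2.not_gt (h.card_lt_of_mem (hins u hu) hT.1 huT)
  have himage : {S | (F S ∧ ∃ v ∈ cl, v ∈ S) ∧ S.card = w.length + 1} =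
      (fun q : V × Finset V => insert q.1 q.2) ''
        ((cl.toFinset : Set V) ×ˢ {S | F S ∧ S.card = w.length}) := by
    ext S
    simp only [Set.mem_image, Set.mem_prod, Set.mem_ofPred_eq, Prod.exists, Finset.mem_coe,
      List.mem_toFinset]
    constructor
    · rintro ⟨⟨hS, u, hu, huS⟩, hc⟩
      refine ⟨u, S.erase u, ⟨hu, (hins u hu).erase_iff.2 hS, ?_⟩, Finset.insert_erase huS⟩
      rw [Finset.card_erase_of_mem huS, hc, Nat.add_sub_cancel]
    · rintro ⟨u, T, ⟨hu, hT⟩, rfl⟩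
      refine ⟨⟨(hins u hu _).2 hT.1, u, hu, Finset.mem_insert_self u T⟩, ?_⟩
      rw [Finset.card_insert_of_notMem (notMem hu hT), hT.2]
  rw [himage, Set.InjOn.ncard_image, Set.ncard_prod, h.count_eq, Set.ncard_coe_finset,
    List.toFinset_card_of_nodup hcl]
  rintro ⟨u, T⟩ ⟨hu, hT⟩ ⟨u', T'⟩ ⟨hu', hT'⟩ heq
  simp only [Finset.mem_coe, List.mem_toFinset, Set.mem_ofPred_eq] at hu hT hu' hT' heq
  obtain rfl : u = u' := (Finset.mem_insert.1 (heq ▸ Finset.mem_insert_self u T)).resolve_right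
    (notMem hu hT')
  rw [← Finset.erase_insert (notMem hu hT), heq, Finset.erase_insert (notMem hu hT')]

theorem IsTally.insertOneOf (h : IsTally k F' r) (hcl : cl.Nodup)
    (hins : ∀ v ∈ cl, Insensitive F' v) (hF : ∀ S, F S ↔ F' S ∧ ∃ v ∈ cl, v ∈ S) :
    IsTally (k + 1) F (r.insertOneOf cl) := by
  refine IsTally.congr ?_ hF
  match r, cl, h with
  | none, cl, h =>
    rintro S ⟨hS, v, hv, hvS⟩
    rw [← Finset.card_erase_add_one hvS]
    exact Nat.succ_lt_succ (h _ ((hins v hv).erase_iff.2 hS))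
  | some _, [], _ => exact fun S hS => by simp at hS
  | some (w, c), v :: cl, ⟨hk, h⟩ =>
    have hvw : v ∉ w := fun hv =>
      (h.card_lt_of_mem (hins v (by simp)) h.mem (List.mem_toFinset.2 hv)).not_ge
        (List.toFinset_card_le w)
    refine ⟨Nat.succ_le_succ hk, List.nodup_cons.2 ⟨hvw, h.nodup⟩, ?_, ?_, ?_⟩
    · rw [List.toFinset_cons]
      exact ⟨(hins v (by simp) _).2 h.mem, v, by simp, by simp⟩
    · rintro S ⟨hS, u, hu, huS⟩
      exact h.card_lt_of_mem (hins u hu) hS huS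
    · exact (h.ncard_insert_image hcl hins).symm

theorem IsTally.spend (h : ∀ k, IsTally k F' (f k)) (hcl : cl.Nodup)
    (hins : ∀ v ∈ cl, Insensitive F' v) (hF : ∀ S, F S ↔ F' S ∧ ∃ v ∈ cl, v ∈ S) :
    IsTally k F (Tally.spend cl f k) := by
  match k with
  | 0 =>
    intro S hS
    obtain ⟨v, -, hvS⟩ := ((hF S).1 hS).2
    exact Finset.card_pos.2 ⟨v, hvS⟩
  | k + 1 => exact (h k).insertOneOf hcl hins hF

theorem IsMinCount.count_le [Fintype V] (h : IsMinCount F w c) : c ≤ 2 ^ Fintype.card V := by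
  rw [h.count_eq, ← Fintype.card_finset, ← Nat.card_eq_fintype_card, ← Set.ncard_univ]
  exact Set.ncard_le_ncard (Set.subset_univ _) (Set.toFinite _)

end Tally

/-! ### The branching algorithm -/

section States

variable {V : Type*} {S : Finset V} {st : List (Entry V)} {e : Entry V} {a b p x y : V}

/-- After the deletion of `S`, the entry is still attached to its component. -/
def Entry.Alive (S : Finset V) (e : Entry V) : Prop :=
  ∀ v ∈ e.chain, v ∉ S

theorem Entry.alive_cons {cl : List V} :
    (⟨x, p :: cl, a⟩ : Entry V).Alive S ↔ p ∉ S ∧ ∀ v ∈ cl, v ∉ S :=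
  List.forall_mem_cons

/-- The entry of a vertex `p` that starts a new component, named after `p`. -/
def Entry.root (p : V) : Entry V :=
  ⟨p, [], p⟩

theorem Entry.alive_root : (Entry.root p).Alive S :=
  fun _ hv => absurd hv List.not_mem_nil

/-- After the deletion of `S`, the vertex `x` lies in the component named `a`. -/
def InComp (S : Finset V) (st : List (Entry V)) (a x : V) : Prop :=
  ∃ e ∈ st, e.vertex = x ∧ e.label = a ∧ e.Alive S

/-- After the deletion of `S`, the vertices `x` and `y` lie in the same component. -/
def SameComp (S : Finset V) (st : List (Entry V)) (x y : V) : Prop :=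
  ∃ a, InComp S st a x ∧ InComp S st a y

theorem eq_of_vertex_eq (hst : (st.map Entry.vertex).Nodup) {e e' : Entry V} (he : e ∈ st)
    (he' : e' ∈ st) (h : e.vertex = e'.vertex) : e = e' :=
  List.inj_on_of_nodup_map hst he he' h

theorem inComp_iff (hst : (st.map Entry.vertex).Nodup) (he : e ∈ st) :
    InComp S st a e.vertex ↔ a = e.label ∧ e.Alive S := by
  refine ⟨?_, fun ⟨ha, hS⟩ => ⟨e, he, rfl, ha.symm, hS⟩⟩
  rintro ⟨e', he', hv, rfl, hS⟩
  obtain rfl := eq_of_vertex_eq hst he' he hv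
  exact ⟨rfl, hS⟩

theorem InComp.mem_vertices (h : InComp S st a x) : x ∈ st.map Entry.vertex :=
  let ⟨_, he, hx, _⟩ := h
  List.mem_map.2 ⟨_, he, hx⟩

theorem InComp.label_unique (hst : (st.map Entry.vertex).Nodup) (ha : InComp S st a x)
    (hb : InComp S st b x) : a = b := by
  obtain ⟨e, he, rfl, rfl, -⟩ := ha
  exact ((inComp_iff hst he).1 hb).1.symm

theorem SameComp.mem_vertices (h : SameComp S st x y) : x ∈ st.map Entry.vertex :=
  let ⟨_, ha, _⟩ := h
  ha.mem_vertices

theorem sameComp_iff_inComp (hst : (st.map Entry.vertex).Nodup) (he : e ∈ st) (hS : e.Alive S) :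
    SameComp S st x e.vertex ↔ InComp S st e.label x := by
  simp only [SameComp, inComp_iff hst he, and_iff_left hS, exists_eq_right]

theorem not_sameComp_of_not_alive (hst : (st.map Entry.vertex).Nodup) (he : e ∈ st)
    (hS : ¬ e.Alive S) : ¬ SameComp S st x e.vertex :=
  fun ⟨_, _, h⟩ => hS ((inComp_iff hst he).1 h).2

theorem isPER_sameComp (hst : (st.map Entry.vertex).Nodup) : IsPER (SameComp S st) where
  symm := fun ⟨a, hx, hy⟩ => ⟨a, hy, hx⟩
  trans := by
    rintro x y z ⟨a, hx, hy⟩ ⟨b, hy', hz⟩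
    obtain rfl := hy.label_unique hst hy'
    exact ⟨a, hx, hz⟩

theorem inComp_cons :
    InComp S (e :: st) a x ↔ (x = e.vertex ∧ a = e.label ∧ e.Alive S) ∨ InComp S st a x := by
  simp only [InComp, List.mem_cons, exists_eq_or_imp, eq_comm (a := e.vertex),
    eq_comm (a := e.label)]

theorem sameComp_cons_of_alive (he : e.Alive S) :
    SameComp S (e :: st) =
      glue (SameComp S st) fun x => x = e.vertex ∨ InComp S st e.label x := by
  funext x y
  simp only [SameComp, inComp_cons, he, and_true, glue, eq_iff_iff]
  grind

theorem sameComp_cons_of_not_alive (he : ¬ e.Alive S) : SameComp S (e :: st) = SameComp S st := by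
  funext x y
  simp only [SameComp, inComp_cons, he, and_false, false_or]

theorem sameComp_root_cons (hp : ∀ e ∈ st, e.label ≠ p) :
    SameComp S (Entry.root p :: st) = glue (SameComp S st) (· = p) := by
  have hempty (x : V) : ¬ InComp S st p x := fun ⟨e, he, _, hep, _⟩ => hp e he hep
  rw [sameComp_cons_of_alive Entry.alive_root]
  simp only [Entry.root, hempty, or_false]

variable [DecidableEq V]

/-- Unite the components with the labels `a` and `p`. -/
def relabel (a p : V) (st : List (Entry V)) : List (Entry V) :=
  st.map fun e => { e with label := if e.label = a then p else e.label }

theorem length_relabel (a p : V) (st : List (Entry V)) :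
    (relabel a p st).length = st.length :=
  List.length_map _

theorem map_vertex_relabel (a p : V) (st : List (Entry V)) :
    (relabel a p st).map Entry.vertex = st.map Entry.vertex := by
  simp [relabel]

theorem root_mem_relabel (h : Entry.root p ∈ st) : Entry.root p ∈ relabel a p st :=
  List.mem_map.2 ⟨_, h, congrArg (Entry.mk p []) (ite_self p)⟩

theorem inComp_relabel :
    InComp S (relabel a p st) b x ↔ ∃ c, InComp S st c x ∧ (if c = a then p else c) = b := by
  simp only [InComp, relabel, List.mem_map]
  constructor
  · rintro ⟨_, ⟨e, he, rfl⟩, hx, hb, hS⟩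
    exact ⟨e.label, ⟨e, he, hx, rfl, hS⟩, hb⟩
  · rintro ⟨_, ⟨e, he, hx, rfl, hS⟩, hb⟩
    exact ⟨_, ⟨e, he, rfl⟩, hx, hb, hS⟩

theorem sameComp_relabel (hst : (st.map Entry.vertex).Nodup) (hp : Entry.root p ∈ st)
    (he : e ∈ st) (hS : e.Alive S) :
    SameComp S (relabel e.label p st) = mergeClasses (SameComp S st) [e.vertex, p] := by
  have hclass (x : V) : (∃ z ∈ [e.vertex, p], SameComp S st x z) ↔
      InComp S st e.label x ∨ InComp S st p x := by
    have hroot : SameComp S st x p ↔ InComp S st p x :=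
      sameComp_iff_inComp hst hp Entry.alive_root
    simp only [List.mem_cons, List.not_mem_nil, or_false, exists_eq_or_imp, exists_eq_left,
      sameComp_iff_inComp hst he hS]
    exact or_congr_right hroot
  funext x y
  rw [mergeClasses, glue, hclass, hclass]
  simp only [SameComp, inComp_relabel, eq_iff_iff]
  constructor
  · rintro ⟨_, ⟨c, hcx, rfl⟩, c', hcy, hcc'⟩
    split_ifs at hcc' with h h' h' <;> grind
  · rintro (⟨c, hx, hy⟩ | ⟨hx | hx, hy | hy⟩)
    exacts [⟨_, ⟨c, hx, rfl⟩, c, hy, rfl⟩, ⟨p, ⟨_, hx, by simp⟩, _, hy, by simp⟩,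
      ⟨p, ⟨_, hx, by simp⟩, _, hy, by simp⟩, ⟨p, ⟨_, hx, by simp⟩, _, hy, by simp⟩,
      ⟨p, ⟨_, hx, by simp⟩, _, hy, by simp⟩]

theorem sameComp_insert_iff {v : V} (hx : ∀ e ∈ st, e.vertex = x → v ∉ e.chain)
    (hy : ∀ e ∈ st, e.vertex = y → v ∉ e.chain) :
    SameComp (insert v S) st x y ↔ SameComp S st x y := by
  have hinComp {a z} (hz : ∀ e ∈ st, e.vertex = z → v ∉ e.chain) :
      InComp (insert v S) st a z ↔ InComp S st a z := by
    refine exists_congr fun e => and_congr_right fun he => and_congr_right fun hez =>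
      and_congr_right fun _ => forall₂_congr fun u hu => ?_
    rw [Finset.mem_insert, or_iff_right (ne_of_mem_of_not_mem hu (hz e he hez))]
  simp only [SameComp, hinComp hx, hinComp hy]

/-- Branch on the edges from the new vertex `p` to the entries in the list: either the entry is
cut off by the deletion of a vertex of its chain, or its component is united with that of `p`. -/
def link (cont : List (Entry V) → ℕ → Tally V) (p : V) :
    List (Entry V) → List (Entry V) → ℕ → Tally V
  | [], st, k => cont st k
  | e :: L, st, k =>
    (Tally.spend e.chain (link cont p L st) k).union
      (if e.label = p then none else
        link cont p (relabel e.label p L) (relabel e.label p st) k)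
termination_by L => L.length
decreasing_by all_goals simp [length_relabel]

end States

namespace Multigraph

variable {V : Type*} (G : Multigraph V)

/-- The branching algorithm: the smallest deletion sets for the state `st` and the vertices `todo`
still to be added. Vertices that are marked by `true` are always branched on. -/
def proc [DecidableEq V] : List (V × Bool) → List (Entry V) → ℕ → Tally V
  | [], _, _ => some ([], 1)
  | (p, z) :: rest, st, k =>
    match z, G.nbrs p st with
    | false, [] => proc rest st k
    | false, [e] => proc rest (⟨p, p :: e.chain, e.label⟩ :: st) k
    | _, L => (Tally.spend [p] (proc rest st) k).union
        (link (proc rest) p L (Entry.root p :: st) k)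

/-- Every unmarked vertex has at most one edge to the later vertices. -/
def Ordered : List (V × Bool) → Prop
  | [] => True
  | (p, z) :: l => (z = false → G.degTo p (l.map Prod.fst) ≤ 1) ∧ Ordered l

/-- Some edge at `x` is still to be added: `x` is in the list `L` of the neighbours to which the
current vertex is to be linked, or it has a neighbour in the list `l` of the later vertices. -/
def Pending (L l : List V) (x : V) : Prop :=
  x ∈ L ∨ G.AdjTo l x

section

variable {G} {S : Finset V} {L l : List V} {st : List (Entry V)} {e : Entry V} {p : V}

theorem linkFeasible_cons_of_not_alive (hst : (st.map Entry.vertex).Nodup) (he : e ∈ st)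
    (hS : ¬ e.Alive S) :
    G.LinkFeasible S p l (e.vertex :: L) (SameComp S st) ↔
      G.LinkFeasible S p l L (SameComp S st) := by
  have hr := isPER_sameComp (S := S) hst
  have hrel {u} : ¬ SameComp S st u e.vertex := not_sameComp_of_not_alive hst he hS
  rw [LinkFeasible, mergeClasses_cons_of_forall_not fun _ => hrel, mergeClasses_singleton hr,
    and_iff_right fun h => hrel (hr.symm h)]

theorem feasible_cons_of_isolated {r : V → V → Prop} (hpl : p ∉ l) (hdeg : G.degTo p l ≤ 1)
    (hr : IsPER r) (hpr : ∀ v, ¬ r p v) (hpS : p ∉ S)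
    (hiso : ∀ y z, r y z → G.mult s(p, y) = 0) :
    G.Feasible S (p :: l) r ↔ G.Feasible S l r := by
  have htouch : G.Touch p r = (· = p) := by
    funext u
    refine propext (or_iff_left ?_)
    rintro ⟨z, huz, hpz⟩
    exact hpz.ne' (hiso z u (hr.symm huz))
  have hlink : G.Linkable p r := fun y z hyz hpy _ => absurd (hiso y z hyz) hpy.ne'
  rw [Feasible, and_iff_right (absurd · hpS), forall_prop_of_true hpS, and_iff_right hlink, Extend,
    htouch]
  exact feasible_glue_eq hpl hdeg hpr fun v h => hpr v (hr.symm h)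

end

variable [DecidableEq V]

/-- The invariant of the branching algorithm for a single entry, where `L` and `l` are as in
`Pending`. -/
structure ValidEntry (L l : List V) (e : Entry V) : Prop where
  vertex_notMem : e.vertex ∉ l
  label_notMem : e.label ∉ l
  chain_notMem : ∀ v ∈ e.chain, v ∉ l
  chain_nodup : e.chain.Nodup
  degree : e.chain ≠ [] → L.count e.vertex + G.degTo e.vertex l ≤ 1

/-- The invariant of the branching algorithm for the state `st`, where `L` and `l` are as in
`Pending`. -/
structure Inv (L l : List V) (st : List (Entry V)) : Prop where
  nodup : (st.map Entry.vertex).Nodup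
  valid : ∀ e ∈ st, G.ValidEntry L l e
  disjoint : ∀ e ∈ st, ∀ e' ∈ st, e.vertex ≠ e'.vertex → G.Pending L l e.vertex →
    G.Pending L l e'.vertex → e.chain.Disjoint e'.chain

variable {G} {S : Finset V} {L l : List V} {st : List (Entry V)} {e e' : Entry V} {a p v x y : V}

theorem Inv.notMem_chain (h : G.Inv (e.vertex :: L) l st) (he : e ∈ st) (hv : v ∈ e.chain)
    (he' : e' ∈ st) (hpend : G.Pending L l e'.vertex) : v ∉ e'.chain := by
  refine h.disjoint e he e' he' ?_ (Or.inl List.mem_cons_self)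
    (hpend.imp_left (List.mem_cons_of_mem _)) hv
  intro hee'
  have hdeg := (h.valid e he).degree (List.ne_nil_of_mem hv)
  rw [← hee'] at hpend
  rw [List.count_cons_self] at hdeg
  rcases hpend with hmem | hadj
  · have := List.count_pos_iff.2 hmem
    lia
  · have := hadj.degTo_pos
    lia

theorem Inv.tail (h : G.Inv (y :: L) l st) : G.Inv L l st where
  nodup := h.nodup
  valid e he :=
    { h.valid e he with
      degree := fun hne => le_trans (by grw [List.count_le_count_cons])
        ((h.valid e he).degree hne) }
  disjoint e he e' he' hne hpend hpend' :=
    h.disjoint e he e' he' hne (hpend.imp_left (List.mem_cons_of_mem _))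
      (hpend'.imp_left (List.mem_cons_of_mem _))

theorem Inv.relabel (h : G.Inv L l st) (hp : p ∉ l) : G.Inv L l (relabel a p st) where
  nodup := by rw [map_vertex_relabel]; exact h.nodup
  valid := List.forall_mem_map.2 fun e he =>
    { h.valid e he with
      label_notMem := by
        dsimp only
        split_ifs
        exacts [hp, (h.valid e he).label_notMem] }
  disjoint := List.forall_mem_map.2 fun e he => List.forall_mem_map.2 (h.disjoint e he)

theorem Inv.skip (h : G.Inv [] (p :: l) st) : G.Inv [] l st where
  nodup := h.nodup
  valid e he :=
    { vertex_notMem := fun hm => (h.valid e he).vertex_notMem (List.mem_cons_of_mem _ hm)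
      label_notMem := fun hm => (h.valid e he).label_notMem (List.mem_cons_of_mem _ hm)
      chain_notMem := fun v hv hm => (h.valid e he).chain_notMem v hv (List.mem_cons_of_mem _ hm)
      chain_nodup := (h.valid e he).chain_nodup
      degree := fun hne => by
        have := (h.valid e he).degree hne
        rw [degTo_cons] at this
        lia }
  disjoint e he e' he' hne hpend hpend' :=
    h.disjoint e he e' he' hne (hpend.imp_right AdjTo.cons) (hpend'.imp_right AdjTo.cons)

theorem Inv.vertex_fresh (h : G.Inv [] (p :: l) st) : p ∉ st.map Entry.vertex := by
  intro hp
  obtain ⟨e, he, rfl⟩ := List.mem_map.1 hp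
  exact (h.valid e he).vertex_notMem List.mem_cons_self

theorem Inv.label_fresh (h : G.Inv [] (p :: l) st) (he : e ∈ st) : e.label ≠ p := by
  rintro rfl
  exact (h.valid e he).label_notMem List.mem_cons_self

theorem Inv.chain_fresh (h : G.Inv [] (p :: l) st) (he : e ∈ st) : p ∉ e.chain :=
  fun hp => (h.valid e he).chain_notMem p hp List.mem_cons_self

theorem count_nbrs (hst : (st.map Entry.vertex).Nodup) (he : e ∈ st) :
    ((G.nbrs p st).map Entry.vertex).count e.vertex = min 2 (G.mult s(p, e.vertex)) := by
  have hcount (l : List V) :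
      (l.flatMap fun y => List.replicate (min 2 (G.mult s(p, y))) y).count e.vertex =
        l.count e.vertex * min 2 (G.mult s(p, e.vertex)) := by
    induction l with
    | nil => simp
    | cons y l ih =>
      rw [List.flatMap_cons, List.count_append, ih, List.count_replicate, List.count_cons]
      by_cases hy : y = e.vertex
      · simp only [hy, beq_self_eq_true, if_true]
        ring
      · simp [hy]
  rw [map_vertex_nbrs, hcount, List.count_eq_one_of_mem hst (List.mem_map_of_mem he), one_mul]

theorem Inv.root_cons (h : G.Inv [] (p :: l) st) (hp : p ∉ l) :
    G.Inv ((G.nbrs p st).map Entry.vertex) l (Entry.root p :: st) where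
  nodup := List.nodup_cons.2 ⟨h.vertex_fresh, h.nodup⟩
  valid := by
    refine List.forall_mem_cons.2 ⟨⟨hp, hp, by simp [Entry.root], List.nodup_nil, by
      simp [Entry.root]⟩, fun e he => { h.skip.valid e he with degree := fun hne => ?_ }⟩
    have := (h.valid e he).degree hne
    rw [degTo_cons, List.count_nil, Sym2.eq_swap] at this
    rw [count_nbrs h.nodup he]
    lia
  disjoint := by
    have pending {x} (hx : G.Pending ((G.nbrs p st).map Entry.vertex) l x) :
        G.Pending [] (p :: l) x :=
      Or.inr (hx.elim (fun hx => ⟨p, by simp, (mem_map_vertex_nbrs.1 hx).2⟩) AdjTo.cons)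
    refine List.forall_mem_cons.2 ⟨fun _ _ _ _ _ => by simp [Entry.root], fun e he =>
      List.forall_mem_cons.2 ⟨fun _ _ _ => by simp [Entry.root], fun e' he' hne h1 h2 =>
        h.disjoint e he e' he' hne (pending h1) (pending h2)⟩⟩

theorem Inv.chain_cons (h : G.Inv [] (p :: l) st) (hp : p ∉ l) (hdeg : G.degTo p l ≤ 1)
    (he : e ∈ st) (hpe : 0 < G.mult s(p, e.vertex)) :
    G.Inv [] l (⟨p, p :: e.chain, e.label⟩ :: st) where
  nodup := List.nodup_cons.2 ⟨h.vertex_fresh, h.nodup⟩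
  valid := by
    have hvalid := h.skip.valid e he
    exact List.forall_mem_cons.2 ⟨⟨hp, hvalid.label_notMem,
      List.forall_mem_cons.2 ⟨hp, hvalid.chain_notMem⟩,
      List.nodup_cons.2 ⟨h.chain_fresh he, hvalid.chain_nodup⟩, fun _ => by simpa using hdeg⟩,
      h.skip.valid⟩
  disjoint := by
    have hdisj : ∀ e' ∈ st, G.Pending [] l e'.vertex → (p :: e.chain).Disjoint e'.chain := by
      intro e' he' hpend
      have hadj := hpend.resolve_left List.not_mem_nil
      refine List.disjoint_cons_left.2 ⟨h.chain_fresh he', ?_⟩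
      by_cases hnil : e.chain = []
      · simp [hnil]
      · refine h.disjoint e he e' he' (fun hee' => ?_) (Or.inr ⟨p, by simp, hpe⟩)
          (Or.inr hadj.cons)
        have hdeg := (h.valid e he).degree hnil
        have := hadj.degTo_pos
        rw [degTo_cons, List.count_nil, Sym2.eq_swap, hee'] at hdeg
        rw [hee'] at hpe
        lia
    exact List.forall_mem_cons.2 ⟨List.forall_mem_cons.2 ⟨fun hne => absurd rfl hne,
      fun e' he' _ _ => hdisj e' he'⟩, fun e' he' => List.forall_mem_cons.2
        ⟨fun _ hpend _ => (hdisj e' he' hpend).symm, h.skip.disjoint e' he'⟩⟩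

theorem feasible_insensitive (hvl : v ∉ l) (hv : ∀ e ∈ st, G.AdjTo l e.vertex → v ∉ e.chain) :
    Insensitive (fun S => G.Feasible S l (SameComp S st)) v := by
  intro S
  refine feasible_congr (fun q hq => ?_) fun x y hx hy => sameComp_insert_iff
    (fun e he hex => hv e he (hex ▸ hx)) fun e he hey => hv e he (hey ▸ hy)
  rw [Finset.mem_insert, or_iff_right (ne_of_mem_of_not_mem hq hvl)]

theorem linkFeasible_insensitive (hvl : v ∉ l) (hst : (st.map Entry.vertex).Nodup)
    (hp : Entry.root p ∈ st) (hv : ∀ e ∈ st, G.Pending L l e.vertex → v ∉ e.chain) :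
    Insensitive (fun S => G.LinkFeasible S p l L (SameComp S st)) v := by
  intro S
  have hnotMem {x} (hx : x = p ∨ G.Pending L l x) : ∀ e ∈ st, e.vertex = x → v ∉ e.chain := by
    rintro e he rfl
    rcases hx with hep | hx
    · rw [eq_of_vertex_eq hst he hp hep]
      exact List.not_mem_nil
    · exact hv e he hx
  refine linkFeasible_congr (fun q hq => ?_) fun x y hx hy =>
    sameComp_insert_iff (hnotMem hx) (hnotMem hy)
  rw [Finset.mem_insert, or_iff_right (ne_of_mem_of_not_mem hq hvl)]

theorem linkFeasible_cons_of_alive (hst : (st.map Entry.vertex).Nodup) (hp : Entry.root p ∈ st)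
    (he : e ∈ st) (hS : e.Alive S) :
    G.LinkFeasible S p l (e.vertex :: L) (SameComp S st) ↔
      e.label ≠ p ∧ G.LinkFeasible S p l L (SameComp S (CountFVS.relabel e.label p st)) := by
  have hlabel : SameComp S st e.vertex p ↔ e.label = p :=
    (sameComp_iff_inComp hst hp Entry.alive_root).trans <|
      (inComp_iff hst he).trans <| (and_iff_left hS).trans eq_comm
  rw [LinkFeasible, sameComp_relabel hst hp he hS, hlabel]

theorem isTally_link [Finite V] {cont : List (Entry V) → ℕ → Tally V}
    (hcont : ∀ st k, G.Inv [] l st →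
      IsTally k (fun S => G.Feasible S l (SameComp S st)) (cont st k))
    (hpl : p ∉ l) : ∀ {L st : List (Entry V)} {k : ℕ}, L ⊆ st → Entry.root p ∈ st →
      G.Inv (L.map Entry.vertex) l st →
      IsTally k (fun S => G.LinkFeasible S p l (L.map Entry.vertex) (SameComp S st))
        (link cont p L st k)
  | [], st, k, _, _, hinv => by
    rw [link]
    exact hcont st k hinv
  | e :: L, st, k, hsub, hp, hinv => by
    obtain ⟨he, hsub⟩ := List.cons_subset.1 hsub
    have hvalid := hinv.valid e he
    have hskip (k) := isTally_link hcont hpl (k := k) hsub hp hinv.tail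
    have hmerge := isTally_link hcont hpl (k := k) (List.map_subset _ hsub)
      (root_mem_relabel (a := e.label) hp)
      (by rw [← CountFVS.relabel, map_vertex_relabel]; exact hinv.tail.relabel hpl)
    rw [← CountFVS.relabel, map_vertex_relabel] at hmerge
    rw [link]
    refine IsTally.union (A := fun S => G.LinkFeasible S p l (L.map Entry.vertex)
        (SameComp S st) ∧ ∃ v ∈ e.chain, v ∈ S)
      (B := fun S => (e.label ≠ p ∧ G.LinkFeasible S p l (L.map Entry.vertex)
        (SameComp S (CountFVS.relabel e.label p st))) ∧ e.Alive S)
      ?_ ?_ (fun S ⟨_, v, hv, hvS⟩ ⟨_, h⟩ => h v hv hvS) fun S => ?_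
    · exact IsTally.spend hskip hvalid.chain_nodup (fun v hv => linkFeasible_insensitive
        (hvalid.chain_notMem v hv) hinv.nodup hp fun e' he' => hinv.notMem_chain he hv he')
        fun S => Iff.rfl
    · split_ifs with hep
      · exact fun S hS => absurd hep hS.1.1
      · refine hmerge.avoid (fun v hv => ?_) fun S => and_congr_left fun _ => and_iff_right hep
        exact linkFeasible_insensitive (hvalid.chain_notMem v hv) (hinv.relabel hpl).nodup
          (root_mem_relabel hp)
          (List.forall_mem_map.2 fun e' he' hpend =>
            (hinv.notMem_chain he hv he' hpend : v ∉ e'.chain))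
    · by_cases hS : e.Alive S
      · have hnone : ¬ ∃ v ∈ e.chain, v ∈ S := fun ⟨v, hv, hvS⟩ => hS v hv hvS
        rw [List.map_cons, linkFeasible_cons_of_alive hinv.nodup hp he hS]
        exact (and_iff_left hS).symm.trans (or_iff_right fun h => hnone h.2).symm
      · have hsome : ∃ v ∈ e.chain, v ∈ S := by simpa [Entry.Alive] using hS
        rw [List.map_cons, linkFeasible_cons_of_not_alive hinv.nodup he hS]
        exact (and_iff_left hsome).symm.trans (or_iff_left fun h => hS h.2).symm
termination_by L => L.length
decreasing_by all_goals simp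

theorem isTally_nil {F : Finset V → Prop} {k : ℕ} (hF : ∀ S, F S) : IsTally k F (some ([], 1)) := by
  refine ⟨Nat.zero_le k, List.nodup_nil, hF _, fun S _ => Nat.zero_le _, ?_⟩
  have hsingle : {S : Finset V | F S ∧ S.card = ([] : List V).length} = {∅} := by
    ext S
    simp [hF]
  rw [hsingle, Set.ncard_singleton]

theorem proc_cons_of_branch {z : Bool} {rest : List (V × Bool)} {k : ℕ}
    (h : z = true ∨ 2 ≤ (G.nbrs p st).length) :
    G.proc ((p, z) :: rest) st k = (Tally.spend [p] (G.proc rest st) k).union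
      (link (G.proc rest) p (G.nbrs p st) (Entry.root p :: st) k) := by
  rw [proc.eq_def]
  dsimp only
  split
  · next h' => simp [h'] at h
  · next h' => simp [h'] at h
  · rfl

theorem proc_cons_of_nil {rest : List (V × Bool)} {k : ℕ} (h : G.nbrs p st = []) :
    G.proc ((p, false) :: rest) st k = G.proc rest st k := by
  rw [proc.eq_def]
  simp only [h]

theorem proc_cons_of_singleton {rest : List (V × Bool)} {k : ℕ} (h : G.nbrs p st = [e]) :
    G.proc ((p, false) :: rest) st k =
      G.proc rest (⟨p, p :: e.chain, e.label⟩ :: st) k := by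
  rw [proc.eq_def]
  simp only [h]

theorem feasible_cons_iff_of_branch (hinv : G.Inv [] (p :: l) st) :
    G.Feasible S (p :: l) (SameComp S st) ↔
      (G.Feasible S l (SameComp S st) ∧ ∃ v ∈ [p], v ∈ S) ∨
      G.LinkFeasible S p l ((G.nbrs p st).map Entry.vertex) (SameComp S (Entry.root p :: st)) ∧
        ∀ v ∈ [p], v ∉ S := by
  rw [sameComp_root_cons fun e he => hinv.label_fresh he,
    linkFeasible_nbrs (isPER_sameComp hinv.nodup) hinv.nodup (fun _ _ => SameComp.mem_vertices)
      hinv.vertex_fresh]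
  by_cases hpS : p ∈ S <;> simp [Feasible, hpS]

theorem feasible_cons_iff_of_nbrs_eq_nil (hinv : G.Inv [] (p :: l) st) (hpl : p ∉ l)
    (hdeg : G.degTo p l ≤ 1) (hnbrs : G.nbrs p st = []) :
    G.Feasible S (p :: l) (SameComp S st) ↔ G.Feasible S l (SameComp S st) := by
  by_cases hpS : p ∈ S
  · simp [Feasible, hpS]
  · refine feasible_cons_of_isolated hpl hdeg (isPER_sameComp hinv.nodup)
      (fun v h => hinv.vertex_fresh h.mem_vertices) hpS fun y z hyz => ?_
    by_contra h0
    have hmem := mem_map_vertex_nbrs.2 ⟨hyz.mem_vertices, Nat.pos_of_ne_zero h0⟩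
    simp [hnbrs] at hmem

theorem feasible_cons_iff_of_nbrs_eq_singleton (hinv : G.Inv [] (p :: l) st) (hpl : p ∉ l)
    (hdeg : G.degTo p l ≤ 1) (hnbrs : G.nbrs p st = [e]) :
    G.Feasible S (p :: l) (SameComp S st) ↔
      G.Feasible S l (SameComp S (⟨p, p :: e.chain, e.label⟩ :: st)) := by
  obtain ⟨he, hpe⟩ : e ∈ st ∧ 0 < G.mult s(p, e.vertex) := mem_nbrs.1 (hnbrs ▸ by simp)
  have hr := isPER_sameComp (S := S) hinv.nodup
  have honly {y z} (hyz : SameComp S st y z) (hy : 0 < G.mult s(p, y)) : y = e.vertex := by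
    have hmem := mem_map_vertex_nbrs.2 ⟨hyz.mem_vertices, hy⟩
    simpa [hnbrs] using hmem
  by_cases hpS : p ∈ S
  · rw [sameComp_cons_of_not_alive fun h => h p List.mem_cons_self hpS]
    simp [Feasible, hpS]
  by_cases hS : e.Alive S
  · have hmult : G.mult s(p, e.vertex) = 1 := by
      have hcount := count_nbrs (G := G) (p := p) hinv.nodup he
      simp only [hnbrs, List.map_singleton, List.count_singleton_self] at hcount
      lia
    have hlink : G.Linkable p (SameComp S st) := fun y z hyz hy hz =>
      ⟨(honly hyz hy).trans (honly (hr.symm hyz) hz).symm, honly hyz hy ▸ hmult⟩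
    have htouch : G.Touch p (SameComp S st) = fun x => x = p ∨ InComp S st e.label x := by
      funext u
      refine propext (or_congr_right ?_)
      rw [← sameComp_iff_inComp hinv.nodup he hS]
      refine ⟨fun ⟨z, huz, hz⟩ => honly (hr.symm huz) hz ▸ huz, fun h => ⟨_, h, hpe⟩⟩
    rw [sameComp_cons_of_alive (Entry.alive_cons.2 ⟨hpS, hS⟩), Feasible,
      and_iff_right (absurd · hpS), forall_prop_of_true hpS, and_iff_right hlink, Extend, htouch]
  · rw [sameComp_cons_of_not_alive fun h => hS (Entry.alive_cons.1 h).2]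
    refine feasible_cons_of_isolated hpl hdeg hr (fun v h => hinv.vertex_fresh h.mem_vertices) hpS
      fun y z hyz => ?_
    by_contra h0
    obtain rfl := honly hyz (Nat.pos_of_ne_zero h0)
    exact not_sameComp_of_not_alive hinv.nodup he hS (hr.symm hyz)

theorem isTally_proc [Finite V] : ∀ {todo : List (V × Bool)} {st : List (Entry V)} {k : ℕ},
    (todo.map Prod.fst).Nodup → G.Ordered todo → G.Inv [] (todo.map Prod.fst) st →
      IsTally k (fun S => G.Feasible S (todo.map Prod.fst) (SameComp S st)) (G.proc todo st k)
  | [], st, k, _, _, _ => isTally_nil fun _ => trivial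
  | (p, z) :: rest, st, k, hnodup, hord, hinv => by
    obtain ⟨hpl, hnodup⟩ := List.nodup_cons.1 hnodup
    have ih {st k} (hinv : G.Inv [] (rest.map Prod.fst) st) :=
      isTally_proc (k := k) hnodup hord.2 hinv
    by_cases hbranch : z = true ∨ 2 ≤ (G.nbrs p st).length
    · rw [proc_cons_of_branch hbranch]
      have hroot := hinv.root_cons hpl
      refine IsTally.union
        (IsTally.spend (fun k => ih hinv.skip) (List.nodup_singleton p) ?_ fun S => Iff.rfl)
        ((isTally_link (fun st k => ih) hpl (fun e he => List.mem_cons_of_mem _ (mem_nbrs.1 he).1)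
          List.mem_cons_self hroot).avoid (cl := [p]) ?_ fun S => Iff.rfl)
        (fun S ⟨_, v, hv, hvS⟩ ⟨_, h⟩ => h v hv hvS) fun S => feasible_cons_iff_of_branch hinv
      · exact List.forall_mem_singleton.2
          (feasible_insensitive hpl fun e he _ => hinv.chain_fresh he)
      · exact List.forall_mem_singleton.2 (linkFeasible_insensitive hpl hroot.nodup
          List.mem_cons_self (List.forall_mem_cons.2 ⟨fun _ => List.not_mem_nil,
            fun e he _ => hinv.chain_fresh he⟩))
    · obtain ⟨hz, hlen⟩ := not_or.1 hbranch
      rw [Bool.not_eq_true] at hz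
      subst hz
      have hdeg := hord.1 rfl
      match hnbrs : G.nbrs p st with
      | [] =>
        rw [proc_cons_of_nil hnbrs]
        exact (ih hinv.skip).congr fun S => feasible_cons_iff_of_nbrs_eq_nil hinv hpl hdeg hnbrs
      | [e] =>
        rw [proc_cons_of_singleton hnbrs]
        obtain ⟨he, hpe⟩ : e ∈ st ∧ 0 < G.mult s(p, e.vertex) := mem_nbrs.1 (hnbrs ▸ by simp)
        exact (ih (hinv.chain_cons hpl hdeg he hpe)).congr fun S =>
          feasible_cons_iff_of_nbrs_eq_singleton hinv hpl hdeg hnbrs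
      | _ :: _ :: _ => simp [hnbrs] at hlen

end Multigraph

/-! ### Iterative compression -/

/-- The number of smallest members that is read off from a tally. -/
def Tally.count {V : Type*} : Tally V → ℕ
  | none => 0
  | some (_, c) => c

theorem length_filter_notMem_singleton_lt {V : Type*} [DecidableEq V] {l : List V} {x : V}
    (hx : x ∈ l) : (l.filter (· ∉ [x])).length < l.length :=
  List.length_filter_lt_length_iff_exists.2 ⟨x, hx, by simp⟩

namespace Multigraph

section

variable {V : Type*} {G : Multigraph V} {l : List V} {x : V}

theorem degTo_le_one : ∀ {l : List V}, l.Nodup →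
    (∀ y ∈ l, ∀ z ∈ l, 0 < G.mult s(x, y) → 0 < G.mult s(x, z) → y = z ∧ G.mult s(x, y) = 1) →
      G.degTo x l ≤ 1
  | [], _, _ => zero_le_one
  | a :: l, hnodup, hleaf => by
    obtain ⟨hal, hnodup⟩ := List.nodup_cons.1 hnodup
    rw [degTo_cons]
    rcases Nat.eq_zero_or_pos (G.mult s(x, a)) with ha | ha
    · rw [ha, zero_add]
      exact degTo_le_one hnodup fun y hy z hz =>
        hleaf y (List.mem_cons_of_mem _ hy) z (List.mem_cons_of_mem _ hz)
    · have hrest : G.degTo x l = 0 := by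
        refine List.sum_eq_zero fun m hm => ?_
        obtain ⟨y, hy, rfl⟩ := List.mem_map.1 hm
        by_contra hne
        obtain rfl := (hleaf a List.mem_cons_self y (List.mem_cons_of_mem _ hy) ha
          (Nat.pos_of_ne_zero hne)).1
        exact hal hy
      rw [hrest, (hleaf a List.mem_cons_self a List.mem_cons_self ha ha).2]

theorem degTo_le_of_subperm {l' : List V} (h : l'.Subperm l) : G.degTo x l' ≤ G.degTo x l := by
  obtain ⟨l₁, hperm, hsub⟩ := h
  rw [degTo, ← (hperm.map _).sum_eq]
  exact (hsub.map _).sum_le_sum fun _ _ => Nat.zero_le _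

theorem ordered_marked {todo : List (V × Bool)} (h : G.Ordered todo) :
    ∀ w : List V, G.Ordered (w.map (·, true) ++ todo)
  | [] => h
  | _ :: w => ⟨fun h => absurd h (by simp), ordered_marked h w⟩

end

variable {V : Type*} [DecidableEq V] (G : Multigraph V)

/-- Order the vertices of a forest such that every vertex has at most one edge to the later
ones. -/
def order (l : List V) : List V :=
  match _h : l.find? fun x => G.degTo x l ≤ 1 with
  | none => []
  | some x => x :: order (l.filter (· ∉ [x]))
termination_by l.length
decreasing_by
  rw [List.unattach_filter (g := (· ∉ [x])) (hf := fun _ _ => rfl), List.unattach_attach]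
  exact length_filter_notMem_singleton_lt (List.mem_of_find?_eq_some _h)

/-- The marked vertices of the next instance of the branching algorithm, if `w` is a feedback
vertex set of the graph that is induced by `vs`. -/
def nextTodo (v : V) (vs w : List V) : List (V × Bool) :=
  (v, true) :: (w.map (·, true) ++ (G.order (vs.filter (· ∉ w))).map (·, false))

/-- The smallest feedback vertex sets of size at most `k` of the graph induced by the list, by
iterative compression. -/
def solve (k : ℕ) : List V → Tally V
  | [] => some ([], 1)
  | v :: vs => match solve k vs with
    | none => none
    | some (w, _) => G.proc (G.nextTodo v vs w) [] k

variable {G} {l vs w : List V} {v x : V} {c k : ℕ}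

theorem order_eq_nil (h : l.find? (fun x => G.degTo x l ≤ 1) = none) : G.order l = [] := by
  rw [order]
  split <;> simp_all

theorem order_eq_cons (h : l.find? (fun x => G.degTo x l ≤ 1) = some x) :
    G.order l = x :: G.order (l.filter (· ∉ [x])) := by
  rw [order]
  split <;> simp_all

theorem AcyclicOn.exists_degTo_le_one (h : G.AcyclicOn l.toFinset) (hl : l.Nodup) (hne : l ≠ []) :
    ∃ x ∈ l, G.degTo x l ≤ 1 := by
  obtain ⟨x, hx, hleaf⟩ := h.exists_leaf (List.toFinset_nonempty_iff l |>.2 hne)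
  exact ⟨x, List.mem_toFinset.1 hx, degTo_le_one hl (by simpa only [List.mem_toFinset] using hleaf)⟩

theorem cons_filter_perm (hl : l.Nodup) (hx : x ∈ l) : (x :: l.filter (· ∉ [x])).Perm l := by
  have herase : l.filter (· ∉ [x]) = l.erase x := by
    rw [hl.erase_eq_filter]
    exact List.filter_congr fun y _ => by simp only [List.mem_singleton, decide_not]; rfl
  rw [herase]
  exact (List.perm_cons_erase hx).symm

theorem order_perm (l : List V) (hl : l.Nodup) (hacyc : G.AcyclicOn l.toFinset) :
    (G.order l).Perm l := by
  match hfind : l.find? fun x => G.degTo x l ≤ 1 with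
  | none =>
    rw [order_eq_nil hfind]
    by_contra hne
    obtain ⟨x, hx, hdeg⟩ := hacyc.exists_degTo_le_one hl (by rintro rfl; exact hne .nil)
    exact List.find?_eq_none.1 hfind x hx (decide_eq_true hdeg)
  | some x =>
    rw [order_eq_cons hfind]
    have hperm := cons_filter_perm hl (List.mem_of_find?_eq_some hfind)
    exact ((order_perm _ (hl.filter _) (hacyc.mono fun y hy => by simp_all)).cons x).trans hperm
termination_by l.length
decreasing_by exact length_filter_notMem_singleton_lt (List.mem_of_find?_eq_some hfind)

theorem ordered_order (l : List V) (hl : l.Nodup) (hacyc : G.AcyclicOn l.toFinset) :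
    G.Ordered ((G.order l).map (·, false)) := by
  match hfind : l.find? fun x => G.degTo x l ≤ 1 with
  | none =>
    rw [order_eq_nil hfind]
    trivial
  | some x =>
    rw [order_eq_cons hfind]
    have hacyc' : G.AcyclicOn (l.filter (· ∉ [x])).toFinset := hacyc.mono fun y hy => by simp_all
    refine ⟨fun _ => ?_, ordered_order _ (hl.filter _) hacyc'⟩
    rw [List.map_map, Function.comp_def, List.map_id']
    refine (degTo_le_of_subperm ((order_perm _ (hl.filter _) hacyc').subperm.trans
      List.filter_sublist.subperm)).trans ?_
    simpa only [decide_eq_true_eq] using List.find?_some hfind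
termination_by l.length
decreasing_by exact length_filter_notMem_singleton_lt (List.mem_of_find?_eq_some hfind)

theorem map_fst_nextTodo :
    (G.nextTodo v vs w).map Prod.fst = v :: (w ++ G.order (vs.filter (· ∉ w))) := by
  simp [nextTodo, Function.comp_def]

theorem append_filter_perm (hvs : vs.Nodup) (hw : w.Nodup) (hwv : w ⊆ vs) :
    (w ++ vs.filter (· ∉ w)).Perm vs := by
  have hdisj : w.Disjoint (vs.filter (· ∉ w)) := fun x hx hx' => by
    simpa [hx] using (List.mem_filter.1 hx').2
  refine (List.perm_ext_iff_of_nodup (hw.append (hvs.filter _) hdisj) hvs).2 fun x => ?_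
  have := @hwv x
  by_cases hx : x ∈ w <;> simp_all

theorem acyclicOn_toFinset_filter (h : G.AcyclicOn (vs.toFinset \ w.toFinset)) :
    G.AcyclicOn (vs.filter (· ∉ w)).toFinset :=
  h.mono fun x hx => by simpa using hx

theorem nextTodo_perm (hvs : vs.Nodup) (hw : w.Nodup) (hwv : w ⊆ vs)
    (hacyc : G.AcyclicOn (vs.toFinset \ w.toFinset)) :
    ((G.nextTodo v vs w).map Prod.fst).Perm (v :: vs) := by
  rw [map_fst_nextTodo]
  exact (((order_perm _ (hvs.filter _) (acyclicOn_toFinset_filter hacyc)).append_left w).trans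
    (append_filter_perm hvs hw hwv)).cons v

theorem ordered_nextTodo (hvs : vs.Nodup) (hacyc : G.AcyclicOn (vs.toFinset \ w.toFinset)) :
    G.Ordered (G.nextTodo v vs w) :=
  ⟨fun h => absurd h (by simp),
    ordered_marked (ordered_order _ (hvs.filter _) (acyclicOn_toFinset_filter hacyc)) w⟩

theorem subset_of_isMinCount (h : IsMinCount (fun S => G.AcyclicOn (vs.toFinset \ S)) w c) :
    w ⊆ vs := by
  intro u hu
  by_contra huv
  have herase : G.AcyclicOn (vs.toFinset \ w.toFinset.erase u) := h.mem.mono fun x hx => by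
    simp only [Finset.mem_sdiff, List.mem_toFinset, Finset.mem_erase, not_and] at hx ⊢
    exact ⟨hx.1, hx.2 fun hxu => huv (hxu ▸ hx.1)⟩
  have hle := h.le_card _ herase
  rw [Finset.card_erase_of_mem (List.mem_toFinset.2 hu), List.toFinset_card_of_nodup h.nodup] at hle
  have := List.length_pos_of_mem hu
  lia

theorem inv_nil (l : List V) : G.Inv [] l [] where
  nodup := List.nodup_nil
  valid := by simp
  disjoint := by simp

theorem isTally_solve [Finite V] : ∀ {vs : List V}, vs.Nodup →
    IsTally k (fun S => G.AcyclicOn (vs.toFinset \ S)) (G.solve k vs)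
  | [], _ => isTally_nil fun S => by simpa using acyclicOn_empty
  | v :: vs, hnodup => by
    have hvs := hnodup.of_cons
    have ih := isTally_solve hvs
    rw [solve]
    match hsolve : G.solve k vs with
    | none =>
      rw [hsolve] at ih
      refine fun S hS => ih S (hS.mono (Finset.sdiff_subset_sdiff ?_ subset_rfl))
      rw [List.toFinset_cons]
      exact Finset.subset_insert _ _
    | some (w, c) =>
      rw [hsolve] at ih
      obtain ⟨-, ih⟩ := ih
      have hperm := nextTodo_perm (v := v) hvs ih.nodup (subset_of_isMinCount ih) ih.mem
      have hnil {S} : SameComp S ([] : List (Entry V)) = G.Conn ∅ := by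
        funext x y
        simp [SameComp, InComp, Conn]
      refine (isTally_proc (hperm.nodup_iff.2 hnodup) (ordered_nextTodo hvs ih.mem)
        (inv_nil _)).congr fun S => ?_
      rw [hnil, feasible_conn_iff (hperm.nodup_iff.2 hnodup) (fun _ _ => Finset.notMem_empty _)
        acyclicOn_empty, List.toFinset_eq_of_perm _ _ hperm, Finset.empty_union]

theorem numMinFVS_eq_count {r : Tally V} (h : IsTally k G.IsFVS r) :
    G.numMinFVS k = r.count := by
  match r, h with
  | none, h =>
    have hempty : {S | G.IsMinimumFVS S ∧ S.card ≤ k} = ∅ :=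
      Set.eq_empty_of_forall_notMem fun S hS => (h S hS.1.1).not_ge hS.2
    rw [numMinFVS, hempty, Set.ncard_empty, Tally.count]
  | some (w, c), ⟨hk, h⟩ =>
    rw [numMinFVS, Tally.count, h.count_eq]
    congr 1
    ext S
    have hw := List.toFinset_card_of_nodup h.nodup
    constructor
    · rintro ⟨⟨hS, hmin⟩, -⟩
      exact ⟨hS, le_antisymm (hw ▸ hmin _ h.mem) (h.le_card S hS)⟩
    · rintro ⟨hS, hcard⟩
      exact ⟨⟨hS, fun T hT => hcard ▸ h.le_card T hT⟩, hcard.trans_le hk⟩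

theorem count_solve [Finite V] (hnodup : vs.Nodup) (hall : ∀ v, v ∈ vs) :
    (G.solve k vs).count = G.numMinFVS k := by
  cases nonempty_fintype V
  refine (numMinFVS_eq_count ((isTally_solve hnodup).congr fun S => ?_)).symm
  rw [isFVS_iff, (Finset.eq_univ_iff_forall.2 fun v => List.mem_toFinset.2 (hall v))]

end Multigraph

/-! ### Symbolic evaluation of programs -/

/-- Function number `f` of the program `P` maps `x` to `y` in at most `T` steps. -/
def Program.Maps (P : Program) (f : ℕ) (x y : Data) (T : ℕ) : Prop :=
  ∃ b t, P[f]? = some b ∧ Eval P [x] b y t ∧ t ≤ T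

/-- Weakest preconditions, by symbolic evaluation: `wp P e env Q` implies that the value of `e` and
some upper bound for the number of steps satisfy `Q`. Only the calls of functions are not unfolded;
for these any bound on the number of steps may be used. -/
def wp (P : Program) : Code → List Data → (Data → ℕ → Prop) → Prop
  | .var i, env, Q => Q (env.getD i .nil) 1
  | .nil, _, Q => Q .nil 1
  | .cons a b, env, Q => wp P a env fun v s => wp P b env fun w t => Q (.cons v w) (s + t + 1)
  | .head a, env, Q => wp P a env fun v s => Q v.head (s + 1)
  | .tail a, env, Q => wp P a env fun v s => Q v.tail (s + 1)
  | .ite c a b, env, Q => wp P c env fun v s =>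
      match v with
      | .nil => wp P b env fun w t => Q w (s + t + 1)
      | .cons _ _ => wp P a env fun w t => Q w (s + t + 1)
  | .bind a b, env, Q => wp P a env fun v s => wp P b (v :: env) fun w t => Q w (s + t + 1)
  | .call f a, env, Q => wp P a env fun v s => ∃ w T, P.Maps f v w T ∧ Q w (s + T + 1)

theorem exists_eval_of_wp {P : Program} : ∀ {e : Code} {env : List Data} {Q : Data → ℕ → Prop},
    wp P e env Q → ∃ v t T, Eval P env e v t ∧ t ≤ T ∧ Q v T
  | .var i, env, Q, h => ⟨_, _, _, .var env i, le_rfl, h⟩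
  | .nil, env, Q, h => ⟨_, _, _, .nil env, le_rfl, h⟩
  | .cons a b, env, Q, h => by
    obtain ⟨v, t, T, heval, ht, hQ⟩ := exists_eval_of_wp (e := a) h
    obtain ⟨v', t', T', heval', ht', hQ'⟩ := exists_eval_of_wp (e := b) hQ
    exact ⟨_, _, _, .cons heval heval', by lia, hQ'⟩
  | .head a, env, Q, h => by
    obtain ⟨v, t, T, heval, ht, hQ⟩ := exists_eval_of_wp (e := a) h
    exact ⟨_, _, _, .head heval, by lia, hQ⟩
  | .tail a, env, Q, h => by
    obtain ⟨v, t, T, heval, ht, hQ⟩ := exists_eval_of_wp (e := a) h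
    exact ⟨_, _, _, .tail heval, by lia, hQ⟩
  | .ite c a b, env, Q, h => by
    obtain ⟨v, t, T, heval, ht, hQ⟩ := exists_eval_of_wp (e := c) h
    cases v with
    | nil =>
      obtain ⟨v', t', T', heval', ht', hQ'⟩ := exists_eval_of_wp (e := b) hQ
      exact ⟨_, _, _, .ite_nil heval heval', by lia, hQ'⟩
    | cons x y =>
      obtain ⟨v', t', T', heval', ht', hQ'⟩ := exists_eval_of_wp (e := a) hQ
      exact ⟨_, _, _, .ite_cons heval heval', by lia, hQ'⟩
  | .bind a b, env, Q, h => by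
    obtain ⟨v, t, T, heval, ht, hQ⟩ := exists_eval_of_wp (e := a) h
    obtain ⟨v', t', T', heval', ht', hQ'⟩ := exists_eval_of_wp (e := b) hQ
    exact ⟨_, _, _, .bind heval heval', by lia, hQ'⟩
  | .call f a, env, Q, h => by
    obtain ⟨v, t, T, heval, ht, w, T', ⟨b, t', hb, heval', ht'⟩, hQ⟩ := exists_eval_of_wp (e := a) h
    exact ⟨_, _, _, .call hb heval heval', by lia, hQ⟩

theorem wp.mono {P : Program} : ∀ {e : Code} {env : List Data} {Q Q' : Data → ℕ → Prop},
    wp P e env Q → (∀ v t, Q v t → Q' v t) → wp P e env Q'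
  | .var _, _, _, _, h, hQ => hQ _ _ h
  | .nil, _, _, _, h, hQ => hQ _ _ h
  | .cons a b, _, _, _, h, hQ => wp.mono (e := a) h fun _ _ h =>
      wp.mono (e := b) h fun _ _ h => hQ _ _ h
  | .head a, _, _, _, h, hQ => wp.mono (e := a) h fun _ _ h => hQ _ _ h
  | .tail a, _, _, _, h, hQ => wp.mono (e := a) h fun _ _ h => hQ _ _ h
  | .ite c a b, _, _, _, h, hQ => wp.mono (e := c) h fun v _ h => by
      cases v with
      | nil => exact wp.mono (e := b) h fun _ _ h => hQ _ _ h
      | cons _ _ => exact wp.mono (e := a) h fun _ _ h => hQ _ _ h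
  | .bind a b, _, _, _, h, hQ => wp.mono (e := a) h fun _ _ h =>
      wp.mono (e := b) h fun _ _ h => hQ _ _ h
  | .call _ a, _, _, _, h, hQ => wp.mono (e := a) h fun _ _ ⟨w, T, h1, h2⟩ =>
      ⟨w, T, h1, hQ _ _ h2⟩

theorem wp_of_eq {P : Program} {e : Code} {env : List Data} {Q : Data → ℕ → Prop} {y : Data} {T : ℕ}
    (h : wp P e env fun v t => v = y ∧ t ≤ T) (hQ : ∀ t ≤ T, Q y t) : wp P e env Q :=
  h.mono fun _ t ⟨hv, ht⟩ => hv ▸ hQ t ht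

theorem Program.Maps.mono {P : Program} {f : ℕ} {x y : Data} {T T' : ℕ} (h : P.Maps f x y T)
    (hT : T ≤ T') : P.Maps f x y T' :=
  let ⟨b, t, h1, h2, h3⟩ := h; ⟨b, t, h1, h2, h3.trans hT⟩

/-! ### The program -/

/-- The functions of the program, with the shape of their arguments. Unless said otherwise,
vertices and budgets are in unary; `A` is the adjacency matrix of a graph. -/
inductive Routine
  /-- `(k, A)` with `k` in binary: the number of minimum feedback vertex sets, in binary. -/
  | main
  /-- `(a, b)`: the concatenation of two lists. -/
  | append
  /-- The conversion of a number from binary to unary. -/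
  | toUnary
  /-- `(rows, i)`: the vertices `i, i + 1, …`, one for every row. -/
  | vertices
  /-- `(l, i)`: member number `i` of the list `l`. -/
  | get
  /-- `(u, v)`: whether two vertices are equal. -/
  | eq
  /-- `(A, u, v)`: the multiplicity of an edge, in binary. -/
  | mult
  /-- `(A, p, st)`: see `Multigraph.nbrs`. -/
  | nbrs
  /-- `(x, l)`: whether the vertex `x` is in the list `l`. -/
  | mem
  /-- `(l, w)`: the members of `l` that are not in `w`. -/
  | diff
  /-- `(st, a, p)`: see `relabel`. -/
  | relabel
  /-- `(a, b, c)`: the sum of two numbers in binary and of a carry bit. -/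
  | add
  /-- `(l, c)`: the product of the length of `l` and of the number `c`, in binary. -/
  | mul
  /-- `(l, l')`: whether the list `l` is shorter than `l'`. -/
  | lt
  /-- `(r, r')`: see `Tally.union`. -/
  | union
  /-- `(cl, r)`: see `Tally.insertOneOf`. -/
  | insertOneOf
  /-- `(A, p, L, todo, st, k)`: see `link`. -/
  | link
  /-- `(A, todo, st, k)`: see `Multigraph.proc`. -/
  | proc
  /-- `l`: the entries `Entry.root x` for the vertices `x` in `l`. -/
  | roots
  /-- `(A, l, rs)`: the list of the first vertex in `l` that has at most one edge to the entries
  `rs`, or the empty list. -/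
  | findLeaf
  /-- `(A, l)`: see `Multigraph.order`. -/
  | order
  /-- `(w, z, todo)`: the vertices in `w`, all marked by `z`, followed by `todo`. -/
  | mark
  /-- `(A, k, vs)`: see `Multigraph.solve`. -/
  | solve

namespace Code

/-- The `j`-fold second projection. -/
def tails : ℕ → Code → Code
  | 0, c => c
  | j + 1, c => .tail (tails j c)

/-- Component `j`, other than the last one, of the tuple that is the value of variable `i`. -/
def proj (i j : ℕ) : Code := .head (tails j (.var i))

/-- Component `j` of the tuple that is the value of variable `i`, if it is the last one. -/
def last (i j : ℕ) : Code := tails j (.var i)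

/-- The truth value `true`. -/
def true : Code := .cons .nil .nil

/-- The exclusive disjunction of two truth values. -/
def xor (a b : Code) : Code := .ite a (.ite b .nil true) (.ite b true .nil)

/-- The application of a routine. -/
def invoke (r : Routine) (a : Code) : Code := .call r.ctorIdx a

/-- The code for `Tally.spend`, where `rest` computes the tally for the decreased budget. -/
def spend (budget chain rest : Code) : Code :=
  .ite budget (invoke .insertOneOf (.cons chain rest)) .nil

/-- The code for the case in `link` that an edge to the vertex `p` is destroyed. Variable `0` is
the entry and variable `1` the argument of `link`. -/
def linkDestroy : Code :=
  spend (last 1 5) (proj 0 1)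
    (invoke .link (.cons (proj 1 0) (.cons (proj 1 1) (.cons (.tail (proj 1 2))
      (.cons (proj 1 3) (.cons (proj 1 4) (.tail (last 1 5))))))))

/-- The code for the case in `link` that an edge to the vertex `p` is kept. The variables are those
of `linkDestroy`. -/
def linkKeep : Code :=
  .ite (invoke .eq (.cons (last 0 2) (proj 1 1))) .nil
    (invoke .link (.cons (proj 1 0) (.cons (proj 1 1)
      (.cons (invoke .relabel (.cons (.tail (proj 1 2)) (.cons (last 0 2) (proj 1 1))))
        (.cons (proj 1 3)
          (.cons (invoke .relabel (.cons (proj 1 4) (.cons (last 0 2) (proj 1 1))))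
            (last 1 5)))))))

/-- The code for the branching step in `proc`. Variable `0` is the list of the edges to the first
vertex and variable `1` the argument of `proc`. -/
def procBranch : Code :=
  invoke .union (.cons
    (spend (last 1 3) (.cons (.head (.head (proj 1 1))) .nil)
      (invoke .proc (.cons (proj 1 0) (.cons (.tail (proj 1 1)) (.cons (proj 1 2)
        (.tail (last 1 3)))))))
    (invoke .link (.cons (proj 1 0) (.cons (.head (.head (proj 1 1))) (.cons (.var 0)
      (.cons (.tail (proj 1 1))
        (.cons
          (.cons (.cons (.head (.head (proj 1 1))) (.cons .nil (.head (.head (proj 1 1)))))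
            (proj 1 2))
          (last 1 3))))))))

/-- The code for the step in `proc` that extends a chain. The variables are those of
`procBranch`. -/
def procExtend : Code :=
  invoke .proc (.cons (proj 1 0) (.cons (.tail (proj 1 1)) (.cons
    (.cons (.cons (.head (.head (proj 1 1)))
        (.cons (.cons (.head (.head (proj 1 1))) (.head (.tail (.head (.var 0)))))
          (.tail (.tail (.head (.var 0))))))
      (proj 1 2))
    (last 1 3))))

/-- The code for `Multigraph.nextTodo`. Variable `0` is the list of a tally and variable `1` the
argument of `solve`. -/
def nextTodo : Code :=
  .cons (.cons (.head (last 1 2)) true)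
    (invoke .mark (.cons (.head (.var 0)) (.cons true
      (invoke .mark (.cons
        (invoke .order (.cons (proj 1 0)
          (invoke .diff (.cons (.tail (last 1 2)) (.head (.var 0))))))
        (.cons .nil .nil))))))

end Code

namespace Routine
open Code

/-- The bodies of the functions. -/
def body : Routine → Code
  | main =>
    .bind (invoke toUnary (proj 0 0))
      (.bind (invoke vertices (.cons (last 1 1) .nil))
        (.tail (invoke solve (.cons (last 2 1) (.cons (.var 1) (.var 0))))))
  | append =>
    .ite (proj 0 0)
      (.cons (.head (proj 0 0)) (invoke append (.cons (.tail (proj 0 0)) (last 0 1))))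
      (last 0 1)
  | toUnary =>
    .ite (.var 0)
      (.bind (invoke toUnary (.tail (.var 0)))
        (.bind (invoke append (.cons (.var 0) (.var 0)))
          (.ite (.head (.var 2)) (.cons .nil (.var 0)) (.var 0))))
      .nil
  | vertices =>
    .ite (proj 0 0)
      (.cons (last 0 1) (invoke vertices (.cons (.tail (proj 0 0)) (.cons .nil (last 0 1)))))
      .nil
  | get =>
    .ite (last 0 1) (invoke get (.cons (.tail (proj 0 0)) (.tail (last 0 1)))) (.head (proj 0 0))
  | eq =>
    .ite (proj 0 0)
      (.ite (last 0 1) (invoke eq (.cons (.tail (proj 0 0)) (.tail (last 0 1)))) .nil)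
      (.ite (last 0 1) .nil true)
  | mult => invoke get (.cons (invoke get (.cons (proj 0 0) (proj 0 1))) (last 0 2))
  | nbrs =>
    .ite (last 0 2)
      (.bind (invoke nbrs (.cons (proj 0 0) (.cons (proj 0 1) (.tail (last 0 2)))))
        (.bind (invoke mult (.cons (proj 1 0) (.cons (proj 1 1) (.head (.head (last 1 2))))))
          (.ite (.var 0)
            (.ite (.tail (.var 0))
              (.cons (.head (last 2 2)) (.cons (.head (last 2 2)) (.var 1)))
              (.cons (.head (last 2 2)) (.var 1)))
            (.var 1))))
      .nil
  | mem =>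
    .ite (last 0 1)
      (.ite (invoke eq (.cons (proj 0 0) (.head (last 0 1)))) true
        (invoke mem (.cons (proj 0 0) (.tail (last 0 1)))))
      .nil
  | diff =>
    .ite (proj 0 0)
      (.bind (invoke diff (.cons (.tail (proj 0 0)) (last 0 1)))
        (.ite (invoke mem (.cons (.head (proj 1 0)) (last 1 1))) (.var 0)
          (.cons (.head (proj 1 0)) (.var 0))))
      .nil
  | relabel =>
    .ite (proj 0 0)
      (.bind (.head (proj 0 0))
        (.cons
          (.cons (proj 0 0) (.cons (proj 0 1)
            (.ite (invoke eq (.cons (last 0 2) (proj 1 1))) (last 1 2) (last 0 2))))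
          (invoke relabel (.cons (.tail (proj 1 0)) (last 1 1)))))
      .nil
  | add =>
    .bind
      (.cons (xor (.head (proj 0 0)) (xor (.head (proj 0 1)) (last 0 2)))
        (.cons (.tail (proj 0 0)) (.cons (.tail (proj 0 1))
          (.ite (.head (proj 0 0)) (.ite (.head (proj 0 1)) true (last 0 2))
            (.ite (.head (proj 0 1)) (last 0 2) .nil)))))
      (.ite (proj 1 0) (.cons (proj 0 0) (invoke add (last 0 1)))
        (.ite (proj 1 1) (.cons (proj 0 0) (invoke add (last 0 1)))
          (.ite (last 1 2) (.cons true .nil) .nil)))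
  | mul =>
    .ite (proj 0 0)
      (invoke add
        (.cons (last 0 1) (.cons (invoke mul (.cons (.tail (proj 0 0)) (last 0 1))) .nil)))
      .nil
  | lt =>
    .ite (last 0 1)
      (.ite (proj 0 0) (invoke lt (.cons (.tail (proj 0 0)) (.tail (last 0 1)))) true)
      .nil
  | union =>
    .ite (proj 0 0)
      (.ite (last 0 1)
        (.ite (invoke lt (.cons (.head (proj 0 0)) (.head (last 0 1)))) (proj 0 0)
          (.ite (invoke lt (.cons (.head (last 0 1)) (.head (proj 0 0)))) (last 0 1)
            (.cons (.head (proj 0 0))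
              (invoke add (.cons (.tail (proj 0 0)) (.cons (.tail (last 0 1)) .nil))))))
        (proj 0 0))
      (last 0 1)
  | insertOneOf =>
    .ite (last 0 1)
      (.ite (proj 0 0)
        (.cons (.cons (.head (proj 0 0)) (.head (last 0 1)))
          (invoke mul (.cons (proj 0 0) (.tail (last 0 1)))))
        .nil)
      .nil
  | link =>
    .ite (proj 0 2)
      (.bind (.head (proj 0 2)) (invoke union (.cons linkDestroy linkKeep)))
      (invoke proc (.cons (proj 0 0) (.cons (proj 0 3) (.cons (proj 0 4) (last 0 5)))))
  | proc =>
    .ite (proj 0 1)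
      (.bind (invoke nbrs (.cons (proj 0 0) (.cons (.head (.head (proj 0 1))) (proj 0 2))))
        (.ite (.tail (.head (proj 1 1))) procBranch
          (.ite (.var 0)
            (.ite (.tail (.var 0)) procBranch procExtend)
            (invoke proc (.cons (proj 1 0) (.cons (.tail (proj 1 1)) (last 1 2)))))))
      (.cons .nil (.cons true .nil))
  | roots =>
    .ite (.var 0)
      (.cons (.cons (.head (.var 0)) (.cons .nil (.head (.var 0)))) (invoke roots (.tail (.var 0))))
      .nil
  | findLeaf =>
    .ite (proj 0 1)
      (.ite (.tail (invoke nbrs (.cons (proj 0 0) (.cons (.head (proj 0 1)) (last 0 2)))))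
        (invoke findLeaf (.cons (proj 0 0) (.cons (.tail (proj 0 1)) (last 0 2))))
        (.cons (.head (proj 0 1)) .nil))
      .nil
  | order =>
    .bind (invoke findLeaf (.cons (proj 0 0) (.cons (last 0 1) (invoke roots (last 0 1)))))
      (.ite (.var 0)
        (.cons (.head (.var 0))
          (invoke order (.cons (proj 1 0) (invoke diff (.cons (last 1 1) (.var 0))))))
        .nil)
  | mark =>
    .ite (proj 0 0)
      (.cons (.cons (.head (proj 0 0)) (proj 0 1))
        (invoke mark (.cons (.tail (proj 0 0)) (last 0 1))))
      (last 0 2)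
  | solve =>
    .ite (last 0 2)
      (.bind (invoke solve (.cons (proj 0 0) (.cons (proj 0 1) (.tail (last 0 2)))))
        (.ite (.var 0)
          (invoke proc (.cons (proj 1 0) (.cons nextTodo (.cons .nil (proj 1 1)))))
          .nil))
      (.cons .nil (.cons true .nil))

end Routine

/-- The program that counts the minimum feedback vertex sets. -/
def prog : Program :=
  [Routine.main, .append, .toUnary, .vertices, .get, .eq, .mult, .nbrs, .mem, .diff, .relabel,
    .add, .mul, .lt, .union, .insertOneOf, .link, .proc, .roots, .findLeaf, .order, .mark,
    .solve].map Routine.body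

/-- The routine `r` maps `x` to `y` in at most `T` steps. -/
abbrev Routine.Maps (r : Routine) (x y : Data) (T : ℕ) : Prop :=
  prog.Maps r.ctorIdx x y T

theorem Routine.maps_of_wp {r : Routine} {x y : Data} {T : ℕ}
    (h : wp prog r.body [x] fun v t => v = y ∧ t ≤ T) : r.Maps x y T := by
  have hbody : prog[r.ctorIdx]? = some r.body := by cases r <;> rfl
  obtain ⟨v, t, T', heval, ht, rfl, hT⟩ := exists_eval_of_wp h
  exact ⟨r.body, t, hbody, heval, ht.trans hT⟩

/-! ### Numbers and lists -/

namespace Data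

/-- The unary representation of a number. -/
def ofUnary : ℕ → Data
  | 0 => nil
  | i + 1 => cons nil (ofUnary i)

theorem ofNat_zero : ofNat 0 = nil := by
  rw [ofNat, Nat.zero_bits, List.map_nil, ofList]

theorem ofNat_of_ne_zero {m : ℕ} (h : m ≠ 0) :
    ofNat m = cons (ofBool m.bodd) (ofNat m.div2) := by
  conv_lhs => rw [← Nat.bit_bodd_div2 m]
  rw [ofNat, Nat.bits_append_bit _ _ fun h0 => ?_]
  · rfl
  · have := Nat.bodd_add_div2 m
    cases hm : m.bodd
    · rw [hm, h0] at this
      exact absurd this.symm h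
    · rfl

theorem ofNat_eq_nil_iff {m : ℕ} : ofNat m = nil ↔ m = 0 := by
  refine ⟨fun h => by_contra fun hm => ?_, fun h => h ▸ ofNat_zero⟩
  rw [ofNat_of_ne_zero hm] at h
  exact Data.noConfusion h

theorem head_ofNat (m : ℕ) : (ofNat m).head = ofBool m.bodd := by
  rcases eq_or_ne m 0 with rfl | h
  · rw [ofNat_zero]; rfl
  · rw [ofNat_of_ne_zero h]; rfl

theorem tail_ofNat (m : ℕ) : (ofNat m).tail = ofNat m.div2 := by
  rcases eq_or_ne m 0 with rfl | h
  · rw [Nat.div2_zero, ofNat_zero]; rfl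
  · rw [ofNat_of_ne_zero h]; rfl

end Data

open Routine

theorem maps_append : ∀ a b : ℕ,
    append.Maps (.cons (.ofUnary a) (.ofUnary b)) (.ofUnary (a + b)) (20 * (a + 1))
  | 0, b => maps_of_wp ⟨congrArg _ b.zero_add.symm, by lia⟩
  | a + 1, b => maps_of_wp ⟨_, _, maps_append a b,
      congrArg Data.ofUnary (show a + b + 1 = a + 1 + b by lia), by lia⟩

theorem maps_toUnary (m : ℕ) : toUnary.Maps (.ofNat m) (.ofUnary m) (100 * m + 20) := by
  induction m using Nat.strong_induction_on with
  | _ m ih =>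
    rcases eq_or_ne m 0 with rfl | hm
    · rw [Data.ofNat_zero]
      exact maps_of_wp ⟨rfl, by lia⟩
    · have hbit := Nat.bodd_add_div2 m
      rw [Data.ofNat_of_ne_zero hm]
      refine maps_of_wp ⟨_, _, ih m.div2 (by lia), _, _, maps_append _ _, ?_⟩
      cases h : m.bodd <;> rw [h] at hbit
      · exact ⟨congrArg Data.ofUnary (show m.div2 + m.div2 = m by simp at hbit; lia), by lia⟩
      · exact ⟨congrArg Data.ofUnary (show m.div2 + m.div2 + 1 = m by simp at hbit; lia), by lia⟩

theorem maps_get : ∀ (l : List Data) (i : ℕ) (h : i < l.length),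
    get.Maps (.cons (.ofList l) (.ofUnary i)) l[i] (20 * (i + 1))
  | _ :: _, 0, _ => maps_of_wp ⟨rfl, by lia⟩
  | _ :: l, i + 1, h => maps_of_wp
      ⟨_, _, maps_get l i (Nat.lt_of_succ_lt_succ h), rfl, by lia⟩

theorem maps_eq : ∀ i j : ℕ,
    eq.Maps (.cons (.ofUnary i) (.ofUnary j)) (.ofBool (i == j)) (20 * (i + 1))
  | 0, 0 => maps_of_wp ⟨rfl, by lia⟩
  | 0, _ + 1 => maps_of_wp ⟨rfl, by lia⟩
  | _ + 1, 0 => maps_of_wp ⟨rfl, by lia⟩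
  | i + 1, j + 1 => maps_of_wp ⟨_, _, maps_eq i j, by simp, by lia⟩

theorem maps_lt : ∀ l l' : List Data,
    lt.Maps (.cons (.ofList l) (.ofList l')) (.ofBool (decide (l.length < l'.length)))
      (20 * (l.length + 1))
  | [], [] => maps_of_wp ⟨rfl, by lia⟩
  | [], _ :: _ => maps_of_wp ⟨rfl, by lia⟩
  | _ :: _, [] => maps_of_wp ⟨rfl, by lia⟩
  | _ :: l, _ :: l' => maps_of_wp
      ⟨_, _, maps_lt l l', by simp, by rw [List.length_cons]; lia⟩

theorem bodd_add_add_toNat (a b : ℕ) (c : Bool) :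
    (a + b + c.toNat).bodd = (a.bodd ^^ (b.bodd ^^ c)) := by
  cases c <;> simp [Nat.bodd_add]

theorem div2_add_add_toNat (a b : ℕ) (c : Bool) :
    (a + b + c.toNat).div2 =
      a.div2 + b.div2 + (bif a.bodd then b.bodd || c else b.bodd && c).toNat := by
  have ha := Nat.bodd_add_div2 a
  have hb := Nat.bodd_add_div2 b
  have hab := Nat.bodd_add_div2 (a + b + c.toNat)
  rw [bodd_add_add_toNat] at hab
  generalize (a + b + c.toNat).div2 = m, a.div2 = a', b.div2 = b', a.bodd = p, b.bodd = q at *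
  cases p <;> cases q <;> cases c <;> simp at * <;> lia

theorem maps_add_cons {x y z : Data} {p q c : Bool} {T : ℕ} (hx : x.head = .ofBool p)
    (hy : y.head = .ofBool q) (hxy : ¬(x = .nil ∧ y = .nil))
    (h : add.Maps (.cons x.tail (.cons y.tail (.ofBool (bif p then q || c else q && c)))) z T) :
    add.Maps (.cons x (.cons y (.ofBool c))) (.cons (.ofBool (p ^^ (q ^^ c))) z) (T + 80) := by
  refine maps_of_wp ?_
  match x, y, hx, hy, hxy, h with
  | .nil, .nil, _, _, hxy, _ => exact absurd ⟨rfl, rfl⟩ hxy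
  | .nil, .cons _ _, hx, rfl, _, h
  | .cons _ _, .nil, rfl, hy, _, h
  | .cons _ _, .cons _ _, rfl, rfl, _, h =>
    cases p <;> cases q <;> cases c <;> first | contradiction | exact ⟨_, _, h, rfl, by lia⟩

theorem maps_add_zero_zero : ∀ c : Bool,
    add.Maps (.cons .nil (.cons .nil (.ofBool c))) (.ofNat c.toNat) 80
  | false => maps_of_wp ⟨Data.ofNat_zero.symm, by lia⟩
  | true => by
    rw [Bool.toNat_true, Data.ofNat_of_ne_zero one_ne_zero]
    exact maps_of_wp ⟨congrArg (Data.cons _) Data.ofNat_zero.symm, by lia⟩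

theorem maps_add {s a b : ℕ} (c : Bool) (ha : a < 2 ^ s) (hb : b < 2 ^ s) :
    add.Maps (.cons (.ofNat a) (.cons (.ofNat b) (.ofBool c))) (.ofNat (a + b + c.toNat))
      (80 * (s + 1)) := by
  induction s generalizing a b c with
  | zero =>
    obtain rfl := Nat.lt_one_iff.1 ha
    obtain rfl := Nat.lt_one_iff.1 hb
    simpa [Data.ofNat_zero] using maps_add_zero_zero c
  | succ s ih =>
    by_cases hab : a = 0 ∧ b = 0
    · obtain ⟨rfl, rfl⟩ := hab
      exact (ih c (by positivity) (by positivity)).mono (by lia)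
    rw [pow_succ] at ha hb
    have hrec := ih (a := a.div2) (b := b.div2) (bif a.bodd then b.bodd || c else b.bodd && c)
      (by rw [Nat.div2_val]; lia) (by rw [Nat.div2_val]; lia)
    rw [← div2_add_add_toNat, ← Data.tail_ofNat, ← Data.tail_ofNat] at hrec
    rw [Data.ofNat_of_ne_zero (m := a + b + c.toNat) (by lia), bodd_add_add_toNat]
    refine (maps_add_cons (Data.head_ofNat a) (Data.head_ofNat b) ?_ hrec).mono (by lia)
    rwa [Data.ofNat_eq_nil_iff, Data.ofNat_eq_nil_iff]

theorem maps_mul {s c : ℕ} : ∀ {l : List Data}, l.length * c < 2 ^ s → c < 2 ^ s →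
    mul.Maps (.cons (.ofList l) (.ofNat c)) (.ofNat (l.length * c))
      ((l.length + 1) * (80 * (s + 1) + 30))
  | [], _, _ => maps_of_wp ⟨by rw [List.length_nil, zero_mul, Data.ofNat_zero], by lia⟩
  | a :: l, h, hc => by
    rw [List.length_cons, add_one_mul] at *
    refine maps_of_wp ⟨_, _, maps_mul (l := l) (by lia) hc, _, _,
      maps_add (s := s) false hc (by lia), ?_, by lia⟩
    rw [Bool.toNat_false, add_zero, add_comm]

/-! ### Graphs and states -/

namespace Data

variable {n : ℕ}

/-- The representation of a vertex, in unary. -/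
def ofVertex (v : Fin n) : Data := ofUnary v

/-- The representation of a list of vertices. -/
def ofVertices (l : List (Fin n)) : Data := ofList (l.map ofVertex)

/-- The representation of a graph by its adjacency matrix. -/
def ofGraph (G : Multigraph (Fin n)) : Data :=
  ofList (List.ofFn fun u => ofList (List.ofFn fun v => ofNat (G.mult s(u, v))))

/-- The representation of an entry of a state. -/
def ofEntry (e : Entry (Fin n)) : Data :=
  cons (ofVertex e.vertex) (cons (ofVertices e.chain) (ofVertex e.label))

/-- The representation of a state. -/
def ofState (st : List (Entry (Fin n))) : Data := ofList (st.map ofEntry)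

/-- The representation of a list of marked vertices. -/
def ofTodo (todo : List (Fin n × Bool)) : Data :=
  ofList (todo.map fun x => cons (ofVertex x.1) (ofBool x.2))

/-- The representation of a tally. -/
def ofTally : Tally (Fin n) → Data
  | none => nil
  | some (w, c) => cons (ofVertices w) (ofNat c)

end Data

section

variable {n : ℕ} {G : Multigraph (Fin n)}

theorem maps_vertices : ∀ (rows : List Data) (i : ℕ),
    vertices.Maps (.cons (.ofList rows) (.ofUnary i))
      (.ofList ((List.range' i rows.length).map Data.ofUnary)) (20 * (rows.length + 1))
  | [], _ => maps_of_wp ⟨rfl, by rw [List.length_nil]; lia⟩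
  | _ :: rows, i => maps_of_wp
      ⟨_, _, maps_vertices rows (i + 1), rfl, by rw [List.length_cons]; lia⟩

theorem maps_eq_vertex (u v : Fin n) :
    eq.Maps (.cons (.ofVertex u) (.ofVertex v)) (.ofBool (u = v)) (20 * (n + 1)) := by
  rw [show decide (u = v) = ((u : ℕ) == v) by simp [Fin.ext_iff, beq_eq_decide]]
  exact (maps_eq u v).mono (by lia)

theorem maps_mult (u v : Fin n) :
    mult.Maps (.cons (.ofGraph G) (.cons (.ofVertex u) (.ofVertex v))) (.ofNat (G.mult s(u, v)))
      (60 * (n + 1)) := by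
  have hrow := maps_get (List.ofFn fun u : Fin n =>
    Data.ofList (List.ofFn fun v : Fin n => Data.ofNat (G.mult s(u, v)))) u (by simp)
  have hentry := maps_get (List.ofFn fun v : Fin n => Data.ofNat (G.mult s(u, v))) v (by simp)
  rw [List.getElem_ofFn] at hrow hentry
  exact maps_of_wp ⟨_, _, hrow, _, _, hentry, rfl, by lia⟩

theorem maps_nbrs (p : Fin n) : ∀ st : List (Entry (Fin n)),
    nbrs.Maps (.cons (.ofGraph G) (.cons (.ofVertex p) (.ofState st))) (.ofState (G.nbrs p st))
      ((st.length + 1) * (150 * (n + 1)))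
  | [] => maps_of_wp ⟨rfl, by rw [List.length_nil]; lia⟩
  | e :: st => by
    refine maps_of_wp ⟨_, _, maps_nbrs p st, _, _, maps_mult p e.vertex, ?_⟩
    have hcons : G.nbrs p (e :: st) =
        List.replicate (min 2 (G.mult s(p, e.vertex))) e ++ G.nbrs p st := List.flatMap_cons
    rw [hcons, List.length_cons, add_one_mul]
    match G.mult s(p, e.vertex) with
    | 0 =>
      rw [Data.ofNat_zero]
      exact ⟨rfl, by lia⟩
    | 1 =>
      rw [Data.ofNat_of_ne_zero one_ne_zero, Nat.div2_one, Data.ofNat_zero]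
      exact ⟨rfl, by lia⟩
    | m + 2 =>
      have hdiv : (m + 2).div2 ≠ 0 := by
        rw [Nat.div2_val]
        lia
      rw [Data.ofNat_of_ne_zero (m + 1).succ_ne_zero, Data.ofNat_of_ne_zero hdiv,
        Nat.min_eq_left (Nat.le_add_left 2 m)]
      exact ⟨rfl, by lia⟩

theorem maps_mem (x : Fin n) : ∀ l : List (Fin n),
    mem.Maps (.cons (.ofVertex x) (.ofVertices l)) (.ofBool (x ∈ l))
      ((l.length + 1) * (40 * (n + 1)))
  | [] => maps_of_wp ⟨rfl, by rw [List.length_nil]; lia⟩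
  | y :: l => by
    refine maps_of_wp ⟨_, _, maps_eq_vertex x y, ?_⟩
    rw [List.length_cons, add_one_mul]
    by_cases hxy : x = y
    · rw [decide_eq_true hxy]
      exact ⟨by simp [hxy, Data.ofBool], by lia⟩
    · rw [decide_eq_false hxy]
      exact ⟨_, _, maps_mem x l, by simp [hxy], by lia⟩

theorem maps_diff {w : List (Fin n)} (hw : w.length ≤ n) : ∀ l : List (Fin n),
    diff.Maps (.cons (.ofVertices l) (.ofVertices w)) (.ofVertices (l.filter (· ∉ w)))
      ((l.length + 1) * (80 * (n + 1) ^ 2))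
  | [] => maps_of_wp ⟨rfl, by rw [List.length_nil]; nlinarith⟩
  | x :: l => by
    have hmem := (maps_mem x w).mono (T' := (n + 1) * (40 * (n + 1))) (by gcongr)
    refine maps_of_wp ⟨_, _, maps_diff hw l, _, _, hmem, ?_⟩
    rw [List.length_cons, add_one_mul]
    by_cases hx : x ∈ w
    · rw [decide_eq_true hx, List.filter_cons_of_neg (by simpa using hx)]
      exact ⟨rfl, by nlinarith⟩
    · rw [decide_eq_false hx, List.filter_cons_of_pos (by simpa using hx)]
      exact ⟨rfl, by nlinarith⟩

theorem maps_relabel (a p : Fin n) : ∀ st : List (Entry (Fin n)),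
    Routine.relabel.Maps (.cons (.ofState st) (.cons (.ofVertex a) (.ofVertex p)))
      (.ofState (relabel a p st)) ((st.length + 1) * (80 * (n + 1)))
  | [] => maps_of_wp ⟨rfl, by rw [List.length_nil]; lia⟩
  | e :: st => by
    refine maps_of_wp ⟨_, _, maps_eq_vertex e.label a, ?_⟩
    rw [List.length_cons, add_one_mul, relabel, List.map_cons, ← relabel]
    by_cases ha : e.label = a
    · rw [decide_eq_true ha, if_pos ha]
      exact ⟨_, _, maps_relabel a p st, rfl, by lia⟩
    · rw [decide_eq_false ha, if_neg ha]
      exact ⟨_, _, maps_relabel a p st, rfl, by lia⟩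

theorem maps_roots : ∀ l : List (Fin n),
    roots.Maps (.ofVertices l) (.ofState (l.map Entry.root)) (20 * (l.length + 1))
  | [] => maps_of_wp ⟨rfl, by rw [List.length_nil]; lia⟩
  | _ :: l => maps_of_wp ⟨_, _, maps_roots l, rfl, by rw [List.length_cons]; lia⟩

theorem maps_mark (z : Bool) (todo : List (Fin n × Bool)) : ∀ w : List (Fin n),
    mark.Maps (.cons (.ofVertices w) (.cons (.ofBool z) (.ofTodo todo)))
      (.ofTodo (w.map (·, z) ++ todo)) (30 * (w.length + 1))
  | [] => maps_of_wp ⟨rfl, by rw [List.length_nil]; lia⟩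
  | _ :: w => maps_of_wp ⟨_, _, maps_mark z todo w, rfl, by rw [List.length_cons]; lia⟩

theorem length_nbrs_le_one_iff {p : Fin n} {st : List (Entry (Fin n))} :
    (G.nbrs p st).length ≤ 1 ↔ G.degTo p (st.map Entry.vertex) ≤ 1 := by
  induction st with
  | nil => simp [Multigraph.nbrs, Multigraph.degTo]
  | cons e st ih =>
    have hzero : (G.nbrs p st).length = 0 ↔ G.degTo p (st.map Entry.vertex) = 0 := by
      simp [Multigraph.nbrs, Multigraph.degTo, List.sum_eq_zero_iff]
    have hcons : G.nbrs p (e :: st) =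
        List.replicate (min 2 (G.mult s(p, e.vertex))) e ++ G.nbrs p st := List.flatMap_cons
    rw [hcons, List.length_append, List.length_replicate, List.map_cons, Multigraph.degTo_cons]
    lia

theorem maps_findLeaf (st : List (Entry (Fin n))) : ∀ l : List (Fin n),
    findLeaf.Maps (.cons (.ofGraph G) (.cons (.ofVertices l) (.ofState st)))
      (.ofVertices (l.find? fun x => G.degTo x (st.map Entry.vertex) ≤ 1).toList)
      ((l.length + 1) * ((st.length + 1) * (200 * (n + 1))))
  | [] => maps_of_wp ⟨rfl, by rw [List.length_nil]; nlinarith⟩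
  | x :: l => by
    have hpos : 0 < (st.length + 1) * (n + 1) := by positivity
    refine maps_of_wp ⟨_, _, maps_nbrs x st, ?_⟩
    rw [List.length_cons, add_one_mul]
    have hiff := length_nbrs_le_one_iff (G := G) (p := x) (st := st)
    match G.nbrs x st, hiff with
    | [], hiff | [_], hiff =>
      rw [List.find?_cons_of_pos (by simpa using hiff)]
      exact ⟨rfl, by nlinarith⟩
    | _ :: _ :: _, hiff =>
      rw [List.find?_cons_of_neg (by simpa using hiff)]
      exact ⟨_, _, maps_findLeaf st l, rfl, by nlinarith⟩

theorem maps_order (l : List (Fin n)) (hl : l.length ≤ n) :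
    order.Maps (.cons (.ofGraph G) (.ofVertices l)) (.ofVertices (G.order l))
      ((l.length + 1) * (400 * (n + 1) ^ 3)) := by
  have hleaf := maps_findLeaf (G := G) (l.map Entry.root) l
  rw [List.length_map, List.map_map, show Entry.vertex ∘ Entry.root = (id : Fin n → _) from rfl,
    List.map_id] at hleaf
  have hleafCost : (l.length + 1) * ((l.length + 1) * (200 * (n + 1))) ≤ 200 * (n + 1) ^ 3 :=
    calc
      _ ≤ (n + 1) * ((n + 1) * (200 * (n + 1))) := by gcongr
      _ = _ := by ring
  rw [add_one_mul]
  refine maps_of_wp ⟨_, _, maps_roots l, _, _, hleaf.mono hleafCost, ?_⟩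
  match hfind : l.find? fun x => G.degTo x l ≤ 1 with
  | none =>
    rw [Multigraph.order_eq_nil hfind]
    exact ⟨rfl, by lia⟩
  | some x =>
    have hx := List.mem_of_find?_eq_some hfind
    have hlt := length_filter_notMem_singleton_lt hx
    have hdiffCost : (l.length + 1) * (80 * (n + 1) ^ 2) ≤ 80 * (n + 1) ^ 3 :=
      calc
        _ ≤ (n + 1) * (80 * (n + 1) ^ 2) := by gcongr
        _ = _ := by ring
    have hdiff := maps_diff (w := [x]) ((List.length_pos_of_mem hx).trans_le hl) l
    have hrec := maps_order (l.filter (· ∉ [x])) (hlt.le.trans hl)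
    rw [Multigraph.order_eq_cons hfind]
    refine ⟨_, _, hdiff.mono hdiffCost, _, _, hrec.mono (Nat.mul_le_mul_right _ hlt), rfl, by lia⟩
termination_by l.length

/-- The list and the number of a tally are small, which bounds the costs of computing with it. -/
def Tally.Bounded (s : ℕ) : Tally (Fin n) → Prop
  | none => True
  | some (w, c) => w.length ≤ s ∧ c < 2 ^ s

theorem maps_union {s : ℕ} {r r' : Tally (Fin n)} (h : r.Bounded s) (h' : r'.Bounded s) :
    union.Maps (.cons (.ofTally r) (.ofTally r')) (.ofTally (r.union r')) (200 * (s + 1)) := by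
  match r, r', h, h' with
  | none, _, _, _ => exact maps_of_wp ⟨rfl, by lia⟩
  | some _, none, _, _ => exact maps_of_wp ⟨rfl, by lia⟩
  | some (w, c), some (w', c'), ⟨hw, hc⟩, ⟨_, hc'⟩ =>
    have hlt := maps_lt (w.map .ofVertex) (w'.map .ofVertex)
    have hgt := maps_lt (w'.map .ofVertex) (w.map .ofVertex)
    simp only [List.length_map] at hlt hgt
    refine maps_of_wp ⟨_, _, hlt, ?_⟩
    rw [Tally.union]
    split_ifs with h1 h2
    · rw [decide_eq_true h1]
      exact ⟨rfl, by lia⟩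
    · rw [decide_eq_false h1]
      refine ⟨_, _, hgt, ?_⟩
      rw [decide_eq_true h2]
      exact ⟨rfl, by lia⟩
    · rw [decide_eq_false h1]
      refine ⟨_, _, hgt, ?_⟩
      rw [decide_eq_false h2]
      exact ⟨_, _, maps_add false hc hc', rfl, by lia⟩

theorem Tally.Bounded.insertOneOf {s : ℕ} {cl : List (Fin n)} {r : Tally (Fin n)}
    (h : r.Bounded s) (hcl : cl.length ≤ n) : (r.insertOneOf cl).Bounded (s + n) := by
  match r, cl, h, hcl with
  | none, _, _, _ => trivial
  | some _, [], _, _ => trivial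
  | some (w, c), v :: cl, ⟨hw, hc⟩, hcl =>
    rw [List.length_cons] at hcl
    refine ⟨by rw [List.length_cons]; lia, ?_⟩
    calc (v :: cl).length * c
      _ < (v :: cl).length * 2 ^ s := by gcongr; simp
      _ ≤ 2 ^ n * 2 ^ s := by gcongr; exact hcl.trans Nat.lt_two_pow_self.le
      _ = 2 ^ (s + n) := by rw [← pow_add, add_comm]

theorem maps_insertOneOf {s : ℕ} {cl : List (Fin n)} {r : Tally (Fin n)} (h : r.Bounded s)
    (hcl : cl.length ≤ n) :
    insertOneOf.Maps (.cons (.ofVertices cl) (.ofTally r)) (.ofTally (r.insertOneOf cl))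
      ((n + 1) * (140 * (s + n + 1))) := by
  have hbound := h.insertOneOf hcl
  match r, cl, h, hcl, hbound with
  | none, _, _, _, _ => exact maps_of_wp ⟨rfl, by nlinarith⟩
  | some _, [], _, _, _ => exact maps_of_wp ⟨rfl, by nlinarith⟩
  | some (w, c), v :: cl, ⟨_, hc⟩, hcl, hbound =>
    have hmul := maps_mul (l := (v :: cl).map .ofVertex) (s := s + n) (c := c)
      (by rw [List.length_map]; exact hbound.2) (hc.trans_le (by gcongr <;> lia))
    rw [List.length_map] at hmul
    have hcost : ((v :: cl).length + 1) * (80 * (s + n + 1) + 30) ≤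
        (n + 1) * (80 * (s + n + 1) + 30) := by gcongr
    exact maps_of_wp ⟨_, _, hmul, rfl, by lia⟩

end

/-! ### The size of the search tree -/

section

variable {V : Type*} [DecidableEq V] {st : List (Entry V)} {e : Entry V} {p : V}

/-- The number of the components that a state describes. -/
def numLabels (st : List (Entry V)) : ℕ :=
  (st.map Entry.label).toFinset.card

theorem numLabels_cons_le : numLabels (e :: st) ≤ numLabels st + 1 := by
  rw [numLabels, List.map_cons, List.toFinset_cons]
  exact Finset.card_insert_le ..

theorem label_mem (he : e ∈ st) : e.label ∈ (st.map Entry.label).toFinset :=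
  List.mem_toFinset.2 (List.mem_map_of_mem he)

theorem numLabels_cons_of_mem {x : V} {cl : List V} (he : e ∈ st) :
    numLabels (⟨x, cl, e.label⟩ :: st) = numLabels st :=
  have h := label_mem he
  congrArg Finset.card (List.toFinset_cons.trans (Finset.insert_eq_of_mem h))

theorem numLabels_relabel_lt (he : e ∈ st) (hp : Entry.root p ∈ st) (hep : e.label ≠ p) :
    numLabels (relabel e.label p st) < numLabels st := by
  refine (Finset.card_le_card fun b hb => ?_).trans_lt (Finset.card_erase_lt_of_mem (label_mem he))
  simp only [relabel, List.mem_toFinset, List.map_map, List.mem_map, Function.comp_apply] at hb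
  obtain ⟨e', he', rfl⟩ := hb
  rw [Finset.mem_erase]
  split_ifs with h
  exacts [⟨hep.symm, label_mem hp⟩, ⟨h, label_mem he'⟩]

end

/-- A bound for the number of leaves of the search tree, up to a constant factor, where `k` is the
remaining budget, `c` the number of components of the state and `j` the number of marked vertices.
A deletion spends a unit of the budget, and an edge that is kept between two components unites
them; only a branching on a marked vertex need not make progress, hence the last factor. -/
def leafBound (k c j : ℕ) : ℕ :=
  7 ^ k * 2 ^ c * 3 ^ j

theorem leafBound_pos (k c j : ℕ) : 0 < leafBound k c j := by
  unfold leafBound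
  positivity

theorem leafBound_mono {c c' : ℕ} (k j : ℕ) (h : c ≤ c') : leafBound k c j ≤ leafBound k c' j := by
  unfold leafBound
  gcongr
  exact one_le_two

theorem leafBound_succ_div_seven (k c j : ℕ) : leafBound (k + 1) c j / 7 = leafBound k c j := by
  rw [show leafBound (k + 1) c j = leafBound k c j * 7 by unfold leafBound; ring]
  exact Nat.mul_div_cancel _ (by decide)

theorem leafBound_succ_components (k c j : ℕ) : leafBound k (c + 1) j = 2 * leafBound k c j := by
  unfold leafBound
  ring

theorem leafBound_le_half {c c' : ℕ} (k j : ℕ) (h : c' < c) :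
    leafBound k c' j ≤ leafBound k c j / 2 := by
  rw [Nat.le_div_iff_mul_le two_pos, mul_comm, ← leafBound_succ_components]
  exact leafBound_mono k j h

theorem leafBound_succ_marked (k c j : ℕ) : leafBound k c (j + 1) = 3 * leafBound k c j := by
  unfold leafBound
  ring

/-- The factor of `leafBound` in the bound for the search tree of `link`, for `m` remaining edges.
Cutting an edge divides `leafBound` by `7` and keeping it divides it by `2`, so that the bound is
multiplied by `1 / 7 + 1 / 2 = 9 / 14`; the weights are `196 * (9 / 14) ^ m` for `m ≤ 2`. -/
def linkWeight : ℕ → ℕ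
  | 0 => 196
  | 1 => 126
  | _ + 2 => 81

theorem linkWeight_succ : ∀ m : ℕ, 9 * linkWeight m ≤ 14 * linkWeight (m + 1)
  | 0 | 1 | _ + 2 => by simp [linkWeight]

theorem linkWeight_le : ∀ m : ℕ, linkWeight m ≤ 196
  | 0 | 1 | _ + 2 => by simp [linkWeight]

theorem le_linkWeight : ∀ m : ℕ, 81 ≤ linkWeight m
  | 0 | 1 | _ + 2 => by simp [linkWeight]

theorem linkWeight_of_two_le : ∀ {m : ℕ}, 2 ≤ m → linkWeight m = 81
  | _ + 2, _ => rfl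

theorem linkWeight_split (m F : ℕ) :
    linkWeight m * (F / 7) + linkWeight m * (F / 2) ≤ linkWeight (m + 1) * F := by
  suffices 14 * (linkWeight m * (F / 7) + linkWeight m * (F / 2)) ≤ 14 * (linkWeight (m + 1) * F) by
    lia
  calc
    _ = linkWeight m * (2 * (7 * (F / 7)) + 7 * (2 * (F / 2))) := by ring
    _ ≤ linkWeight m * (2 * F + 7 * F) := by gcongr <;> exact Nat.mul_div_le ..
    _ = 9 * linkWeight m * F := by ring
    _ ≤ 14 * linkWeight (m + 1) * F := Nat.mul_le_mul_right F (linkWeight_succ m)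
    _ = _ := by ring

theorem proc_split {m k c j : ℕ} {z : Bool} (h : z = true ∨ 2 ≤ m) :
    196 * (leafBound k c j / 7) + linkWeight m * leafBound k (c + 1) j ≤
      196 * leafBound k c (j + z.toNat) := by
  have hdiv := Nat.mul_div_le (leafBound k c j) 7
  rw [leafBound_succ_components]
  cases z with
  | false =>
    rw [linkWeight_of_two_le (h.resolve_left Bool.false_ne_true), Bool.toNat_false, add_zero]
    lia
  | true =>
    have hweight : linkWeight m * (2 * leafBound k c j) ≤ 196 * (2 * leafBound k c j) :=
      Nat.mul_le_mul_right _ (linkWeight_le m)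
    rw [Bool.toNat_true, leafBound_succ_marked]
    lia

/-! ### The cost of the search -/

/-- A bound for the number of steps of a search on `n` vertices whose search tree has height at
most `h` and at most `X` leaves. -/
def searchCost (n h X : ℕ) : ℕ :=
  20 * (n + 1) ^ 2 * h * X

theorem searchCost_mono {h h' X X' : ℕ} (n : ℕ) (hh : h ≤ h') (hX : X ≤ X') :
    searchCost n h X ≤ searchCost n h' X' := by
  unfold searchCost
  gcongr

/-- The cost `c` of a node is charged to the increase of the height; `1620 = 20 * 81`, where
`81` is the least value of `linkWeight`. -/
theorem add_searchCost_le {n c h h₁ h₂ X₁ X₂ Y : ℕ} (hc : c ≤ 1620 * (n + 1) ^ 2) (h₁h : h₁ < h)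
    (h₂h : h₂ < h) (hX : X₁ + X₂ ≤ Y) (hY : 81 ≤ Y) :
    c + (searchCost n h₁ X₁ + searchCost n h₂ X₂) ≤ searchCost n h Y := by
  obtain ⟨h, rfl⟩ : ∃ h', h = h' + 1 := ⟨h - 1, by lia⟩
  unfold searchCost
  calc
    _ ≤ 20 * (n + 1) ^ 2 * 81 +
        (20 * (n + 1) ^ 2 * h * X₁ + 20 * (n + 1) ^ 2 * h * X₂) := by
      gcongr <;> lia
    _ = 20 * (n + 1) ^ 2 * 81 + 20 * (n + 1) ^ 2 * h * (X₁ + X₂) := by ring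
    _ ≤ 20 * (n + 1) ^ 2 * Y + 20 * (n + 1) ^ 2 * h * Y := by gcongr
    _ = _ := by ring

theorem add_searchCost_le_of_lt {n c h h' k b j : ℕ} (hc : c ≤ 1620 * (n + 1) ^ 2) (hh : h' < h) :
    c + searchCost n h' (196 * leafBound k b j) ≤ searchCost n h (196 * leafBound k b j) :=
  have hpos := leafBound_pos k b j
  add_searchCost_le (h₂ := h') (X₂ := 0) hc hh hh (add_zero _).le (by lia)

section

variable {n : ℕ} {G : Multigraph (Fin n)}

theorem Tally.Bounded.mono {s s' : ℕ} {r : Tally (Fin n)} (h : r.Bounded s) (hs : s ≤ s') :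
    r.Bounded s' :=
  match r, h with
  | none, _ => trivial
  | some _, ⟨hw, hc⟩ => ⟨hw.trans hs, hc.trans_le (Nat.pow_le_pow_right two_pos hs)⟩

theorem IsTally.bounded {k : ℕ} {F : Finset (Fin n) → Prop} :
    ∀ {r : Tally (Fin n)}, IsTally k F r → r.Bounded (n + 1)
  | none, _ => trivial
  | some (w, c), ⟨_, h⟩ => by
    have hw := h.nodup.length_le_card
    have hc := h.count_le
    rw [Fintype.card_fin] at hw hc
    exact ⟨by lia, hc.trans_lt (Nat.pow_lt_pow_right one_lt_two n.lt_succ_self)⟩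

theorem Tally.Bounded.spend {cl : List (Fin n)} {f : ℕ → Tally (Fin n)}
    (hf : ∀ k, (f k).Bounded (n + 1)) (hcl : cl.length ≤ n) :
    ∀ k, (Tally.spend cl f k).Bounded (2 * n + 1)
  | 0 => trivial
  | k + 1 => ((hf k).insertOneOf hcl).mono (by lia)

theorem wp_spend {env : List Data} {budget chain rest : Code} {cl : List (Fin n)}
    {f : ℕ → Tally (Fin n)} {k T : ℕ}
    (hbudget : wp prog budget env fun v t => v = .ofUnary k ∧ t ≤ 10)
    (hchain : wp prog chain env fun v t => v = .ofVertices cl ∧ t ≤ 20) (hcl : cl.length ≤ n)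
    (hrest : ∀ k', k = k' + 1 → wp prog rest env fun v t => v = .ofTally (f k') ∧ t ≤ T)
    (hf : ∀ k, (f k).Bounded (n + 1)) :
    wp prog (.spend budget chain rest) env fun v t =>
      v = .ofTally (Tally.spend cl f k) ∧ t ≤ 320 * (n + 1) ^ 2 + T := by
  have := Nat.one_le_pow 2 (n + 1) n.succ_pos
  simp only [Code.spend, Code.invoke, wp]
  refine wp_of_eq hbudget fun t ht => ?_
  cases k with
  | zero => exact ⟨rfl, by lia⟩
  | succ k =>
    have hinsert := maps_insertOneOf (hf k) hcl
    rw [show (n + 1) * (140 * (n + 1 + n + 1)) = 280 * (n + 1) ^ 2 by ring] at hinsert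
    exact wp_of_eq hchain fun t₁ h₁ => wp_of_eq (hrest k rfl) fun t₂ h₂ =>
      ⟨_, _, hinsert, rfl, by lia⟩

/-- The argument of the routine for `link`. -/
def linkArg (G : Multigraph (Fin n)) (p : Fin n) (rest : List (Fin n × Bool))
    (L st : List (Entry (Fin n))) (k : ℕ) : Data :=
  .cons (.ofGraph G) (.cons (.ofVertex p) (.cons (.ofState L) (.cons (.ofTodo rest)
    (.cons (.ofState st) (.ofUnary k)))))

/-- The argument of the routine for `Multigraph.proc`. -/
def procArg (G : Multigraph (Fin n)) (todo : List (Fin n × Bool)) (st : List (Entry (Fin n)))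
    (k : ℕ) : Data :=
  .cons (.ofGraph G) (.cons (.ofTodo todo) (.cons (.ofState st) (.ofUnary k)))

variable {p : Fin n} {rest : List (Fin n × Bool)} {L st : List (Entry (Fin n))}
  {e : Entry (Fin n)} {k h : ℕ}

theorem wp_linkDestroy {T : ℕ} {f : ℕ → Tally (Fin n)} (hcl : e.chain.length ≤ n)
    (hf : ∀ k, (f k).Bounded (n + 1))
    (hlink : ∀ k', k = k' + 1 →
      Routine.link.Maps (linkArg G p rest L st k') (.ofTally (f k')) T) :
    wp prog Code.linkDestroy [.ofEntry e, linkArg G p rest (e :: L) st k] fun v t =>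
      v = .ofTally (Tally.spend e.chain f k) ∧ t ≤ 360 * (n + 1) ^ 2 + T := by
  refine (wp_spend (budget := .last 1 5) (chain := .proj 0 1) (T := 40 + T) ⟨rfl, by lia⟩
    ⟨rfl, by lia⟩ hcl ?_ hf).mono fun v t ⟨hv, ht⟩ => ⟨hv, ht.trans (by nlinarith)⟩
  rintro k rfl
  exact ⟨_, _, hlink k rfl, rfl, by lia⟩

theorem wp_linkKeep {T : ℕ} {r : Tally (Fin n)} (hL : L.length ≤ 2 * n) (hst : st.length ≤ n)
    (hlink : e.label ≠ p →
      Routine.link.Maps (linkArg G p rest (relabel e.label p L) (relabel e.label p st) k)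
        (.ofTally r) T) :
    wp prog Code.linkKeep [.ofEntry e, linkArg G p rest (e :: L) st k] fun v t =>
      v = .ofTally (if e.label = p then none else r) ∧ t ≤ 420 * (n + 1) ^ 2 + T := by
  have := Nat.le_self_pow two_ne_zero (n + 1)
  have hcost {l : List (Entry (Fin n))} (hl : l.length ≤ 2 * n) :
      (l.length + 1) * (80 * (n + 1)) ≤ 160 * (n + 1) ^ 2 :=
    calc
      _ ≤ (2 * n + 2) * (80 * (n + 1)) := by gcongr; lia
      _ = _ := by ring
  refine ⟨_, _, maps_eq_vertex e.label p, ?_⟩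
  by_cases hep : e.label = p
  · rw [decide_eq_true hep, if_pos hep]
    exact ⟨rfl, by lia⟩
  · rw [decide_eq_false hep, if_neg hep]
    exact ⟨_, _, (maps_relabel _ _ L).mono (hcost hL), _, _,
      (maps_relabel _ _ st).mono (hcost (by lia)), _, _, hlink hep, rfl, by lia⟩

theorem maps_link_cons {T₁ T₂ : ℕ} {f : ℕ → Tally (Fin n)} {r : Tally (Fin n)}
    (hcl : e.chain.length ≤ n) (hL : L.length ≤ 2 * n) (hst : st.length ≤ n)
    (hf : ∀ k, (f k).Bounded (n + 1)) (hr : r.Bounded (n + 1))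
    (hdestroy : ∀ k', k = k' + 1 →
      Routine.link.Maps (linkArg G p rest L st k') (.ofTally (f k')) T₁)
    (hkeep : e.label ≠ p →
      Routine.link.Maps (linkArg G p rest (relabel e.label p L) (relabel e.label p st) k)
        (.ofTally r) T₂) :
    Routine.link.Maps (linkArg G p rest (e :: L) st k)
      (.ofTally ((Tally.spend e.chain f k).union (if e.label = p then none else r)))
      (1620 * (n + 1) ^ 2 + (T₁ + T₂)) := by
  have hr' : Tally.Bounded (2 * n + 1) (if e.label = p then none else r) := by
    split_ifs
    exacts [trivial, hr.mono (by lia)]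
  have hunion := maps_union (.spend hf hcl k) hr'
  have := Nat.le_self_pow two_ne_zero (n + 1)
  have hedges : wp prog (.proj 0 2) [linkArg G p rest (e :: L) st k] fun v t =>
      v = .cons (.ofEntry e) (.ofState L) ∧ t ≤ 10 := ⟨rfl, by lia⟩
  refine maps_of_wp ?_
  simp only [body, Code.invoke, wp]
  exact wp_of_eq hedges fun t ht => wp_of_eq hedges fun t' ht' =>
    wp_of_eq (wp_linkDestroy hcl hf hdestroy) fun t₁ h₁ =>
      wp_of_eq (wp_linkKeep hL hst hkeep) fun t₂ h₂ => ⟨_, _, hunion, rfl, by lia⟩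

theorem length_le_of_nodup {l : List (Fin n)} (h : l.Nodup) : l.length ≤ n :=
  h.length_le_card.trans_eq (Fintype.card_fin n)

theorem Multigraph.Inv.length_le {l : List (Fin n)} {L : List (Fin n)} (h : G.Inv L l st) :
    st.length ≤ n :=
  (List.length_map _).symm.trans_le (length_le_of_nodup h.nodup)

theorem bounded_link (hnodup : (rest.map Prod.fst).Nodup) (hord : G.Ordered rest)
    (hpl : p ∉ rest.map Prod.fst) (hsub : L ⊆ st) (hp : Entry.root p ∈ st)
    (hinv : G.Inv (L.map Entry.vertex) (rest.map Prod.fst) st) :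
    (CountFVS.link (G.proc rest) p L st k).Bounded (n + 1) :=
  (Multigraph.isTally_link (fun _ _ => Multigraph.isTally_proc hnodup hord) hpl hsub hp
    hinv).bounded

theorem maps_link {j : ℕ} (hnodup : (rest.map Prod.fst).Nodup) (hord : G.Ordered rest)
    (hpl : p ∉ rest.map Prod.fst)
    (hproc : ∀ {st k}, G.Inv [] (rest.map Prod.fst) st →
      proc.Maps (procArg G rest st k) (.ofTally (G.proc rest st k))
        (searchCost n h (196 * leafBound k (numLabels st) j))) :
    ∀ {L st : List (Entry (Fin n))} {k : ℕ}, L ⊆ st → Entry.root p ∈ st →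
      G.Inv (L.map Entry.vertex) (rest.map Prod.fst) st → L.length ≤ 2 * n →
      Routine.link.Maps (linkArg G p rest L st k)
        (.ofTally (CountFVS.link (G.proc rest) p L st k))
        (searchCost n (h + 1 + L.length)
          (linkWeight L.length * leafBound k (numLabels st) j))
  | [], st, k, _, _, hinv, _ => by
    have hcost := add_searchCost_le_of_lt (n := n) (k := k) (b := numLabels st) (j := j) le_rfl
      h.lt_succ_self
    have := Nat.one_le_pow 2 (n + 1) n.succ_pos
    rw [CountFVS.link]
    exact maps_of_wp ⟨_, _, hproc hinv, rfl, by simp only [List.length_nil, linkWeight]; lia⟩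
  | e :: L, st, k, hsub, hp, hinv, hlen => by
    obtain ⟨he, hsub⟩ := List.cons_subset.1 hsub
    rw [List.length_cons] at hlen
    have hskip (k) := maps_link hnodup hord hpl hproc (k := k) hsub hp hinv.tail (by lia)
    have hmerge := maps_link hnodup hord hpl hproc (k := k) (List.map_subset _ hsub)
      (root_mem_relabel (a := e.label) hp)
      (by rw [← CountFVS.relabel, map_vertex_relabel]; exact hinv.tail.relabel hpl)
      (by rw [List.length_map]; lia)
    rw [← CountFVS.relabel, length_relabel] at hmerge
    have hmergeBounded := bounded_link (k := k) hnodup hord hpl (List.map_subset _ hsub)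
      (root_mem_relabel (a := e.label) hp)
      (by rw [← CountFVS.relabel, map_vertex_relabel]; exact hinv.tail.relabel hpl)
    rw [CountFVS.link]
    refine (maps_link_cons (length_le_of_nodup (hinv.valid e he).chain_nodup) (by lia)
      hinv.length_le (fun k => bounded_link hnodup hord hpl hsub hp hinv.tail) hmergeBounded
      (T₁ := searchCost n (h + 1 + L.length)
        (linkWeight L.length * (leafBound k (numLabels st) j / 7)))
      (T₂ := searchCost n (h + 1 + L.length)
        (linkWeight L.length * (leafBound k (numLabels st) j / 2)))
      (fun k' hk => by simpa only [hk, leafBound_succ_div_seven] using hskip k')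
      fun hep => hmerge.mono (searchCost_mono n le_rfl
        (Nat.mul_le_mul_left _ (leafBound_le_half k j (numLabels_relabel_lt he hp hep))))).mono ?_
    have hY : 81 * 1 ≤ linkWeight (L.length + 1) * leafBound k (numLabels st) j :=
      Nat.mul_le_mul (le_linkWeight _) (leafBound_pos ..)
    exact add_searchCost_le le_rfl (by rw [List.length_cons]; lia) (by rw [List.length_cons]; lia)
      (linkWeight_split ..) hY
termination_by L => L.length
decreasing_by all_goals simp

end

section

variable {n : ℕ} {G : Multigraph (Fin n)} {p : Fin n} {z : Bool} {rest todo : List (Fin n × Bool)}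
  {L st : List (Entry (Fin n))} {e : Entry (Fin n)} {k h T T₁ T₂ : ℕ} {f : ℕ → Tally (Fin n)}
  {r : Tally (Fin n)}

theorem length_nbrs_le : (G.nbrs p st).length ≤ 2 * st.length := by
  simp only [Multigraph.nbrs, List.length_flatMap, List.length_replicate]
  refine (List.sum_le_card_nsmul _ 2 ?_).trans_eq ?_
  · exact List.forall_mem_map.2 fun e _ => min_le_left ..
  · rw [List.length_map, smul_eq_mul, mul_comm]

theorem wp_procBranch (hf : ∀ k, (f k).Bounded (n + 1)) (hr : r.Bounded (n + 1))
    (hdelete : ∀ k', k = k' + 1 → proc.Maps (procArg G rest st k') (.ofTally (f k')) T₁)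
    (hlink : Routine.link.Maps (linkArg G p rest L (Entry.root p :: st) k) (.ofTally r) T₂) :
    wp prog Code.procBranch [.ofState L, procArg G ((p, z) :: rest) st k] fun v t =>
      v = .ofTally ((Tally.spend [p] f k).union r) ∧ t ≤ 1400 * (n + 1) ^ 2 + (T₁ + T₂) := by
  have hcl : [p].length ≤ n := p.pos
  have hunion := maps_union (.spend hf hcl k) (hr.mono (s' := 2 * n + 1) (by lia))
  have := Nat.le_self_pow two_ne_zero (n + 1)
  have hspend : wp prog _ [.ofState L, procArg G ((p, z) :: rest) st k] _ :=
    wp_spend (budget := .last 1 3) (chain := .cons (.head (.head (.proj 1 1))) .nil)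
      (rest := .invoke proc (.cons (.proj 1 0) (.cons (.tail (.proj 1 1)) (.cons (.proj 1 2)
        (.tail (.last 1 3))))))
      (T := 40 + T₁) ⟨rfl, by lia⟩ ⟨rfl, by lia⟩ hcl
      (by rintro k rfl; exact ⟨_, _, hdelete k rfl, rfl, by lia⟩) hf
  simp only [Code.procBranch, Code.invoke, wp]
  exact wp_of_eq hspend fun t ht => ⟨_, _, hlink, _, _, hunion, rfl, by lia⟩

theorem maps_proc_nil : proc.Maps (procArg G [] st k) (Data.ofTally (n := n) (some ([], 1))) 20 :=
  maps_of_wp ⟨by simp [Data.ofTally, Data.ofVertices, Data.ofNat_of_ne_zero, Data.ofNat_zero,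
    Data.ofBool, Data.ofList], by lia⟩

theorem maps_nbrs_of_length_le (hst : st.length ≤ n) :
    nbrs.Maps (.cons (.ofGraph G) (.cons (.ofVertex p) (.ofState st))) (.ofState (G.nbrs p st))
      (150 * (n + 1) ^ 2) :=
  (maps_nbrs p st).mono <| calc
    _ ≤ (n + 1) * (150 * (n + 1)) := by gcongr
    _ = _ := by ring

theorem maps_proc_of_wp_procBranch (hst : st.length ≤ n)
    (hbranch : z = true ∨ 2 ≤ (G.nbrs p st).length)
    (h : wp prog Code.procBranch [.ofState (G.nbrs p st), procArg G ((p, z) :: rest) st k]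
      fun v t => v = .ofTally r ∧ t ≤ T) :
    proc.Maps (procArg G ((p, z) :: rest) st k) (.ofTally r) (220 * (n + 1) ^ 2 + T) := by
  have := Nat.one_le_pow 2 (n + 1) n.succ_pos
  have htodo : wp prog (.proj 0 1) [procArg G ((p, z) :: rest) st k] fun v t =>
      v = .cons (.cons (.ofVertex p) (.ofBool z)) (.ofTodo rest) ∧ t ≤ 10 := ⟨rfl, by lia⟩
  refine maps_of_wp ?_
  simp only [body, Code.invoke, wp]
  refine wp_of_eq htodo fun t ht => ⟨_, _, maps_nbrs_of_length_le hst, ?_⟩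
  have htodo' : wp prog (.proj 1 1) [.ofState (G.nbrs p st), procArg G ((p, z) :: rest) st k]
      fun v t => v = .cons (.cons (.ofVertex p) (.ofBool z)) (.ofTodo rest) ∧ t ≤ 10 :=
    ⟨rfl, by lia⟩
  refine wp_of_eq htodo' fun t' ht' => ?_
  match z, G.nbrs p st, hbranch, h with
  | true, _, _, h => exact wp_of_eq h fun t ht => ⟨rfl, by lia⟩
  | false, _ :: _ :: _, _, h => exact wp_of_eq h fun t ht => ⟨rfl, by lia⟩
  | false, [], hbranch, _ | false, [_], hbranch, _ => simp at hbranch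

theorem maps_proc_of_nil (hst : st.length ≤ n) (hnbrs : G.nbrs p st = [])
    (h : proc.Maps (procArg G rest st k) (.ofTally r) T) :
    proc.Maps (procArg G ((p, false) :: rest) st k) (.ofTally r) (220 * (n + 1) ^ 2 + T) := by
  have := Nat.one_le_pow 2 (n + 1) n.succ_pos
  refine maps_of_wp ⟨_, _, maps_nbrs_of_length_le hst, ?_⟩
  rw [hnbrs]
  exact ⟨_, _, h, rfl, by lia⟩

theorem maps_proc_of_singleton (hst : st.length ≤ n) (hnbrs : G.nbrs p st = [e])
    (h : proc.Maps (procArg G rest (⟨p, p :: e.chain, e.label⟩ :: st) k) (.ofTally r) T) :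
    proc.Maps (procArg G ((p, false) :: rest) st k) (.ofTally r) (220 * (n + 1) ^ 2 + T) := by
  have := Nat.one_le_pow 2 (n + 1) n.succ_pos
  refine maps_of_wp ⟨_, _, maps_nbrs_of_length_le hst, ?_⟩
  rw [hnbrs]
  exact ⟨_, _, h, rfl, by lia⟩

theorem bounded_proc (hnodup : (todo.map Prod.fst).Nodup) (hord : G.Ordered todo)
    (hinv : G.Inv [] (todo.map Prod.fst) st) : (G.proc todo st k).Bounded (n + 1) :=
  (Multigraph.isTally_proc hnodup hord hinv).bounded

theorem maps_proc_of_branch {j : ℕ} (hnodup : (rest.map Prod.fst).Nodup) (hord : G.Ordered rest)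
    (hpl : p ∉ rest.map Prod.fst) (hinv : G.Inv [] (p :: rest.map Prod.fst) st)
    (hbranch : z = true ∨ 2 ≤ (G.nbrs p st).length)
    (hproc : ∀ {st k}, G.Inv [] (rest.map Prod.fst) st →
      proc.Maps (procArg G rest st k) (.ofTally (G.proc rest st k))
        (searchCost n h (196 * leafBound k (numLabels st) j))) :
    proc.Maps (procArg G ((p, z) :: rest) st k) (.ofTally (G.proc ((p, z) :: rest) st k))
      (searchCost n (h + (2 * n + 2)) (196 * leafBound k (numLabels st) (j + z.toNat))) := by
  have hst := hinv.length_le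
  have hsub : G.nbrs p st ⊆ Entry.root p :: st := fun e he =>
    List.mem_cons_of_mem _ (Multigraph.mem_nbrs.1 he).1
  have hroot := hinv.root_cons hpl
  have hlen : (G.nbrs p st).length ≤ 2 * n := length_nbrs_le.trans (by lia)
  rw [Multigraph.proc_cons_of_branch hbranch]
  have hlink := (maps_link (k := k) hnodup hord hpl hproc hsub List.mem_cons_self hroot hlen).mono
    (searchCost_mono n le_rfl (Nat.mul_le_mul_left _ (leafBound_mono k j numLabels_cons_le)))
  have hwp := wp_procBranch (z := z)
    (T₁ := searchCost n h (196 * (leafBound k (numLabels st) j / 7)))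
    (fun k => bounded_proc hnodup hord hinv.skip)
    (bounded_link hnodup hord hpl hsub List.mem_cons_self hroot)
    (fun k' hk => by simpa only [hk, leafBound_succ_div_seven] using hproc hinv.skip) hlink
  refine (maps_proc_of_wp_procBranch hst hbranch hwp).mono ?_
  have hY := Nat.le_mul_of_pos_right 196 (leafBound_pos k (numLabels st) (j + z.toNat))
  have hcost : (220 + 1400) * (n + 1) ^ 2 + _ ≤ searchCost n (h + (2 * n + 2))
      (196 * leafBound k (numLabels st) (j + z.toNat)) :=
    add_searchCost_le (h₁ := h) (h₂ := h + 1 + (G.nbrs p st).length) (by lia) (by lia) (by lia)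
      (proc_split hbranch) (hY.trans' (by decide))
  lia

theorem maps_proc : ∀ {todo : List (Fin n × Bool)} {st : List (Entry (Fin n))} {k : ℕ},
    (todo.map Prod.fst).Nodup → G.Ordered todo → G.Inv [] (todo.map Prod.fst) st →
      proc.Maps (procArg G todo st k) (.ofTally (G.proc todo st k))
        (searchCost n (todo.length * (2 * n + 2) + 1)
          (196 * leafBound k (numLabels st) (todo.countP (·.2))))
  | [], st, k, _, _, _ => by
    have := Nat.one_le_pow 2 (n + 1) n.succ_pos
    rw [Multigraph.proc, List.length_nil, zero_mul, zero_add]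
    exact maps_proc_nil.mono ((Nat.le_add_right ..).trans
      (add_searchCost_le_of_lt (n := n) (by lia) one_pos))
  | (p, z) :: rest, st, k, hnodup, hord, hinv => by
    obtain ⟨hpl, hnodup⟩ := List.nodup_cons.1 hnodup
    have hst := hinv.length_le
    have ih {st k} (hinv : G.Inv [] (rest.map Prod.fst) st) :=
      maps_proc (k := k) hnodup hord.2 hinv
    by_cases hbranch : z = true ∨ 2 ≤ (G.nbrs p st).length
    · have hcount : ((p, z) :: rest).countP (·.2) = rest.countP (·.2) + z.toNat := by
        cases z <;> simp
      rw [hcount, List.length_cons, add_one_mul, add_right_comm]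
      exact maps_proc_of_branch hnodup hord.2 hpl hinv hbranch ih
    · obtain ⟨hz, hlen⟩ := not_or.1 hbranch
      rw [Bool.not_eq_true] at hz
      subst hz
      have hcost : 220 * (n + 1) ^ 2 + _ ≤ searchCost n
          (((p, false) :: rest).length * (2 * n + 2) + 1)
          (196 * leafBound k (numLabels st) (rest.countP (·.2))) :=
        add_searchCost_le_of_lt (h' := rest.length * (2 * n + 2) + 1) (by lia)
          (by rw [List.length_cons, add_one_mul]; lia)
      match hnbrs : G.nbrs p st with
      | [] =>
        rw [Multigraph.proc_cons_of_nil hnbrs]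
        exact (maps_proc_of_nil hst hnbrs (ih hinv.skip)).mono hcost
      | [e] =>
        rw [Multigraph.proc_cons_of_singleton hnbrs]
        obtain ⟨he, hpe⟩ : e ∈ st ∧ 0 < G.mult s(p, e.vertex) :=
          Multigraph.mem_nbrs.1 (hnbrs ▸ by simp)
        have hmaps := maps_proc_of_singleton (k := k) hst hnbrs
          (ih (hinv.chain_cons hpl (hord.1 rfl) he hpe))
        rw [numLabels_cons_of_mem he] at hmaps
        exact hmaps.mono hcost
      | _ :: _ :: _ => simp [hnbrs] at hlen

end

/-! ### The cost of the iterative compression -/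

section

variable {n : ℕ} {G : Multigraph (Fin n)} {v : Fin n} {vs w : List (Fin n)} {c k : ℕ}

theorem leafBound_zero_le {j : ℕ} (h : j ≤ k) : leafBound k 0 (j + 1) ≤ 3 * 21 ^ k := by
  calc
    _ = 3 * (7 ^ k * 3 ^ j) := by unfold leafBound; ring
    _ ≤ 3 * (7 ^ k * 3 ^ k) := by gcongr; decide
    _ = 3 * 21 ^ k := by rw [← mul_pow]; rfl

theorem countP_nextTodo : (G.nextTodo v vs w).countP (·.2) = w.length + 1 := by
  simp [Multigraph.nextTodo, List.countP_map, Function.comp_def]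

theorem maps_proc_nextTodo (hnodup : (v :: vs).Nodup)
    (htally : IsTally k (fun S => G.AcyclicOn (vs.toFinset \ S)) (some (w, c))) :
    proc.Maps (procArg G (G.nextTodo v vs w) [] k) (.ofTally (G.proc (G.nextTodo v vs w) [] k))
      (23520 * ((n + 1) ^ 4 * 21 ^ k)) := by
  obtain ⟨hk, hmin⟩ := htally
  have hvs := hnodup.of_cons
  have hperm := Multigraph.nextTodo_perm (v := v) hvs hmin.nodup
    (Multigraph.subset_of_isMinCount hmin) hmin.mem
  have hlen : (G.nextTodo v vs w).length ≤ n := by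
    rw [← List.length_map Prod.fst, hperm.length_eq]
    exact length_le_of_nodup hnodup
  refine (maps_proc (hperm.nodup_iff.2 hnodup) (Multigraph.ordered_nextTodo hvs hmin.mem)
    (Multigraph.inv_nil _)).mono ?_
  have hheight : (G.nextTodo v vs w).length * (2 * n + 2) + 1 ≤ 2 * (n + 1) ^ 2 := by
    nlinarith
  have hleaves : leafBound k 0 ((G.nextTodo v vs w).countP (·.2)) ≤ 3 * 21 ^ k := by
    rw [countP_nextTodo]
    exact leafBound_zero_le hk
  calc
    _ ≤ searchCost n (2 * (n + 1) ^ 2) (196 * (3 * 21 ^ k)) :=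
      searchCost_mono n hheight (Nat.mul_le_mul_left _ hleaves)
    _ = _ := by unfold searchCost; ring

/-- The argument of the routine for `Multigraph.solve`. -/
def solveArg (G : Multigraph (Fin n)) (k : ℕ) (vs : List (Fin n)) : Data :=
  .cons (.ofGraph G) (.cons (.ofUnary k) (.ofVertices vs))

theorem maps_order_filter (hvs : vs.length ≤ n) :
    order.Maps (.cons (.ofGraph G) (.ofVertices (vs.filter (· ∉ w))))
      (.ofVertices (G.order (vs.filter (· ∉ w)))) (400 * (n + 1) ^ 4) := by
  have hlen := (List.length_filter_le (· ∉ w) vs).trans hvs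
  refine (maps_order _ hlen).mono ?_
  calc
    _ ≤ (n + 1) * (400 * (n + 1) ^ 3) := by gcongr
    _ = _ := by ring

theorem wp_nextTodo (hvs : vs.length ≤ n) (hw : w.length ≤ n)
    (horder : (G.order (vs.filter (· ∉ w))).length ≤ n) :
    wp prog Code.nextTodo [.ofTally (some (w, c)), solveArg G k (v :: vs)] fun d t =>
      d = .ofTodo (G.nextTodo v vs w) ∧ t ≤ 700 * (n + 1) ^ 4 := by
  have hdiff := (maps_diff hw vs).mono (T' := 80 * (n + 1) ^ 4) <| calc
    _ ≤ (n + 1) * (80 * (n + 1) ^ 2) := by gcongr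
    _ = 80 * (n + 1) ^ 3 := by ring
    _ ≤ _ := by gcongr <;> lia
  have hunmarked := maps_mark false [] (G.order (vs.filter (· ∉ w)))
  rw [List.append_nil] at hunmarked
  have := Nat.le_self_pow four_ne_zero (n + 1)
  simp only [Code.nextTodo, Code.invoke, wp]
  exact ⟨_, _, hdiff, _, _, maps_order_filter hvs, _, _, hunmarked, _, _, maps_mark true _ w,
    rfl, by lia⟩

theorem maps_solve_nil :
    solve.Maps (solveArg G k []) (Data.ofTally (n := n) (some ([], 1))) 20 :=
  maps_of_wp ⟨by simp [Data.ofTally, Data.ofVertices, Data.ofNat_of_ne_zero, Data.ofNat_zero,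
    Data.ofBool, Data.ofList], by lia⟩

theorem maps_solve_cons_of_none {T : ℕ}
    (h : solve.Maps (solveArg G k vs) (Data.ofTally (n := n) none) T) :
    solve.Maps (solveArg G k (v :: vs)) (Data.ofTally (n := n) none) (T + 100) :=
  maps_of_wp ⟨_, _, h, rfl, by lia⟩

theorem maps_solve_cons_of_some {T : ℕ} (hnodup : (v :: vs).Nodup)
    (htally : IsTally k (fun S => G.AcyclicOn (vs.toFinset \ S)) (some (w, c)))
    (h : solve.Maps (solveArg G k vs) (.ofTally (some (w, c))) T) :
    solve.Maps (solveArg G k (v :: vs)) (.ofTally (G.proc (G.nextTodo v vs w) [] k))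
      (T + 25000 * ((n + 1) ^ 4 * 21 ^ k)) := by
  have hvs := hnodup.of_cons
  have horder := (Multigraph.order_perm _ (hvs.filter (· ∉ w))
    (Multigraph.acyclicOn_toFinset_filter htally.2.mem)).length_eq
  have hnext : wp prog _ [_, solveArg G k (v :: vs)] _ := wp_nextTodo (c := c)
    (length_le_of_nodup hvs) (length_le_of_nodup htally.2.nodup)
    (horder.trans_le (length_le_of_nodup (hvs.filter _)))
  have hpow : (n + 1) ^ 4 ≤ (n + 1) ^ 4 * 21 ^ k := Nat.le_mul_of_pos_right _ (by positivity)
  have := Nat.one_le_pow 4 (n + 1) n.succ_pos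
  refine maps_of_wp ?_
  simp only [body, Code.invoke, Code.proj, Code.last, Code.tails, wp]
  refine ⟨_, _, h, ?_⟩
  exact wp_of_eq hnext fun t ht => ⟨_, _, maps_proc_nextTodo hnodup htally, rfl, by lia⟩

theorem maps_solve : ∀ {vs : List (Fin n)}, vs.Nodup →
    solve.Maps (solveArg G k vs) (.ofTally (G.solve k vs))
      ((vs.length + 1) * (25000 * ((n + 1) ^ 4 * 21 ^ k)))
  | [], _ => by
    have : 1 ≤ (n + 1) ^ 4 * 21 ^ k := Nat.one_le_iff_ne_zero.2 (by positivity)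
    exact maps_solve_nil.mono (by rw [List.length_nil]; lia)
  | v :: vs, hnodup => by
    have hmaps := maps_solve hnodup.of_cons
    have htally := Multigraph.isTally_solve (G := G) (k := k) hnodup.of_cons
    rw [Multigraph.solve, List.length_cons, add_one_mul (vs.length + 1)]
    match hsolve : G.solve k vs with
    | none =>
      rw [hsolve] at hmaps
      have : 1 ≤ (n + 1) ^ 4 * 21 ^ k := Nat.one_le_iff_ne_zero.2 (by positivity)
      exact (maps_solve_cons_of_none hmaps).mono (by lia)
    | some (w, c) =>
      rw [hsolve] at hmaps htally
      exact maps_solve_cons_of_some hnodup htally hmaps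

theorem ofList_range' : Data.ofList ((List.range' 0 n).map Data.ofUnary) =
    .ofVertices (List.finRange n) := by
  rw [← List.range_eq_range', Data.ofVertices, ← List.map_coe_finRange_eq_range, List.map_map]
  rfl

theorem tail_ofTally : ∀ r : Tally (Fin n), (Data.ofTally r).tail = .ofNat r.count
  | none => Data.ofNat_zero.symm
  | some _ => rfl

theorem maps_main (G : Multigraph (Fin n)) (k : ℕ) :
    main.Maps (encodeInstance G k) (.ofNat (G.numMinFVS k)) (26000 * ((n + 1) ^ 5 * 21 ^ k)) := by
  have hvertices := maps_vertices (List.ofFn fun u : Fin n =>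
    .ofList (List.ofFn fun v : Fin n => .ofNat (G.mult s(u, v)))) 0
  rw [List.length_ofFn, ofList_range'] at hvertices
  have hsolve := maps_solve (G := G) (k := k) (List.nodup_finRange n)
  rw [List.length_finRange, show (n + 1) * (25000 * ((n + 1) ^ 4 * 21 ^ k)) =
    25000 * ((n + 1) ^ 5 * 21 ^ k) by ring] at hsolve
  have hresult := tail_ofTally (G.solve k (List.finRange n))
  rw [Multigraph.count_solve (List.nodup_finRange n) List.mem_finRange] at hresult
  have hk : k < (n + 1) ^ 5 * 21 ^ k :=
    (Nat.lt_pow_self (by decide)).trans_le (Nat.le_mul_of_pos_left _ (by positivity))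
  have hn : n + 1 ≤ (n + 1) ^ 5 * 21 ^ k :=
    (Nat.le_self_pow (by decide) _).trans (Nat.le_mul_of_pos_right _ (by positivity))
  exact maps_of_wp ⟨_, _, maps_toUnary k, _, _, hvertices, _, _, hsolve, hresult, by lia⟩

end

end CountFVS

theorem mainTheorem3_general :
    ∃ (P : CountFVS.Program) (p : Polynomial ℕ),
      ∀ (n : ℕ) (G : CountFVS.Multigraph (Fin n)) (k : ℕ),
        ∃ t : ℕ, t ≤ 21 ^ k * p.eval n ∧
          P.Computes (CountFVS.encodeInstance G k) (CountFVS.Data.ofNat (G.numMinFVS k)) t := by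
  refine ⟨CountFVS.prog, 26002 * (Polynomial.X + 1) ^ 5, fun n G k => ?_⟩
  obtain ⟨b, t, hbody, heval, ht⟩ := CountFVS.maps_main G k
  refine ⟨1 + t + 1, ?_, .call hbody (.var _ 0) heval⟩
  have hpos : 0 < (n + 1) ^ 5 * 21 ^ k := by positivity
  simp only [Polynomial.eval_mul, Polynomial.eval_ofNat, Polynomial.eval_pow, Polynomial.eval_add,
    Polynomial.eval_X, Polynomial.eval_one]
  lia

/-- There is an algorithm that, given a graph `G` on `n` vertices (with parallel edges allowed)
and a natural number `k`, computes `#minFVS(G, k)` in time `26 ^ k * poly(n)`, hence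
in time `2 ^ O(k) * poly(n)`. -/
theorem mainTheorem3 :
    ∃ (P : CountFVS.Program) (p : Polynomial ℕ),
      ∀ (n : ℕ) (G : CountFVS.Multigraph (Fin n)) (k : ℕ),
        ∃ t : ℕ, t ≤ 26 ^ k * p.eval n ∧
          P.Computes (CountFVS.encodeInstance G k) (CountFVS.Data.ofNat (G.numMinFVS k)) t := by
  obtain ⟨P, p, hP⟩ := mainTheorem3_general
  refine ⟨P, p, fun n G k => ?_⟩
  obtain ⟨t, ht, hcomputes⟩ := hP n G k
  exact ⟨t, ht.trans (by gcongr; decide), hcomputes⟩
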